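/- **Setting.** Let $p>0$, $b<d$, $k>0$, $\theta\in(-\pi/2,\pi/2)$, $\hat\alpha=k\sin\theta$, and for $n\in\mathbb Z$ let $\alpha_n=\hat\alpha+\frac{2\pi}{p}n$, and $\beta_n=\sqrt{k^2-\alpha_n^2}$ if $\alpha_n^2\le k^2$, $\beta_n=i\sqrt{\alpha_n^2-k^2}$ otherwise. Let $\tilde q=1$ for $x_2>d$, $\tilde q=q_0(x_1,x_2)$ for $b<x_2<d$ and $\tilde q=q(x_2)$ for $x_2<b$, where $q_0\in L^\infty(\mathbb R\times(b,d);\mathbb C)$ is $p$-periodic in $x_1$ with $\operatorname{Im}q_0\ge 0$ and $\operatorname{Re}q_0>0$, and $q\in L^\infty(\mathbb R;\mathbb R)$ is positive and $2\pi$-periodic. *Downward modes.* Let $w_{n,1},w_{n,2}$ be the solutions of $u''+(k^2q-\alpha_n^2)u=0$ on $\mathbb R$ with $w_{n,1}(0)=w_{n,2}'(0)=1$, $w_{n,1}'(0)=w_{n,2}(0)=0$. Put $$W_n=\begin{pmatrix}w_{n,1}(2\pi)&w_{n,2}(2\pi)\\ w_{n,1}'(2\pi)&w_{n,2}'(2\pi)\end{pmatrix},\qquad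 \eta_n=\operatorname{tr}W_n .$$ Assume (Assumption A) that $W_n\ne I$ whenever $\eta_n=2$ and $W_n\neq -I$ whenever $\eta_n=-2$. The $n$-th downward mode $u_n^-$ is the nontrivial solution, unique up to a constant factor, of the form $u_n^-(t)=e^{m_nt}v_n(t)$ with $v_n$ $2\pi$-periodic, where: $m_n=\mu>0$ with $e^{2\pi\mu}$ an eigenvalue of $W_n$ if $\eta_n>2$; $m_n=\mu+\frac i2$, $\mu>0$, with $-e^{2\pi\mu}$ an eigenvalue of $W_n$ if $\eta_n<-2$; $m_n=-i\vartheta$, $\vartheta\in(0,\frac12)$, with $e^{2\pi i\vartheta}$ an eigenvalue of $W_n$ if $|\eta_n|<2$; $m_n=0$ if $\eta_n=2$; $m_n=\frac i2$ if $\eta_n=-2$. Assume $u_n^-(b)\ne 0$ for all $n$, and put $\tau_n=-(u_n^-)'(b)/u_n^-(b)$. *The form.* Let $C=(0,p)\times(b,d)$, and let $H^1_{\hat\alpha}(C)$ be the space of the (restrictions to $C$ of) functions $u$ on $\mathbb R\times(b,d)$ such that $e^{-i\hat\alpha x_1}u$ is $p$-periodic in $x_1$ and $u$ has a weak gradient there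 with $u,\nabla u\in L^2(C)$, with norm $(\|u\|_{L^2(C)}^2+\|\nabla u\|_{L^2(C)}^2)^{1/2}$. Let $u_n(d)$, $u_n(b)$ be the coefficients of the traces $u(x_1,d)=\sum_n u_n(d)e^{i\alpha_nx_1}$ and $u(x_1,b)=\sum_n u_n(b)e^{i\alpha_nx_1}$. The upward and downward Dirichlet-to-Neumann maps are $T\sum_n f_ne^{i\alpha_nx_1}=\sum_n i\beta_nf_ne^{i\alpha_nx_1}$ on $x_2=d$ and $T^-\sum_n f_ne^{i\alpha_nx_1}=\sum_n\tau_nf_ne^{i\alpha_nx_1}$ on $x_2=b$. Consider $$a(u,v)=\int_C\big(\nabla u\cdot\nabla\bar v-k^2\tilde q\,u\bar v\big)\,dx-\int_0^p Tu\,\bar v\,ds\Big|_{x_2=d}-\int_0^p T^-u\,\bar v\,ds\Big|_{x_2=b},$$ the boundary integrals denoting the dualities $p\sum_n i\beta_nu_n(d)\overline{v_n(d)}$ and $p\sum_n\tau_nu_n(b)\overline{v_n(b)}$. **Theorem.** These series converge absolutely for all $u,v\in H^1_{\hat\alpha}(C)$, and the sesquilinear form $a$ on $H^1_{\hat\alpha}(C)\times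 H^1_{\hat\alpha}(C)$ is strongly elliptic, i.e. $a=B-Q$ with a bounded sesquilinear form $B$ that is coercive ($\operatorname{Re}B(u,u)\ge c\|u\|^2$ for all $u$, with some $c>0$) and a bounded sesquilinear form $Q$ that is compact ($u\mapsto Q(u,\cdot)$ is a compact operator into the antidual). More precisely, there is $N\in\mathbb N$ such that $\tau_n$ is real and negative for all $|n|>N$ and such that $$B(u,v)=\int_C\big(\nabla u\cdot\nabla\bar v+u\bar v\big)\,dx-p\sum_n i\beta_nu_n(d)\overline{v_n(d)}-p\sum_{|n|>N}\tau_nu_n(b)\overline{v_n(b)},$$ $$Q(u,v)=\int_C(k^2\tilde q+1)\,u\bar v\,dx+p\sum_{|n|\le N}\tau_nu_n(b)\overline{v_n(b)}$$ are, respectively, coercive and compact (both bounded), with $a=B-Q$. -/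

import Mathlib

open MeasureTheory Filter
open scoped ComplexConjugate ContDiff

noncomputable section

/-- The data of the diffraction problem with its standing assumptions: a homogeneous cover
`x₂ > d`, a grating `b < x₂ < d` of horizontal period `p` and index `q₀`, and a substrate
`x₂ < b` whose real index `q` depends on `x₂` only and is `2π`-periodic (`q` is extended
periodically to `ℝ`); `k` is the wavenumber and `θ` the angle of incidence. -/
structure GratingProblem where
  p : ℝ
  b : ℝ
  d : ℝ
  k : ℝ
  θ : ℝ
  q : ℝ → ℝ
  q₀ : ℝ × ℝ → ℂ
  p_pos : 0 < p
  b_lt_d : b < d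
  k_pos : 0 < k
  θ_mem : θ ∈ Set.Ioo (-(Real.pi / 2)) (Real.pi / 2)
  q_periodic : Function.Periodic q (2 * Real.pi)
  q_bounded : MemLp q ⊤ volume
  q_pos : ∀ᵐ t : ℝ, 0 < q t
  q₀_periodic : ∀ x₁ x₂ : ℝ, x₂ ∈ Set.Ioo b d → q₀ (x₁ + p, x₂) = q₀ (x₁, x₂)
  q₀_bounded : MemLp q₀ ⊤ (volume.restrict (Set.univ ×ˢ Set.Ioo b d))
  q₀_im_nonneg : ∀ᵐ x ∂(volume.restrict (Set.univ ×ˢ Set.Ioo b d)), 0 ≤ (q₀ x).im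
  q₀_re_pos : ∀ᵐ x ∂(volume.restrict (Set.univ ×ˢ Set.Ioo b d)), 0 < (q₀ x).re

/-! ### Traces on horizontal lines and Fourier coefficients -/

/-- The trace on `x₂ = d` of a function `u` on `b < x₂ < d` with weak derivative `g = ∂₂u`:
`(d - b) u(x₁, d) = ∫_b^d ∂₂((t - b) u(x₁, t)) dt`.  The right-hand side depends continuously on
`(u, g)` in `L²`, and it is the restriction of `u` when `u` is smooth up to the boundary
(`traceAbove_eq`), so this is the usual trace operator. -/
def traceAbove (b d : ℝ) (u g : ℝ × ℝ → ℂ) (x₁ : ℝ) : ℂ :=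
  ((d - b : ℝ) : ℂ)⁻¹ * ∫ t in b..d, (u (x₁, t) + ((t - b : ℝ) : ℂ) * g (x₁, t))

/-- The trace on `x₂ = b`: `(d - b) u(x₁, b) = ∫_b^d ∂₂((t - d) u(x₁, t)) dt`. -/
def traceBelow (b d : ℝ) (u g : ℝ × ℝ → ℂ) (x₁ : ℝ) : ℂ :=
  ((d - b : ℝ) : ℂ)⁻¹ * ∫ t in b..d, (u (x₁, t) + ((t - d : ℝ) : ℂ) * g (x₁, t))

theorem integral_shift_mul_deriv (b d c : ℝ) (f g : ℝ → ℂ)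
    (hf : ∀ t, HasDerivAt f (g t) t) (hg : Continuous g) :
    ∫ t in b..d, (f t + ((t - c : ℝ) : ℂ) * g t)
      = ((d - c : ℝ) : ℂ) * f d - ((b - c : ℝ) : ℂ) * f b := by
  have hc : Continuous f := continuous_iff_continuousAt.2 fun t => (hf t).continuousAt
  refine intervalIntegral.integral_eq_sub_of_hasDerivAt
    (f := fun t => ((t - c : ℝ) : ℂ) * f t) (fun t _ => ?_)
    (Continuous.intervalIntegrable (by fun_prop) b d)
  have h1 : HasDerivAt (fun s : ℝ => ((s - c : ℝ) : ℂ)) ((1 : ℝ) : ℂ) t :=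
    ((hasDerivAt_id t).sub_const c).ofReal_comp
  have h2 : HasDerivAt (fun s : ℝ => ((s - c : ℝ) : ℂ) * f s)
      (((1 : ℝ) : ℂ) * f t + ((t - c : ℝ) : ℂ) * g t) t := h1.mul (hf t)
  rwa [Complex.ofReal_one, one_mul] at h2

theorem traceAbove_eq {b d : ℝ} (hbd : b < d) (u g : ℝ × ℝ → ℂ) (x₁ : ℝ)
    (hu : ∀ t, HasDerivAt (fun s => u (x₁, s)) (g (x₁, t)) t)
    (hg : Continuous fun t => g (x₁, t)) :
    traceAbove b d u g x₁ = u (x₁, d) := by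
  have h0 : ((d - b : ℝ) : ℂ) ≠ 0 := by exact_mod_cast (sub_pos.2 hbd).ne'
  rw [traceAbove, integral_shift_mul_deriv b d b _ _ hu hg, sub_self, Complex.ofReal_zero,
    zero_mul, sub_zero, inv_mul_cancel_left₀ h0]

theorem traceBelow_eq {b d : ℝ} (hbd : b < d) (u g : ℝ × ℝ → ℂ) (x₁ : ℝ)
    (hu : ∀ t, HasDerivAt (fun s => u (x₁, s)) (g (x₁, t)) t)
    (hg : Continuous fun t => g (x₁, t)) :
    traceBelow b d u g x₁ = u (x₁, b) := by
  have h0 : ((d - b : ℝ) : ℂ) ≠ 0 := by exact_mod_cast (sub_pos.2 hbd).ne'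
  rw [traceBelow, integral_shift_mul_deriv b d d _ _ hu hg, sub_self, Complex.ofReal_zero,
    zero_mul, zero_sub, ← neg_mul, ← Complex.ofReal_neg, neg_sub, inv_mul_cancel_left₀ h0]

/-! ### Hill's equation -/

/-- `u'' + V u = 0` on `ℝ` in the sense of Carathéodory: `u` is differentiable and `u'` is an
indefinite integral of `-V u` (so `u` is `C¹`, and the equation holds almost everywhere). -/
def IsHillSolution {E : Type} [NormedAddCommGroup E] [NormedSpace ℝ E]
    (V : ℝ → ℝ) (u : ℝ → E) : Prop :=
  Differentiable ℝ u ∧ ∀ x, deriv u x = deriv u 0 - ∫ t in (0 : ℝ)..x, V t • u t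

/-- The solution of `u'' + V u = 0`, `u(0) = a₀`, `u'(0) = a₁`. -/
def hillSolution (V : ℝ → ℝ) (a₀ a₁ : ℝ) : ℝ → ℝ :=
  Classical.epsilon fun w => IsHillSolution V w ∧ w 0 = a₀ ∧ deriv w 0 = a₁

/-! ### Forms on a Hilbert space -/

section Forms

variable {H : Type} [NormedAddCommGroup H] [InnerProductSpace ℂ H]

/-- `B` is a bounded sesquilinear form (linear in the first, conjugate linear in the second
argument) with `Re B(u, u) ≥ c ‖u‖²` for some `c > 0`. -/
def IsCoerciveForm (B : H → H → ℂ) : Prop :=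
  (∃ B' : H →L[ℂ] H →L⋆[ℂ] ℂ, ∀ u v, B u v = B' u v) ∧
    ∃ c : ℝ, 0 < c ∧ ∀ u, c * ‖u‖ ^ 2 ≤ (B u u).re

/-- `Q` is a compact sesquilinear form: a bounded one for which `u ↦ Q(u, ·)` is a compact
operator from `H` to its antidual. -/
def IsCompactForm (Q : H → H → ℂ) : Prop :=
  ∃ Q' : H →L[ℂ] H →L⋆[ℂ] ℂ, (∀ u v, Q u v = Q' u v) ∧ IsCompactOperator Q'

/-- A form is strongly elliptic if it is a coercive form minus a compact form. -/
def IsStronglyElliptic (a : H → H → ℂ) : Prop :=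
  ∃ B Q : H → H → ℂ, IsCoerciveForm B ∧ IsCompactForm Q ∧ ∀ u v, a u v = B u v - Q u v

end Forms

namespace GratingProblem

variable (S : GratingProblem)

/-- The refractive index `q̃` of the whole plane. -/
def refractiveIndex (x : ℝ × ℝ) : ℂ :=
  if S.d < x.2 then 1 else if S.b < x.2 then S.q₀ x else (S.q x.2 : ℂ)

/-- `α̂ = k sin θ`. -/
def αhat : ℝ := S.k * Real.sin S.θ

/-- `αₙ = α̂ + 2πn/p`. -/
def α (n : ℤ) : ℝ := S.αhat + 2 * Real.pi / S.p * n

/-- `βₙ = √(k² - αₙ²)`, with non-negative imaginary part. -/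
def β (n : ℤ) : ℂ :=
  if S.α n ^ 2 ≤ S.k ^ 2 then (Real.sqrt (S.k ^ 2 - S.α n ^ 2) : ℂ)
  else Complex.I * (Real.sqrt (S.α n ^ 2 - S.k ^ 2) : ℂ)

/-- The coefficients `fₙ` in `f(x₁) = ∑ₙ fₙ exp(i αₙ x₁)`. -/
def fourierCoefficient (f : ℝ → ℂ) (n : ℤ) : ℂ :=
  ((1 / S.p : ℝ) : ℂ) * ∫ x in (0 : ℝ)..S.p, f x * Complex.exp (-(Complex.I * S.α n * x))

/-! ### Wave modes in the substrate -/

/-- The potential `k² q - αₙ²` of the `n`-th Hill equation. -/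
def hillPotential (n : ℤ) (t : ℝ) : ℝ := S.k ^ 2 * S.q t - S.α n ^ 2

def w₁ (n : ℤ) : ℝ → ℝ := hillSolution (S.hillPotential n) 1 0

def w₂ (n : ℤ) : ℝ → ℝ := hillSolution (S.hillPotential n) 0 1

/-- The monodromy matrix `Wₙ`. -/
def monodromy (n : ℤ) : Matrix (Fin 2) (Fin 2) ℝ :=
  !![S.w₁ n (2 * Real.pi), S.w₂ n (2 * Real.pi);
     deriv (S.w₁ n) (2 * Real.pi), deriv (S.w₂ n) (2 * Real.pi)]

/-- `ηₙ = wₙ₁(2π) + wₙ₂'(2π)`. -/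
def η (n : ℤ) : ℝ := S.w₁ n (2 * Real.pi) + deriv (S.w₂ n) (2 * Real.pi)

/-- The characteristic multipliers are the eigenvalues of the monodromy matrix. -/
def IsCharacteristicMultiplier (n : ℤ) (l : ℂ) : Prop :=
  Module.End.HasEigenvalue (Matrix.toLin' ((S.monodromy n).map Complex.ofReal)) l

/-- The exponent `m` of the `n`-th downward mode `exp(m x₂) v(x₂)`, `v` being `2π`-periodic. -/
def IsDownwardExponent (n : ℤ) (m : ℂ) : Prop :=
  (2 < S.η n ∧ ∃ μ : ℝ, 0 < μ ∧
    S.IsCharacteristicMultiplier n (Real.exp (2 * Real.pi * μ) : ℂ) ∧ m = μ) ∨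
  (S.η n < -2 ∧ ∃ μ : ℝ, 0 < μ ∧
    S.IsCharacteristicMultiplier n (-(Real.exp (2 * Real.pi * μ) : ℂ)) ∧ m = μ + Complex.I / 2) ∨
  (|S.η n| < 2 ∧ ∃ ϑ : ℝ, 0 < ϑ ∧ ϑ < 1 / 2 ∧
    S.IsCharacteristicMultiplier n (Complex.exp (Complex.I * (2 * Real.pi * ϑ))) ∧
    m = -(Complex.I * ϑ)) ∨
  (S.η n = 2 ∧ m = 0) ∨
  (S.η n = -2 ∧ m = Complex.I / 2)

/-- `u` is an `n`-th downward mode: a nontrivial Floquet solution `u(t) = exp(m t) v(t)` of the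
`n`-th Hill equation with the downward exponent `m`.  If `ηₙ ≠ ±2`, or if `Wₙ ≠ ±I`, it is
unique up to a constant factor. -/
def IsDownwardMode (n : ℤ) (u : ℝ → ℂ) : Prop :=
  u ≠ 0 ∧ IsHillSolution (S.hillPotential n) u ∧
    ∃ (m : ℂ) (v : ℝ → ℂ), S.IsDownwardExponent n m ∧ Function.Periodic v (2 * Real.pi) ∧
      ∀ t : ℝ, u t = Complex.exp (m * t) * v t

/-- The `n`-th downward mode `uₙ⁻` (a choice of the constant factor is immaterial below). -/
def downwardMode (n : ℤ) : ℝ → ℂ := Classical.epsilon (S.IsDownwardMode n)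

/-- The two exceptional cases `ηₙ = 2`, `Wₙ = I` and `ηₙ = -2`, `Wₙ = -I` do not occur. -/
def AssumptionA : Prop :=
  ∀ n : ℤ, (S.η n = 2 → (S.monodromy n - 1).rank ≠ 0) ∧
    (S.η n = -2 → (S.monodromy n + 1).rank ≠ 0)

/-! ### Dirichlet-to-Neumann maps

A quasi-periodic distribution `∑ₙ fₙ exp(i αₙ x₁)` is represented by its coefficients `n ↦ fₙ`. -/

/-- The classical upward map `T` on `x₂ = d`. -/
def T (f : ℤ → ℂ) (n : ℤ) : ℂ := Complex.I * S.β n * f n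

/-- The `n`-th coefficient `-(uₙ⁻)'(b) / uₙ⁻(b)` of the downward map. -/
def downwardCoefficient (n : ℤ) : ℂ := -(deriv (S.downwardMode n) S.b / S.downwardMode n S.b)

/-- The downward map `T⁻` on `x₂ = b`. -/
def Tminus (f : ℤ → ℂ) (n : ℤ) : ℂ := S.downwardCoefficient n * f n

/-- The part of `T⁻` with modes `|n| > N`. -/
def TminusHigh (N : ℕ) (f : ℤ → ℂ) (n : ℤ) : ℂ := if (N : ℤ) < |n| then S.Tminus f n else 0

/-- The part of `T⁻` with modes `|n| ≤ N`. -/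
def TminusLow (N : ℕ) (f : ℤ → ℂ) (n : ℤ) : ℂ := if (N : ℤ) < |n| then 0 else S.Tminus f n

/-- The duality `∫₀ᵖ F ḡ ds` in terms of coefficients. -/
def pairing (F g : ℤ → ℂ) : ℂ := S.p * ∑' n : ℤ, F n * conj (g n)

/-! ### The quasi-periodic Sobolev space -/

/-- The periodic cell `C = (0, p) × (b, d)`. -/
def cell : Set (ℝ × ℝ) := Set.Ioo 0 S.p ×ˢ Set.Ioo S.b S.d

/-- Test functions for `α̂`-quasi-periodic distributions on `b < x₂ < d`: smooth functions whose
support in `x₂` is a compact part of `(b, d)` and which acquire the factor `exp(-i α̂ p)` under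
`x₁ ↦ x₁ + p`, so that their product with an `α̂`-quasi-periodic function is `p`-periodic. -/
def IsTestFunction (φ : ℝ × ℝ → ℂ) : Prop :=
  ContDiff ℝ ∞ φ ∧
  (∀ x₁ x₂ : ℝ, φ (x₁ + S.p, x₂) = Complex.exp (-(Complex.I * S.αhat * S.p)) * φ (x₁, x₂)) ∧
  ∃ b' d' : ℝ, S.b < b' ∧ d' < S.d ∧ ∀ x : ℝ × ℝ, x.2 ∉ Set.Icc b' d' → φ x = 0

/-- `g` is the weak derivative in direction `e` of the `α̂`-quasi-periodic function on
`b < x₂ < d` which coincides with `u` on the cell (only the values on the cell enter). -/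
def IsWeakDeriv (e : ℝ × ℝ) (u g : ℝ × ℝ → ℂ) : Prop :=
  ∀ φ : ℝ × ℝ → ℂ, S.IsTestFunction φ →
    ∫ x in S.cell, u x * fderiv ℝ φ x e = -∫ x in S.cell, g x * φ x

abbrev L2 : Type := Lp ℂ 2 (volume.restrict S.cell)

theorem cell_finite : IsFiniteMeasure (volume.restrict S.cell) := by
  refine ⟨?_⟩
  rw [Measure.restrict_apply_univ]
  exact ((Metric.isBounded_Ioo _ _).prod (Metric.isBounded_Ioo _ _)).measure_lt_top

theorem integrable_mul_continuous (u : S.L2) {φ : ℝ × ℝ → ℂ} (hφ : Continuous φ) :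
    Integrable (fun x => u x * φ x) (volume.restrict S.cell) := by
  have := S.cell_finite
  have hu : Integrable u (volume.restrict S.cell) := (Lp.memLp u).integrable (by norm_num)
  have hK : IsCompact (Set.Icc 0 S.p ×ˢ Set.Icc S.b S.d) := isCompact_Icc.prod isCompact_Icc
  obtain ⟨M, hM⟩ := hK.exists_bound_of_continuousOn hφ.continuousOn
  refine hu.mul_bdd (c := M) hφ.aestronglyMeasurable ?_
  refine (ae_restrict_iff' (measurableSet_Ioo.prod measurableSet_Ioo)).2 (ae_of_all _ ?_)
  intro x hx
  exact hM x ⟨Set.Ioo_subset_Icc_self hx.1, Set.Ioo_subset_Icc_self hx.2⟩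

variable {S} in
theorem IsTestFunction.continuous_fderiv_apply {φ : ℝ × ℝ → ℂ} (h : S.IsTestFunction φ)
    (e : ℝ × ℝ) : Continuous fun x => fderiv ℝ φ x e :=
  (h.1.continuous_fderiv (by simp)).clm_apply continuous_const

theorem isWeakDeriv_zero (e : ℝ × ℝ) :
    S.IsWeakDeriv e (0 : S.L2) (0 : S.L2) := by
  intro φ _
  have h : ∀ ψ : ℝ × ℝ → ℂ, ∫ x in S.cell, (0 : S.L2) x * ψ x = 0 := fun ψ => by
    refine integral_eq_zero_of_ae ?_
    filter_upwards [Lp.coeFn_zero ℂ 2 (volume.restrict S.cell)] with x hx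
    rw [hx, Pi.zero_apply, zero_mul]
  rw [h, h, neg_zero]

theorem isWeakDeriv_add (e : ℝ × ℝ) {u v g h : S.L2} (hu : S.IsWeakDeriv e u g)
    (hv : S.IsWeakDeriv e v h) : S.IsWeakDeriv e (u + v : S.L2) (g + h : S.L2) := by
  intro φ hφ
  have key : ∀ (f₁ f₂ : S.L2) (ψ : ℝ × ℝ → ℂ), Continuous ψ →
      ∫ x in S.cell, (f₁ + f₂ : S.L2) x * ψ x
        = (∫ x in S.cell, f₁ x * ψ x) + ∫ x in S.cell, f₂ x * ψ x := fun f₁ f₂ ψ hψ => by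
    rw [← integral_add (S.integrable_mul_continuous f₁ hψ) (S.integrable_mul_continuous f₂ hψ)]
    refine integral_congr_ae ?_
    filter_upwards [Lp.coeFn_add f₁ f₂] with x hx
    rw [hx, Pi.add_apply, add_mul]
  rw [key _ _ _ (hφ.continuous_fderiv_apply e), key _ _ _ hφ.1.continuous, hu φ hφ, hv φ hφ,
    neg_add]

theorem isWeakDeriv_smul (e : ℝ × ℝ) (c : ℂ) {u g : S.L2} (hu : S.IsWeakDeriv e u g) :
    S.IsWeakDeriv e (c • u : S.L2) (c • g : S.L2) := by
  intro φ hφ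
  have key : ∀ (f : S.L2) (ψ : ℝ × ℝ → ℂ),
      ∫ x in S.cell, (c • f : S.L2) x * ψ x = c * ∫ x in S.cell, f x * ψ x := fun f ψ => by
    rw [← integral_const_mul]
    refine integral_congr_ae ?_
    filter_upwards [Lp.coeFn_smul c f] with x hx
    rw [hx, Pi.smul_apply, smul_eq_mul, mul_assoc]
  rw [key, key, hu φ hφ, mul_neg]

/-- The space `H¹_α̂(C)`, a function being listed with its weak gradient as
`(u, ∂₁u, ∂₂u) ∈ L²(C)³`, with the norm `(‖u‖² + ‖∂₁u‖² + ‖∂₂u‖²)^(1/2)`. -/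
def H1 : Submodule ℂ (PiLp 2 fun _ : Fin 3 => S.L2) where
  carrier := {U | S.IsWeakDeriv (1, 0) (U 0) (U 1) ∧ S.IsWeakDeriv (0, 1) (U 0) (U 2)}
  zero_mem' := ⟨S.isWeakDeriv_zero _, S.isWeakDeriv_zero _⟩
  add_mem' := fun hU hV =>
    ⟨S.isWeakDeriv_add _ hU.1 hV.1, S.isWeakDeriv_add _ hU.2 hV.2⟩
  smul_mem' := fun c _ hU => ⟨S.isWeakDeriv_smul _ c hU.1, S.isWeakDeriv_smul _ c hU.2⟩

variable {S}

/-- The function itself. -/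
def val (u : S.H1) : ℝ × ℝ → ℂ := (u.1 0 : S.L2)

/-- Its weak derivative `∂₁u`. -/
def d₁ (u : S.H1) : ℝ × ℝ → ℂ := (u.1 1 : S.L2)

/-- Its weak derivative `∂₂u`. -/
def d₂ (u : S.H1) : ℝ × ℝ → ℂ := (u.1 2 : S.L2)

/-- Fourier coefficients of the trace of `u` on `x₂ = d`. -/
def topCoeff (u : S.H1) : ℤ → ℂ :=
  S.fourierCoefficient (traceAbove S.b S.d (val u) (d₂ u))

/-- Fourier coefficients of the trace of `u` on `x₂ = b`. -/
def bottomCoeff (u : S.H1) : ℤ → ℂ :=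
  S.fourierCoefficient (traceBelow S.b S.d (val u) (d₂ u))

variable (S)

/-- The sesquilinear form `a(u, v)` of the diffraction problem. -/
def form (u v : S.H1) : ℂ :=
  (∫ x in S.cell, (d₁ u x * conj (d₁ v x) + d₂ u x * conj (d₂ v x)
      - (S.k : ℂ) ^ 2 * S.refractiveIndex x * val u x * conj (val v x)))
    - S.pairing (S.T (topCoeff u)) (topCoeff v)
    - S.pairing (S.Tminus (bottomCoeff u)) (bottomCoeff v)

/-- `∫ (∇u · ∇v̄ + u v̄)`, minus the boundary terms of `T` and of the modes `|n| > N` of `T⁻`. -/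
def principalForm (N : ℕ) (u v : S.H1) : ℂ :=
  (∫ x in S.cell, (d₁ u x * conj (d₁ v x) + d₂ u x * conj (d₂ v x)
      + val u x * conj (val v x)))
    - S.pairing (S.T (topCoeff u)) (topCoeff v)
    - S.pairing (S.TminusHigh N (bottomCoeff u)) (bottomCoeff v)

/-- `∫ (k² q̃ + 1) u v̄` plus the boundary term of the modes `|n| ≤ N` of `T⁻`. -/
def lowerOrderForm (N : ℕ) (u v : S.H1) : ℂ :=
  (∫ x in S.cell, ((S.k : ℂ) ^ 2 * S.refractiveIndex x + 1) * val u x * conj (val v x))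
    + S.pairing (S.TminusLow N (bottomCoeff u)) (bottomCoeff v)

end GratingProblem

end

/-! The volume part of B is exactly the inner product of H¹, so coercivity with constant 1 follows
once both boundary series of B have nonpositive real part before they are subtracted. For T this is
immediate: iβₙ is purely imaginary for propagating modes and negative for evanescent ones. For T⁻ it
is a statement about Hill's equation with potential V = k²q - αₙ², which is at most -1 almost
everywhere when |n| is large.

For such V the initial value problem behaves hyperbolically: the entries of the monodromy matrix are
positive and its diagonal entries exceed 1. So ηₙ > 2, and an eigenvalue l > 1 yields a mode that
grows by the factor l over a period. Three quantities are then compared at t and t + 2π, where each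
is multiplied by l². The product y y' is nondecreasing, hence nonnegative; the Wronskian of the real
and imaginary parts is constant, hence zero; and |u'|² - αₙ²|u|² does not increase, hence is
nonpositive. So u'/u is real, positive and at most |αₙ| (`growing_estimate`), which makes τₙ
negative with |τₙ| ≤ |αₙ|.

Since iβₙ and τₙ grow at most linearly in n, convergence and boundedness of the boundary series
reduce to the trace inequality ∑(|n|+1)|uₙ|² ≤ K‖u‖² (`exists_coeff_bound`). A trace coefficient is
an integral of u and ∂₂u against any profile with prescribed end values. Taking the profile to be a
power of degree |n|+1, concentrated in a layer of width of order 1/(|n|+1), and applying Bessel's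
inequality gives the weight.

Compactness of Q comes from the finite rank of its boundary part and from the compact embedding of
H¹ into L². The latter is proved with the basis of exponentials times cosines: integration by parts
multiplies the coefficients of u by αₙ and mπ/(d-b), so they are square summable with weights
tending to infinity. -/

noncomputable section

/-! ### Existence of Carathéodory solutions of Hill's equation -/

theorem exists_ae_abs_le_of_memLp_top {V : ℝ → ℝ} (hV : MemLp V ⊤ volume) :
    ∃ M : ℝ, 1 ≤ M ∧ ∀ᵐ t : ℝ, |V t| ≤ M := by
  refine ⟨max 1 (eLpNorm V ⊤ volume).toReal, le_max_left _ _, ?_⟩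
  filter_upwards [ae_le_eLpNormEssSup (f := V) (μ := volume)] with t ht
  refine le_max_of_le_right ?_
  rw [← Real.norm_eq_abs, ← toReal_enorm]
  refine ENNReal.toReal_mono hV.2.ne ?_
  rwa [eLpNorm_exponent_top]

theorem memLp_top_smul_intervalIntegrable {E : Type*} [NormedAddCommGroup E] [NormedSpace ℝ E]
    {V : ℝ → ℝ} (hV : MemLp V ⊤ volume) {u : ℝ → E} (hu : Continuous u) (a b : ℝ) :
    IntervalIntegrable (fun t => V t • u t) volume a b := by
  have h : IntervalIntegrable V volume a b :=
    ((hV.locallyIntegrable le_top).integrableOn_isCompact isCompact_uIcc).intervalIntegrable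
  exact h.smul_continuousOn hu.continuousOn

/-- Each integration gains a factor 1/L in the weight cosh(Lx), because ∫cosh(Lt) = sinh(Lx)/L and
|sinh| ≤ cosh. This makes the Picard operator below a contraction on the whole line. -/
theorem abs_integral_le_cosh {L C : ℝ} (hL : 0 < L) {f : ℝ → ℝ}
    (hf : ∀ᵐ t : ℝ, |f t| ≤ C * Real.cosh (L * t)) (x : ℝ) :
    |∫ t in (0 : ℝ)..x, f t| ≤ C / L * Real.cosh (L * x) := by
  have hC : 0 ≤ C := by
    obtain ⟨t, ht⟩ := hf.exists
    have := (abs_nonneg _).trans ht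
    exact nonneg_of_mul_nonneg_left this (Real.cosh_pos _)
  have h1 : |∫ t in (0 : ℝ)..x, f t| ≤ |∫ t in (0 : ℝ)..x, C * Real.cosh (L * t)| := by
    have := intervalIntegral.norm_integral_le_abs_of_norm_le (μ := volume) (a := 0) (b := x)
      (f := f) (g := fun t => C * Real.cosh (L * t)) (ae_restrict_of_ae hf)
      (Continuous.intervalIntegrable (by fun_prop) _ _)
    simpa using this
  have h2 : ∫ t in (0 : ℝ)..x, C * Real.cosh (L * t) = C / L * Real.sinh (L * x) := by
    have hd : ∀ t ∈ Set.uIcc 0 x,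
        HasDerivAt (fun s => C / L * Real.sinh (L * s)) (C * Real.cosh (L * t)) t := by
      intro t _
      have h : HasDerivAt (fun s => L * s) L t := by simpa using (hasDerivAt_id t).const_mul L
      refine (h.sinh.const_mul (C / L)).congr_deriv ?_
      field_simp
    rw [intervalIntegral.integral_eq_sub_of_hasDerivAt hd
      (Continuous.intervalIntegrable (by fun_prop) _ _)]
    simp
  refine h1.trans ?_
  rw [h2, abs_mul, abs_of_nonneg (div_nonneg hC hL.le)]
  refine mul_le_mul_of_nonneg_left ?_ (div_nonneg hC hL.le)
  rw [abs_le]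
  constructor
  · rw [neg_le, ← Real.sinh_neg, ← Real.cosh_neg]; exact (Real.sinh_lt_cosh _).le
  · exact (Real.sinh_lt_cosh _).le

/-- Picard iteration for the twice integrated equation, carried out for g = w / cosh(Lx) in the
bounded continuous functions on ℝ. The exponential weight gives a global solution at once, with no
continuation argument. -/
theorem exists_isHillSolution {V : ℝ → ℝ} (hV : MemLp V ⊤ volume) (a₀ a₁ : ℝ) :
    ∃ w : ℝ → ℝ, IsHillSolution V w ∧ w 0 = a₀ ∧ deriv w 0 = a₁ := by
  obtain ⟨M, hM1, hM⟩ := exists_ae_abs_le_of_memLp_top hV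
  -- Two integrations and the factor |V| ≤ M give the Lipschitz constant M/L² = 1/(4M), below 1/2
  -- because M ≥ 1. The bound M ≥ 1 also gives |x| ≤ cosh(Lx), which controls the affine term.
  set L : ℝ := 2 * M with hLdef
  have hL : 0 < L := by positivity
  let P : BoundedContinuousFunction ℝ ℝ → ℝ → ℝ := fun g x =>
    ∫ t in (0 : ℝ)..x, V t • (Real.cosh (L * t) * g t)
  let R : BoundedContinuousFunction ℝ ℝ → ℝ → ℝ := fun g x => ∫ t in (0 : ℝ)..x, P g t
  have hyc : ∀ g : BoundedContinuousFunction ℝ ℝ, Continuous fun t => Real.cosh (L * t) * g t :=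
    fun g => by fun_prop
  have hint : ∀ (g : BoundedContinuousFunction ℝ ℝ) a b,
      IntervalIntegrable (fun t => V t • (Real.cosh (L * t) * g t)) volume a b :=
    fun g => memLp_top_smul_intervalIntegrable hV (hyc g)
  have hPc : ∀ g, Continuous (P g) := fun g =>
    intervalIntegral.continuous_primitive (hint g) 0
  have hRd : ∀ g x, HasDerivAt (R g) (P g x) x := fun g x =>
    (hPc g).integral_hasStrictDerivAt 0 x |>.hasDerivAt
  have hRc : ∀ g, Continuous (R g) := fun g =>
    continuous_iff_continuousAt.2 fun x => (hRd g x).continuousAt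
  have hPb : ∀ g x, |P g x| ≤ M * ‖g‖ / L * Real.cosh (L * x) := by
    intro g x
    refine abs_integral_le_cosh hL ?_ x
    filter_upwards [hM] with t ht
    have hg : |g t| ≤ ‖g‖ := g.norm_coe_le_norm t
    rw [smul_eq_mul, abs_mul, abs_mul, abs_of_pos (Real.cosh_pos _)]
    calc |V t| * (Real.cosh (L * t) * |g t|) ≤ M * (Real.cosh (L * t) * ‖g‖) := by gcongr
      _ = _ := by ring
  have hRb : ∀ g x, |R g x| ≤ M * ‖g‖ / L / L * Real.cosh (L * x) := fun g x =>
    abs_integral_le_cosh hL (ae_of_all _ (hPb g)) x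
  have hPs : ∀ g h x, P g x - P h x = P (g - h) x := by
    intro g h x
    simp only [P]
    rw [← intervalIntegral.integral_sub (hint g _ _) (hint h _ _)]
    refine intervalIntegral.integral_congr fun t _ => ?_
    simp only [smul_eq_mul, BoundedContinuousFunction.coe_sub, Pi.sub_apply]; ring
  have hRs : ∀ g h x, R g x - R h x = R (g - h) x := by
    intro g h x
    simp only [R]
    rw [← intervalIntegral.integral_sub ((hPc g).intervalIntegrable _ _)
      ((hPc h).intervalIntegrable _ _)]
    exact intervalIntegral.integral_congr fun t _ => hPs g h t
  have hTb : ∀ g x, ‖(a₀ + a₁ * x - R g x) / Real.cosh (L * x)‖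
      ≤ |a₀| + |a₁| + M * ‖g‖ / L / L := by
    intro g x
    have hc := Real.cosh_pos (L * x)
    rw [Real.norm_eq_abs, abs_div, abs_of_pos hc, div_le_iff₀ hc]
    have hx : |x| ≤ Real.cosh (L * x) := by
      have h1 : |x| ≤ L * |x| := by
        have := abs_nonneg x
        nlinarith
      have h2 : L * |x| ≤ Real.sinh (L * |x|) := Real.self_le_sinh_iff.2 (by positivity)
      have h3 := (Real.sinh_lt_cosh (L * |x|)).le
      have h4 : Real.cosh (L * |x|) = Real.cosh (L * x) := by
        rw [← Real.cosh_abs (L * x), abs_mul, abs_of_pos hL]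
      linarith
    have h1 := Real.one_le_cosh (L * x)
    calc |a₀ + a₁ * x - R g x| ≤ |a₀| + |a₁| * |x| + |R g x| := by
          have := abs_sub (a₀ + a₁ * x) (R g x)
          have := abs_add_le a₀ (a₁ * x)
          rw [abs_mul] at this
          linarith
      _ ≤ |a₀| * Real.cosh (L * x) + |a₁| * Real.cosh (L * x)
          + M * ‖g‖ / L / L * Real.cosh (L * x) := by
          gcongr
          · exact le_mul_of_one_le_right (abs_nonneg _) h1
          · exact hRb g x
      _ = _ := by ring
  let T : BoundedContinuousFunction ℝ ℝ → BoundedContinuousFunction ℝ ℝ := fun g =>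
    BoundedContinuousFunction.ofNormedAddCommGroup
      (fun x => (a₀ + a₁ * x - R g x) / Real.cosh (L * x))
      (by
        have := hRc g
        exact Continuous.div (by fun_prop) (by fun_prop) fun x => (Real.cosh_pos _).ne')
      _ (hTb g)
  have hT : ContractingWith (1 / 2) T := by
    refine ⟨by norm_num, LipschitzWith.of_dist_le_mul fun g h => ?_⟩
    rw [BoundedContinuousFunction.dist_le (by positivity)]
    intro x
    have hc := Real.cosh_pos (L * x)
    have h1 : T g x - T h x = -(R (g - h) x / Real.cosh (L * x)) := by
      simp only [T, BoundedContinuousFunction.coe_ofNormedAddCommGroup]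
      rw [← hRs]; ring
    rw [Real.dist_eq, h1, abs_neg, abs_div, abs_of_pos hc, div_le_iff₀ hc, dist_eq_norm]
    refine (hRb _ _).trans ?_
    refine mul_le_mul_of_nonneg_right ?_ hc.le
    have h2 : M * ‖g - h‖ / L / L = 1 / (4 * M) * ‖g - h‖ := by
      rw [hLdef]; field_simp; ring
    rw [h2]
    refine mul_le_mul_of_nonneg_right ?_ (norm_nonneg _)
    simp only [one_div, NNReal.coe_inv, NNReal.coe_ofNat]
    gcongr
    linarith
  let g := ContractingWith.fixedPoint T hT
  have hg : T g = g := ContractingWith.fixedPoint_isFixedPt hT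
  let w : ℝ → ℝ := fun x => Real.cosh (L * x) * g x
  have hw : w = fun x => a₀ + a₁ * x - R g x := by
    funext x
    have h1 : (a₀ + a₁ * x - R g x) / Real.cosh (L * x) = g x := DFunLike.congr_fun hg x
    simp only [w]
    rw [← h1, mul_div_cancel₀ _ (Real.cosh_pos _).ne']
  have hwd : ∀ x, HasDerivAt w (a₁ - P g x) x := by
    intro x
    rw [hw]
    have h1 : HasDerivAt (fun x => a₀ + a₁ * x) a₁ x := by
      simpa using ((hasDerivAt_id x).const_mul a₁).const_add a₀
    exact h1.sub (hRd g x)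
  have h0 : deriv w 0 = a₁ := by
    rw [(hwd 0).deriv]; simp [P]
  refine ⟨w, ⟨fun x => (hwd x).differentiableAt, fun x => ?_⟩, ?_, h0⟩
  · rw [h0, (hwd x).deriv]
  · rw [hw]; simp [R]

/-! ### Identities for solutions of Hill's equation -/

namespace IsHillSolution

variable {E F : Type} [NormedAddCommGroup E] [NormedSpace ℝ E] [NormedAddCommGroup F]
  [NormedSpace ℝ F] {V : ℝ → ℝ}

theorem continuous {u : ℝ → E} (hu : IsHillSolution V u) : Continuous u := hu.1.continuous

theorem continuous_deriv (hV : MemLp V ⊤ volume) {u : ℝ → E} (hu : IsHillSolution V u) :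
    Continuous (deriv u) := by
  rw [show deriv u = fun x => deriv u 0 - ∫ t in (0 : ℝ)..x, V t • u t from funext hu.2]
  exact continuous_const.sub (intervalIntegral.continuous_primitive
    (memLp_top_smul_intervalIntegrable hV hu.continuous) 0)

theorem clm_comp [CompleteSpace E] [CompleteSpace F] (hV : MemLp V ⊤ volume) {u : ℝ → E}
    (hu : IsHillSolution V u) (A : E →L[ℝ] F) : IsHillSolution V fun t => A (u t) := by
  have hd : ∀ x, HasDerivAt (fun t => A (u t)) (A (deriv u x)) x := fun x =>
    A.hasFDerivAt.comp_hasDerivAt x (hu.1 x).hasDerivAt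
  refine ⟨fun x => (hd x).differentiableAt, fun x => ?_⟩
  rw [(hd x).deriv, (hd 0).deriv, hu.2 x, map_sub,
    ← A.intervalIntegral_comp_comm (memLp_top_smul_intervalIntegrable hV hu.continuous _ _)]
  simp only [map_smul]

theorem add (hV : MemLp V ⊤ volume) {u v : ℝ → E} (hu : IsHillSolution V u)
    (hv : IsHillSolution V v) : IsHillSolution V fun t => u t + v t := by
  have hd : ∀ x, HasDerivAt (fun t => u t + v t) (deriv u x + deriv v x) x := fun x =>
    (hu.1 x).hasDerivAt.add (hv.1 x).hasDerivAt
  refine ⟨fun x => (hd x).differentiableAt, fun x => ?_⟩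
  rw [(hd x).deriv, (hd 0).deriv, hu.2 x, hv.2 x]
  simp only [smul_add]
  rw [intervalIntegral.integral_add (memLp_top_smul_intervalIntegrable hV hu.continuous _ _)
    (memLp_top_smul_intervalIntegrable hV hv.continuous _ _)]
  abel

theorem deriv_eq_sub (hV : MemLp V ⊤ volume) {u : ℝ → E} (hu : IsHillSolution V u) (a x : ℝ) :
    deriv u x = deriv u a - ∫ t in a..x, V t • u t := by
  have hi := memLp_top_smul_intervalIntegrable hV hu.continuous
  rw [hu.2 x, hu.2 a, ← intervalIntegral.integral_add_adjacent_intervals (hi 0 a) (hi a x)]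
  abel

theorem comp_add_period (hV : MemLp V ⊤ volume) {T : ℝ} (hT : Function.Periodic V T) {u : ℝ → E}
    (hu : IsHillSolution V u) : IsHillSolution V fun t => u (t + T) := by
  refine ⟨fun x => (hu.1 (x + T)).comp x (differentiableAt_id.add_const T), fun x => ?_⟩
  have h : ∀ x, deriv (fun t => u (t + T)) x = deriv u (x + T) := fun x =>
    deriv_comp_add_const u T x
  have h2 : ∫ t in (0 : ℝ)..x, V t • u (t + T) = ∫ t in T..(x + T), V t • u t := by
    have h3 := intervalIntegral.integral_comp_add_right (a := 0) (b := x)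
      (fun t => V t • u t) T
    simpa only [hT _, zero_add] using h3
  rw [h, h, zero_add, h2]
  exact hu.deriv_eq_sub hV T (x + T)

theorem comp_neg {u : ℝ → E} (hu : IsHillSolution V u) :
    IsHillSolution (fun t => V (-t)) fun t => u (-t) := by
  refine ⟨fun x => (hu.1 (-x)).comp x differentiableAt_id.neg, fun x => ?_⟩
  rw [deriv_comp_neg, deriv_comp_neg, hu.2 (-x), neg_zero,
    intervalIntegral.integral_comp_neg (fun t => V t • u t), neg_zero,
    intervalIntegral.integral_symm (-x) 0]
  abel

theorem absolutelyContinuousOnInterval_deriv (hV : MemLp V ⊤ volume) {y : ℝ → ℝ}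
    (hy : IsHillSolution V y) (a b : ℝ) : AbsolutelyContinuousOnInterval (deriv y) a b := by
  have hi := memLp_top_smul_intervalIntegrable hV hy.continuous
  have h : deriv y = fun x => deriv y a + -∫ t in a..x, V t • y t :=
    funext fun x => by rw [hy.deriv_eq_sub hV a x, sub_eq_add_neg]
  rw [h]
  have hc : AbsolutelyContinuousOnInterval (fun _ : ℝ => deriv y a) a b :=
    contDiff_const.contDiffOn.absolutelyContinuousOnInterval
  exact hc.add ((hi a b).absolutelyContinuousOnInterval_intervalIntegral
    Set.left_mem_uIcc).neg

theorem ae_deriv_deriv (hV : MemLp V ⊤ volume) {y : ℝ → ℝ} (hy : IsHillSolution V y) :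
    ∀ᵐ x : ℝ, deriv (deriv y) x = -(V x * y x) := by
  have hl : LocallyIntegrable (fun t => V t • y t) volume :=
    (hV.locallyIntegrable le_top).smul_continuous hy.continuous
  filter_upwards [LocallyIntegrable.ae_hasDerivAt_integral hl] with x hx
  have h : deriv y = fun x => deriv y 0 - ∫ t in (0 : ℝ)..x, V t • y t := funext hy.2
  rw [h]
  exact ((hx 0).const_sub _).deriv

/-- Green's formula for a solution `y` and an absolutely continuous `g`. -/
theorem integral_green (hV : MemLp V ⊤ volume) {y g : ℝ → ℝ} (hy : IsHillSolution V y)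
    {a b : ℝ} (hg : AbsolutelyContinuousOnInterval g a b) :
    ∫ x in a..b, (deriv y x * deriv g x - V x * (y x * g x))
      = deriv y b * g b - deriv y a * g a := by
  rw [← (hy.absolutelyContinuousOnInterval_deriv hV a b).integral_deriv_mul_eq_sub hg]
  refine intervalIntegral.integral_congr_ae ?_
  filter_upwards [hy.ae_deriv_deriv hV] with x hx _
  rw [hx]; ring

theorem absolutelyContinuousOnInterval (hV : MemLp V ⊤ volume) {y : ℝ → ℝ}
    (hy : IsHillSolution V y) (a b : ℝ) : AbsolutelyContinuousOnInterval y a b :=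
  (contDiff_one_iff_deriv.2 ⟨hy.1, hy.continuous_deriv hV⟩).contDiffOn.absolutelyContinuousOnInterval

theorem integral_green_self (hV : MemLp V ⊤ volume) {y z : ℝ → ℝ} (hy : IsHillSolution V y)
    (hz : IsHillSolution V z) (a b : ℝ) :
    ∫ x in a..b, (deriv y x * deriv z x - V x * (y x * z x))
      = deriv y b * z b - deriv y a * z a :=
  hy.integral_green hV (hz.absolutelyContinuousOnInterval hV a b)

theorem integral_energy (hV : MemLp V ⊤ volume) {y : ℝ → ℝ} (hy : IsHillSolution V y) (a b : ℝ) :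
    ∫ x in a..b, -(2 * V x * (y x * deriv y x)) = deriv y b ^ 2 - deriv y a ^ 2 := by
  rw [sq, sq, ← hy.integral_green hV (hy.absolutelyContinuousOnInterval_deriv hV a b)]
  refine intervalIntegral.integral_congr_ae ?_
  filter_upwards [hy.ae_deriv_deriv hV] with x hx _
  rw [hx]; ring

theorem intervalIntegrable_green (hV : MemLp V ⊤ volume) {y z : ℝ → ℝ}
    (hy : IsHillSolution V y) (hz : IsHillSolution V z) (a b : ℝ) :
    IntervalIntegrable (fun x => deriv y x * deriv z x - V x * (y x * z x)) volume a b := by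
  have hyc := hy.continuous_deriv hV
  have hzc := hz.continuous_deriv hV
  exact (Continuous.intervalIntegrable (by fun_prop) _ _).sub
    (memLp_top_smul_intervalIntegrable hV (hy.continuous.mul hz.continuous) a b)

/-- Where V ≤ 0, the derivative y'² - V y² of y y' is nonnegative. -/
theorem deriv_mul_self_mono (hV : MemLp V ⊤ volume) (hneg : ∀ᵐ t : ℝ, V t ≤ 0) {y : ℝ → ℝ}
    (hy : IsHillSolution V y) : Monotone fun x => deriv y x * y x := by
  intro a b hab
  rw [← sub_nonneg, ← hy.integral_green_self hV hy a b]
  refine intervalIntegral.integral_nonneg_of_ae_restrict hab ?_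
  filter_upwards [ae_restrict_of_ae hneg] with t ht
  have := mul_nonneg (neg_nonneg.2 ht) (mul_self_nonneg (y t))
  have := mul_self_nonneg (deriv y t)
  simp only [Pi.zero_apply]
  linarith

/-- If `y y' ≥ 0` on `[a, b]`, the quantity `y'² - K² y²` does not increase from `a` to `b`. -/
theorem energy_le (hV : MemLp V ⊤ volume) {K : ℝ} (hK : ∀ᵐ t : ℝ, -K ^ 2 ≤ V t) {ι : Type}
    (s : Finset ι) {y : ι → ℝ → ℝ} (hy : ∀ i ∈ s, IsHillSolution V (y i)) {a b : ℝ} (hab : a ≤ b)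
    (hpos : ∀ t ∈ Set.Icc a b, 0 ≤ ∑ i ∈ s, deriv (y i) t * y i t) :
    ∑ i ∈ s, (deriv (y i) b ^ 2 - K ^ 2 * y i b ^ 2)
      ≤ ∑ i ∈ s, (deriv (y i) a ^ 2 - K ^ 2 * y i a ^ 2) := by
  have hi : ∀ i ∈ s, IntervalIntegrable (fun x => -(2 * V x * (y i x * deriv (y i) x)))
      volume a b := fun i his => by
    have hc := (hy i his).continuous_deriv hV
    have := ((memLp_top_smul_intervalIntegrable hV ((hy i his).continuous.mul hc) a b).const_mul
      2).neg
    refine this.congr fun x _ => ?_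
    simp only [smul_eq_mul, Pi.mul_apply, Pi.neg_apply]; ring
  have hc : ∀ i ∈ s, Continuous fun x => 2 * K ^ 2 * (deriv (y i) x * y i x) := fun i his => by
    have := (hy i his).continuous_deriv hV
    have := (hy i his).continuous
    fun_prop
  have h1 : ∀ i ∈ s, ∫ x in a..b, 2 * K ^ 2 * (deriv (y i) x * y i x)
      = K ^ 2 * y i b ^ 2 - K ^ 2 * y i a ^ 2 := fun i his => by
    refine intervalIntegral.integral_eq_sub_of_hasDerivAt
      (f := fun x => K ^ 2 * y i x ^ 2) (fun x _ => ?_) ((hc i his).intervalIntegrable _ _)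
    refine ((((hy i his).1 x).hasDerivAt.pow 2).const_mul (K ^ 2)).congr_deriv ?_
    simp; ring
  -- The derivative of y'² is -2V y y'. As -V ≤ K² and the sum of the products y y' is nonnegative,
  -- its sum over i is at most that of 2K² y y', the derivative of K² y². Only the sum needs a sign,
  -- which allows the real and imaginary parts of a complex solution to be treated together.
  have h2 : ∑ i ∈ s, (deriv (y i) b ^ 2 - deriv (y i) a ^ 2)
      ≤ ∑ i ∈ s, (K ^ 2 * y i b ^ 2 - K ^ 2 * y i a ^ 2) := by
    rw [← Finset.sum_congr rfl h1,
      ← Finset.sum_congr rfl (fun i his => (hy i his).integral_energy hV a b),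
      ← intervalIntegral.integral_finsetSum hi,
      ← intervalIntegral.integral_finsetSum fun i his => (hc i his).intervalIntegrable _ _]
    refine intervalIntegral.integral_mono_ae_restrict hab
      (by simpa only [Finset.sum_fn] using IntervalIntegrable.sum _ hi)
      (by simpa only [Finset.sum_fn] using
        IntervalIntegrable.sum _ fun i his => (hc i his).intervalIntegrable a b) ?_
    filter_upwards [ae_restrict_of_ae hK, ae_restrict_mem measurableSet_Icc] with t ht hmem
    have h3 := mul_nonneg (sub_nonneg.2 ht) (hpos t hmem)
    have h4 : (V t - -K ^ 2) * ∑ i ∈ s, deriv (y i) t * y i t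
        = (1 / 2) * (∑ i ∈ s, 2 * K ^ 2 * (deriv (y i) t * y i t)
          - ∑ i ∈ s, -(2 * V t * (y i t * deriv (y i) t))) := by
      rw [← Finset.sum_sub_distrib, Finset.mul_sum, Finset.mul_sum]
      refine Finset.sum_congr rfl fun i _ => ?_
      ring
    linarith
  simp only [Finset.sum_sub_distrib] at h2 ⊢
  linarith

/-! ### Uniqueness for the initial value problem with nonpositive potential -/

/-- From zero data y y' stays nonnegative, so the energy y'² - M² y² stays nonpositive and |y'| ≤
M|y|. Grönwall's inequality then forces y = 0. -/
theorem eq_zero_of_nonneg (hV : MemLp V ⊤ volume) (hneg : ∀ᵐ t : ℝ, V t ≤ 0) {y : ℝ → ℝ}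
    (hy : IsHillSolution V y) (h0 : y 0 = 0) (h1 : deriv y 0 = 0) {x : ℝ} (hx : 0 ≤ x) :
    y x = 0 := by
  obtain ⟨M, hM1, hM⟩ := exists_ae_abs_le_of_memLp_top hV
  have hK : ∀ᵐ t : ℝ, -M ^ 2 ≤ V t := by
    filter_upwards [hM] with t ht
    have := (abs_le.1 ht).1
    nlinarith
  have hpos : ∀ t, 0 ≤ t → 0 ≤ deriv y t * y t := fun t ht => by
    have := hy.deriv_mul_self_mono hV hneg ht
    simpa [h0] using this
  have hb : ∀ t, 0 ≤ t → |deriv y t| ≤ M * |y t| := fun t ht => by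
    have := energy_le hV hK (Finset.univ : Finset Unit) (y := fun _ => y) (fun _ _ => hy) ht
      (fun s hs => by simpa using hpos s hs.1)
    simp only [Finset.univ_unique, Finset.sum_const, Finset.card_singleton, one_smul, h0, h1] at this
    have h2 : deriv y t ^ 2 ≤ (M * |y t|) ^ 2 := by rw [mul_pow, sq_abs]; linarith
    exact abs_le_of_sq_le_sq h2 (by positivity)
  exact eq_zero_of_abs_deriv_le_mul_abs_self_of_eq_zero_right (f := y) (f' := deriv y) (K := M)
    (a := 0) (b := x) hy.continuous.continuousOn
    (fun t _ => (hy.1 t).hasDerivAt.hasDerivWithinAt) h0 (fun t ht => hb t ht.1) x ⟨hx, le_rfl⟩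

theorem eq_zero (hV : MemLp V ⊤ volume) (hneg : ∀ᵐ t : ℝ, V t ≤ 0) {y : ℝ → ℝ}
    (hy : IsHillSolution V y) (h0 : y 0 = 0) (h1 : deriv y 0 = 0) (x : ℝ) : y x = 0 := by
  rcases le_total 0 x with hx | hx
  · exact hy.eq_zero_of_nonneg hV hneg h0 h1 hx
  -- The reflected function solves the equation with reflected potential, which satisfies the same
  -- bounds.
  · have hmp : MeasurePreserving (fun t : ℝ => -t) volume volume :=
      Measure.measurePreserving_neg volume
    have h := hy.comp_neg.eq_zero_of_nonneg (x := -x) (hV.comp_measurePreserving hmp)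
      (hmp.quasiMeasurePreserving.ae hneg) (by simpa using h0)
      (by rw [deriv_comp_neg]; simp [h1]) (by linarith)
    simpa using h

theorem unique (hV : MemLp V ⊤ volume) (hneg : ∀ᵐ t : ℝ, V t ≤ 0) {y z : ℝ → ℝ}
    (hy : IsHillSolution V y) (hz : IsHillSolution V z) (h0 : y 0 = z 0)
    (h1 : deriv y 0 = deriv z 0) : y = z := by
  funext x
  have hw := hy.add hV (hz.clm_comp hV (-(ContinuousLinearMap.id ℝ ℝ)))
  have hd : deriv (fun t => y t + (-(ContinuousLinearMap.id ℝ ℝ)) (z t)) 0 = 0 := by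
    have : HasDerivAt (fun t => y t + (-(ContinuousLinearMap.id ℝ ℝ)) (z t))
        (deriv y 0 + -deriv z 0) 0 := (hy.1 0).hasDerivAt.add (hz.1 0).hasDerivAt.neg
    rw [this.deriv, h1, add_neg_cancel]
  have := hw.eq_zero hV hneg (by simp [h0]) hd x
  simp only [neg_apply, ContinuousLinearMap.id_apply] at this
  linarith

end IsHillSolution

/-! ### Growth of solutions when the potential is at most -1 -/

namespace IsHillSolution

variable {V : ℝ → ℝ}

theorem monotoneOn_sq (hV : MemLp V ⊤ volume) (hneg : ∀ᵐ t : ℝ, V t ≤ 0) {y : ℝ → ℝ}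
    (hy : IsHillSolution V y) (h0 : 0 ≤ deriv y 0 * y 0) :
    MonotoneOn (fun x => y x ^ 2) (Set.Ici 0) := by
  refine monotoneOn_of_deriv_nonneg (convex_Ici 0) (hy.continuous.pow 2).continuousOn
    (hy.1.pow 2).differentiableOn fun x hx => ?_
  rw [interior_Ici] at hx
  have h := hy.deriv_mul_self_mono hV hneg (le_of_lt hx)
  have h2 : deriv (fun x => y x ^ 2) x = 2 * (deriv y x * y x) := by
    exact ((hy.1 x).hasDerivAt.pow 2).deriv.trans (by simp; ring)
  simp only at h
  rw [h2]; linarith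

/-- The solution is positive just after 0. A later negative value would force a zero in between,
which is impossible because y² is nondecreasing. -/
theorem nonneg_of_deriv_pos (hV : MemLp V ⊤ volume) (hneg : ∀ᵐ t : ℝ, V t ≤ 0) {y : ℝ → ℝ}
    (hy : IsHillSolution V y) (h0 : y 0 = 0) (h1 : 0 < deriv y 0) {x : ℝ} (hx : 0 ≤ x) :
    0 ≤ y x := by
  by_contra! hlt
  have hx0 : 0 < x := lt_of_le_of_ne hx fun h => by rw [← h, h0] at hlt; exact lt_irrefl _ hlt
  have hpos : ∃ t ∈ Set.Ioo 0 x, 0 < y t := by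
    have h2 := (hy.1 0).hasDerivAt.tendsto_slope_zero_right.eventually (lt_mem_nhds h1)
    obtain ⟨t, ht1, ht2⟩ := (h2.and (Ioo_mem_nhdsGT hx0)).exists
    refine ⟨t, ht2, ?_⟩
    simp only [zero_add, h0, sub_zero, smul_eq_mul] at ht1
    exact pos_of_mul_pos_right ht1 (inv_nonneg.2 ht2.1.le)
  obtain ⟨t, ht, hyt⟩ := hpos
  obtain ⟨c, hc, hyc⟩ : (0 : ℝ) ∈ y '' Set.Icc t x :=
    intermediate_value_Icc' ht.2.le hy.continuous.continuousOn ⟨hlt.le, hyt.le⟩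
  have := hy.monotoneOn_sq hV hneg (by simp [h0]) (Set.mem_Ici.2 ht.1.le)
    (Set.mem_Ici.2 (ht.1.le.trans hc.1)) hc.1
  simp only [hyc] at this
  nlinarith

theorem nonneg_of_pos (hV : MemLp V ⊤ volume) (hneg : ∀ᵐ t : ℝ, V t ≤ 0) {y : ℝ → ℝ}
    (hy : IsHillSolution V y) (h0 : 0 < y 0) (h1 : deriv y 0 = 0) {x : ℝ} (hx : 0 ≤ x) :
    y 0 ≤ y x := by
  have hsq : ∀ t, 0 ≤ t → y 0 ^ 2 ≤ y t ^ 2 := fun t ht =>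
    hy.monotoneOn_sq hV hneg (by simp [h1]) (Set.mem_Ici.2 le_rfl) (Set.mem_Ici.2 ht) ht
  refine le_of_sq_le_sq (hsq x hx) ?_
  by_contra! hlt
  obtain ⟨c, hc, hyc⟩ : (0 : ℝ) ∈ y '' Set.Icc 0 x :=
    intermediate_value_Icc' hx hy.continuous.continuousOn ⟨hlt.le, h0.le⟩
  have := hsq c hc.1
  rw [hyc] at this
  nlinarith

theorem deriv_lower_bound (hV : MemLp V ⊤ volume) (hneg : ∀ᵐ t : ℝ, V t ≤ -1) {y : ℝ → ℝ}
    (hy : IsHillSolution V y) (hpos : ∀ t, 0 ≤ t → 0 ≤ y t) {x : ℝ} (hx : 0 ≤ x) :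
    deriv y 0 + ∫ t in (0 : ℝ)..x, y t ≤ deriv y x := by
  have hi := memLp_top_smul_intervalIntegrable hV hy.continuous 0 x
  rw [hy.2 x, sub_eq_add_neg, ← intervalIntegral.integral_neg]
  refine add_le_add_right (intervalIntegral.integral_mono_ae_restrict hx
    (hy.continuous.intervalIntegrable _ _) hi.neg ?_) _
  filter_upwards [ae_restrict_of_ae hneg, ae_restrict_mem measurableSet_Icc] with t ht hm
  have := hpos t hm.1
  simp only [smul_eq_mul, Pi.neg_apply]
  nlinarith

/-- With `sine_growth`, this makes all entries of the monodromy matrix positive and its diagonal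
entries larger than 1. That yields ηₙ > 2 and an eigenvalue larger than 1. -/
theorem cosine_growth (hV : MemLp V ⊤ volume) (hneg : ∀ᵐ t : ℝ, V t ≤ -1) {y : ℝ → ℝ}
    (hy : IsHillSolution V y) (h0 : y 0 = 1) (h1 : deriv y 0 = 0) {x : ℝ} (hx : 0 < x) :
    1 < y x ∧ 0 < deriv y x := by
  have hneg' : ∀ᵐ t : ℝ, V t ≤ 0 := hneg.mono fun t ht => by linarith
  have hge : ∀ t, 0 ≤ t → 1 ≤ y t := fun t ht =>
    h0 ▸ hy.nonneg_of_pos hV hneg' (by rw [h0]; exact one_pos) h1 ht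
  have hd : ∀ t, 0 < t → 0 < deriv y t := fun t ht => by
    refine lt_of_lt_of_le ?_ (hy.deriv_lower_bound hV hneg (fun s hs =>
      zero_le_one.trans (hge s hs)) ht.le)
    rw [h1, zero_add]
    exact intervalIntegral.integral_pos ht hy.continuous.continuousOn
      (fun s hs => zero_le_one.trans (hge s hs.1.le))
      ⟨0, ⟨le_rfl, ht.le⟩, by rw [h0]; exact one_pos⟩
  refine ⟨?_, hd x hx⟩
  have hm : StrictMonoOn y (Set.Ici 0) := by
    refine strictMonoOn_of_deriv_pos (convex_Ici 0) hy.continuous.continuousOn fun t ht => ?_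
    rw [interior_Ici] at ht
    exact hd t ht
  have := hm (Set.mem_Ici.2 le_rfl) (Set.mem_Ici.2 hx.le) hx
  rwa [h0] at this

theorem sine_growth (hV : MemLp V ⊤ volume) (hneg : ∀ᵐ t : ℝ, V t ≤ -1) {y : ℝ → ℝ}
    (hy : IsHillSolution V y) (h0 : y 0 = 0) (h1 : deriv y 0 = 1) {x : ℝ} (hx : 0 < x) :
    0 < y x ∧ 1 < deriv y x := by
  have hneg' : ∀ᵐ t : ℝ, V t ≤ 0 := hneg.mono fun t ht => by linarith
  have hge : ∀ t, 0 ≤ t → 0 ≤ y t := fun t ht =>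
    hy.nonneg_of_deriv_pos hV hneg' h0 (by rw [h1]; exact one_pos) ht
  have hd : ∀ t, 0 ≤ t → 1 ≤ deriv y t := fun t ht => by
    refine le_trans ?_ (hy.deriv_lower_bound hV hneg hge ht)
    rw [h1]
    have := intervalIntegral.integral_nonneg (μ := volume) ht (fun s (hs : s ∈ Set.Icc 0 t) => hge s hs.1)
    linarith
  have hm : StrictMonoOn y (Set.Ici 0) := by
    refine strictMonoOn_of_deriv_pos (convex_Ici 0) hy.continuous.continuousOn fun t ht => ?_
    rw [interior_Ici] at ht
    exact one_pos.trans_le (hd t (le_of_lt ht))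
  have hpos : ∀ t, 0 < t → 0 < y t := fun t ht => by
    have := hm (Set.mem_Ici.2 le_rfl) (Set.mem_Ici.2 ht.le) ht
    rwa [h0] at this
  refine ⟨hpos x hx, lt_of_lt_of_le ?_ (hy.deriv_lower_bound hV hneg hge hx.le)⟩
  rw [h1]
  have := intervalIntegral.integral_pos hx hy.continuous.continuousOn
    (fun s hs => hge s hs.1.le) ⟨x, ⟨hx.le, le_rfl⟩, hpos x hx⟩
  linarith

/-- The logarithmic derivative of a solution that grows by a factor `l > 1` over a period. -/
theorem growing_estimate (hV : MemLp V ⊤ volume) {K T l : ℝ} (hK0 : 0 ≤ K) (hT : 0 < T)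
    (hl : 1 < l) (hneg : ∀ᵐ t : ℝ, V t ≤ -1) (hK : ∀ᵐ t : ℝ, -K ^ 2 ≤ V t) {u : ℝ → ℂ}
    (hu : IsHillSolution V u) (hper : ∀ t, u (t + T) = l * u t) {x : ℝ} (hx : u x ≠ 0) :
    (deriv u x / u x).im = 0 ∧ 0 < (deriv u x / u x).re ∧ ‖deriv u x / u x‖ ≤ K := by
  have hneg' : ∀ᵐ t : ℝ, V t ≤ 0 := hneg.mono fun t ht => by linarith
  set y : Bool → ℝ → ℝ := fun i t => if i then (u t).re else (u t).im with hydef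
  have hy : ∀ i, IsHillSolution V (y i) := by
    intro i
    cases i
    · simpa [hydef] using hu.clm_comp hV Complex.imCLM
    · simpa [hydef] using hu.clm_comp hV Complex.reCLM
  have hyp : ∀ i t, y i (t + T) = l * y i t := by
    intro i t; cases i <;> simp [hydef, hper]
  have hyd : ∀ i t, deriv (y i) (t + T) = l * deriv (y i) t := by
    intro i t
    rw [← deriv_comp_add_const, show (fun t => y i (t + T)) = fun t => l * y i t from
      funext (hyp i), deriv_const_mul_field]
  have hre : ∀ t, (deriv u t).re = deriv (y true) t := fun t =>
    (Complex.reCLM.hasFDerivAt.comp_hasDerivAt t (hu.1 t).hasDerivAt).deriv.symm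
  have him : ∀ t, (deriv u t).im = deriv (y false) t := fun t =>
    (Complex.imCLM.hasFDerivAt.comp_hasDerivAt t (hu.1 t).hasDerivAt).deriv.symm
  have hmono : ∀ i, Monotone fun t => deriv (y i) t * y i t := fun i =>
    (hy i).deriv_mul_self_mono hV hneg'
  have hl2 : 1 < l ^ 2 := by nlinarith
  -- Over a period y y' is multiplied by l² > 1 and does not decrease, so it cannot be negative.
  have hnn : ∀ i t, 0 ≤ deriv (y i) t * y i t := fun i t => by
    have h := hmono i (le_add_of_nonneg_right hT.le : t ≤ t + T)
    simp only [hyp, hyd] at h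
    nlinarith
  -- Green's formula is symmetric in the two solutions, so their Wronskian is the same at x and x +
  -- T. It is also multiplied by l² and therefore vanishes; it is the imaginary part of u'/u up to
  -- the factor |u|².
  have hwr : deriv (y false) x * y true x - deriv (y true) x * y false x = 0 := by
    have h1 := (hy false).integral_green_self hV (hy true) x (x + T)
    have h2 := (hy true).integral_green_self hV (hy false) x (x + T)
    have h3 : ∫ t in x..(x + T), (deriv (y false) t * deriv (y true) t
          - V t * (y false t * y true t))
        = ∫ t in x..(x + T), (deriv (y true) t * deriv (y false) t
          - V t * (y true t * y false t)) :=
      intervalIntegral.integral_congr fun t _ => by ring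
    rw [h3, h2] at h1
    simp only [hyp, hyd] at h1
    have h4 : (l ^ 2 - 1) * (deriv (y false) x * y true x - deriv (y true) x * y false x) = 0 := by
      linarith
    exact (mul_eq_zero.1 h4).resolve_left (by linarith)
  -- By Green's formula (l² - 1) y y' at x is the integral of y'² - V y² over a period, which is at
  -- least that of y², since V ≤ -1.
  have hpos : ∀ i, y i x ≠ 0 → 0 < deriv (y i) x * y i x := by
    intro i hi
    have h1 := (hy i).integral_green_self hV (hy i) x (x + T)
    have h2 : 0 < ∫ t in x..(x + T), y i t ^ 2 :=
      intervalIntegral.integral_pos (by linarith) ((hy i).continuous.pow 2).continuousOn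
        (fun _ _ => sq_nonneg _) ⟨x, ⟨le_rfl, by linarith⟩, by positivity⟩
    have h3 : ∫ t in x..(x + T), y i t ^ 2 ≤ ∫ t in x..(x + T),
        (deriv (y i) t * deriv (y i) t - V t * (y i t * y i t)) := by
      refine intervalIntegral.integral_mono_ae_restrict (by linarith)
        (((hy i).continuous.pow 2).intervalIntegrable _ _)
        ((hy i).intervalIntegrable_green hV (hy i) _ _) ?_
      filter_upwards [ae_restrict_of_ae hneg] with t ht
      have := mul_self_nonneg (deriv (y i) t)
      have := mul_self_nonneg (y i t)
      nlinarith
    rw [h1] at h3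
    simp only [hyp, hyd] at h3
    nlinarith
  -- The energy |u'|² - K²|u|² does not increase over a period but is multiplied by l² > 1, so it is
  -- nonpositive. This is the bound ‖u'/u‖ ≤ K.
  have hen : ∑ i, (deriv (y i) x ^ 2 - K ^ 2 * y i x ^ 2) ≤ 0 := by
    have h := energy_le hV hK Finset.univ (fun i _ => hy i) (le_add_of_nonneg_right hT.le : x ≤ x + T)
      (fun t _ => Finset.sum_nonneg fun i _ => hnn i t)
    simp only [hyp, hyd, Fintype.sum_bool] at h ⊢
    nlinarith
  have hN : 0 < Complex.normSq (u x) := Complex.normSq_pos.2 hx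
  have hyt : y true x = (u x).re := by simp [hydef]
  have hyf : y false x = (u x).im := by simp [hydef]
  refine ⟨?_, ?_, ?_⟩
  · rw [Complex.div_im, hre, him, ← hyt, ← hyf, ← sub_div, div_eq_zero_iff]
    left; linarith
  · rw [Complex.div_re, hre, him, ← hyt, ← hyf, ← add_div]
    refine div_pos ?_ hN
    rcases eq_or_ne (y true x) 0 with h | h
    · have h' : y false x ≠ 0 := fun h' => hx (Complex.ext (hyt ▸ h) (hyf ▸ h'))
      have := hpos false h'
      have := hnn true x
      linarith
    · have := hpos true h
      have := hnn false x
      linarith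
  · rw [norm_div, div_le_iff₀ (norm_pos_iff.2 hx)]
    refine le_of_sq_le_sq ?_ (by positivity)
    rw [mul_pow, ← Complex.normSq_eq_norm_sq, ← Complex.normSq_eq_norm_sq, Complex.normSq_apply,
      Complex.normSq_apply, hre, him, ← hyt, ← hyf]
    simp only [Fintype.sum_bool] at hen
    linarith

end IsHillSolution

namespace GratingProblem

variable (S : GratingProblem)

/-! ### The downward modes of high order -/

theorem memLp_hillPotential (n : ℤ) : MemLp (S.hillPotential n) ⊤ volume :=
  (S.q_bounded.const_mul (S.k ^ 2)).sub (memLp_top_const _)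

theorem periodic_hillPotential (n : ℤ) : Function.Periodic (S.hillPotential n) (2 * Real.pi) :=
  fun t => by simp only [hillPotential, S.q_periodic t]

theorem neg_sq_le_hillPotential (n : ℤ) : ∀ᵐ t : ℝ, -|S.α n| ^ 2 ≤ S.hillPotential n t := by
  filter_upwards [S.q_pos] with t ht
  rw [sq_abs, hillPotential]
  have := mul_nonneg (sq_nonneg S.k) ht.le
  linarith

theorem tendsto_abs_α : Tendsto (fun n : ℤ => |S.α n|) cofinite atTop := by
  have hp := S.p_pos
  have hc : 0 < 2 * Real.pi / S.p := by positivity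
  have h1 : Tendsto (fun n : ℤ => 2 * Real.pi / S.p * |(n : ℝ)| - |S.αhat|) cofinite atTop := by
    refine tendsto_atTop_add_const_right _ _ (Tendsto.const_mul_atTop hc ?_)
    exact tendsto_norm_cocompact_atTop.comp Int.tendsto_coe_cofinite
  refine tendsto_atTop_mono (fun n => ?_) h1
  have h := abs_sub_abs_le_abs_sub (2 * Real.pi / S.p * n) (-S.αhat)
  rw [abs_neg, abs_mul, abs_of_pos hc] at h
  refine h.trans (le_of_eq ?_)
  rw [α]; congr 1; ring

theorem exists_hillPotential_le : ∃ N : ℕ, ∀ n : ℤ, (N : ℤ) < |n| →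
    ∀ᵐ t : ℝ, S.hillPotential n t ≤ -1 := by
  obtain ⟨M, hM1, hM⟩ := exists_ae_abs_le_of_memLp_top S.q_bounded
  -- The threshold is at least 1, so |αₙ| ≤ αₙ² and a lower bound for |αₙ| suffices.
  have hev := S.tendsto_abs_α.eventually_ge_atTop (S.k ^ 2 * M + 1)
  rw [Filter.eventually_cofinite] at hev
  obtain ⟨N, hN⟩ := (hev.image Int.natAbs).bddAbove
  refine ⟨N, fun n hn => ?_⟩
  have hn' : S.k ^ 2 * M + 1 ≤ |S.α n| := by
    by_contra h
    have : n.natAbs ≤ N := hN ⟨n, h, rfl⟩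
    rw [Int.abs_eq_natAbs] at hn
    omega
  filter_upwards [hM] with t ht
  have h1 : S.k ^ 2 * S.q t ≤ S.k ^ 2 * M :=
    mul_le_mul_of_nonneg_left ((le_abs_self _).trans ht) (sq_nonneg _)
  have h2 : |S.α n| ≤ S.α n ^ 2 := by
    rw [← sq_abs]
    have : 0 ≤ S.k ^ 2 * M := by positivity
    nlinarith
  rw [hillPotential]
  linarith

variable {S}

theorem w₁_spec (S : GratingProblem) (n : ℤ) :
    IsHillSolution (S.hillPotential n) (S.w₁ n) ∧ S.w₁ n 0 = 1 ∧ deriv (S.w₁ n) 0 = 0 :=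
  Classical.epsilon_spec (exists_isHillSolution (S.memLp_hillPotential n) 1 0)

theorem w₂_spec (S : GratingProblem) (n : ℤ) :
    IsHillSolution (S.hillPotential n) (S.w₂ n) ∧ S.w₂ n 0 = 0 ∧ deriv (S.w₂ n) 0 = 1 :=
  Classical.epsilon_spec (exists_isHillSolution (S.memLp_hillPotential n) 0 1)

theorem two_lt_η {n : ℤ} (hn : ∀ᵐ t : ℝ, S.hillPotential n t ≤ -1) : 2 < S.η n := by
  have hV := S.memLp_hillPotential n
  obtain ⟨h1, h2, h3⟩ := S.w₁_spec n
  obtain ⟨h4, h5, h6⟩ := S.w₂_spec n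
  have := (h1.cosine_growth hV hn h2 h3 Real.two_pi_pos).1
  have := (h4.sine_growth hV hn h5 h6 Real.two_pi_pos).2
  rw [η]; linarith

/-- A `2 × 2` matrix with positive entries has an eigenvalue exceeding its diagonal entries. -/
theorem exists_root_of_pos {a b c d : ℝ} (hb : 0 < b) (hc : 0 < c) :
    ∃ l, a < l ∧ (l - a) * (l - d) = b * c := by
  have h0 : 0 ≤ (a - d) ^ 2 + 4 * (b * c) := by positivity
  refine ⟨((a + d) + √((a - d) ^ 2 + 4 * (b * c))) / 2, ?_, ?_⟩
  · have : |a - d| < √((a - d) ^ 2 + 4 * (b * c)) := by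
      rw [← Real.sqrt_sq_eq_abs]
      exact Real.sqrt_lt_sqrt (sq_nonneg _) (by nlinarith [mul_pos hb hc])
    have := (le_abs_self _).trans_lt this
    linarith
  · have := Real.sq_sqrt h0
    linear_combination this / 4

/-- `downwardMode` is a choice, so nothing is known of it before a mode has been exhibited. An
eigenvector of the monodromy matrix for an eigenvalue l > 1 supplies the initial data. -/
theorem exists_isDownwardMode {n : ℤ} (hn : ∀ᵐ t : ℝ, S.hillPotential n t ≤ -1) :
    ∃ u, S.IsDownwardMode n u := by
  have hV := S.memLp_hillPotential n
  obtain ⟨h1, h2, h3⟩ := S.w₁_spec n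
  obtain ⟨h4, h5, h6⟩ := S.w₂_spec n
  obtain ⟨ha, hc⟩ := h1.cosine_growth hV hn h2 h3 Real.two_pi_pos
  obtain ⟨hb, hd⟩ := h4.sine_growth hV hn h5 h6 Real.two_pi_pos
  set a := S.w₁ n (2 * Real.pi) with ha_def
  set b := S.w₂ n (2 * Real.pi) with hb_def
  set c := deriv (S.w₁ n) (2 * Real.pi) with hc_def
  set d := deriv (S.w₂ n) (2 * Real.pi) with hd_def
  obtain ⟨l, hl, hroot⟩ := exists_root_of_pos (a := a) (d := d) hb hc
  have hl1 : 1 < l := ha.trans hl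
  have hl0 : 0 < l := one_pos.trans hl1
  let μ := Real.log l / (2 * Real.pi)
  have hμ : 0 < μ := div_pos (Real.log_pos hl1) Real.two_pi_pos
  have hexp : Real.exp (2 * Real.pi * μ) = l := by
    rw [mul_div_cancel₀ _ Real.two_pi_pos.ne', Real.exp_log hl0]
  -- The vector (b, l - a) is an eigenvector of the matrix with rows (a, b) and (c, d) for the root
  -- l of its characteristic polynomial.
  let y : ℝ → ℝ := fun t => b * S.w₁ n t + (l - a) * S.w₂ n t
  have hy : IsHillSolution (S.hillPotential n) y :=
    (h1.clm_comp hV (b • ContinuousLinearMap.id ℝ ℝ)).add hV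
      (h4.clm_comp hV ((l - a) • ContinuousLinearMap.id ℝ ℝ))
  have hyd : ∀ t, deriv y t = b * deriv (S.w₁ n) t + (l - a) * deriv (S.w₂ n) t := fun t =>
    (((h1.1 t).hasDerivAt.const_mul b).add ((h4.1 t).hasDerivAt.const_mul (l - a))).deriv
  -- Both sides solve the same equation because the potential is periodic. Their values at 0 agree
  -- identically, their derivatives by `hroot`.
  have hper : ∀ t, y (t + 2 * Real.pi) = l * y t := by
    have h := (hy.comp_add_period hV (S.periodic_hillPotential n)).unique hV
      (hn.mono fun t ht => by linarith) (hy.clm_comp hV (l • ContinuousLinearMap.id ℝ ℝ)) ?_ ?_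
    · intro t
      exact congrFun h t
    · simp only [zero_add, smul_apply, ContinuousLinearMap.id_apply,
        smul_eq_mul, y, h2, h5, ← ha_def, ← hb_def]
      ring
    · have h7 : deriv (fun t => (l • ContinuousLinearMap.id ℝ ℝ) (y t)) 0 = l * deriv y 0 :=
        ((hy.1 0).hasDerivAt.const_mul l).deriv
      rw [h7, deriv_comp_add_const, zero_add, hyd, hyd, h3, h6, ← hc_def, ← hd_def]
      linear_combination -hroot
  have heig : S.IsCharacteristicMultiplier n (Real.exp (2 * Real.pi * μ) : ℂ) := by
    rw [hexp]
    refine Module.End.hasEigenvalue_of_hasEigenvector (x := ![(b : ℂ), ((l - a : ℝ) : ℂ)])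
      ⟨Module.End.mem_eigenspace_iff.2 ?_, ?_⟩
    · rw [Matrix.toLin'_apply]
      have e1 : (a : ℂ) * b + b * (l - a) = l * b := by ring
      have e2 : (c : ℂ) * b + d * (l - a) = l * (l - a) := by
        have : ((l : ℂ) - a) * (l - d) = b * c := by exact_mod_cast hroot
        linear_combination -this
      ext i
      fin_cases i
      · simpa [monodromy, Matrix.mulVec, dotProduct] using e1
      · simpa [monodromy, Matrix.mulVec, dotProduct] using e2
    · intro h
      have := congrFun h 0
      simp only [Matrix.cons_val_zero, Pi.zero_apply, Complex.ofReal_eq_zero] at this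
      exact hb.ne' this
  refine ⟨fun t => (y t : ℂ), fun h => ?_, hy.clm_comp hV Complex.ofRealCLM, (μ : ℂ),
    fun t => Complex.exp (-(μ * t)) * y t, Or.inl ⟨two_lt_η hn, μ, hμ, heig, rfl⟩, fun t => ?_,
    fun t => ?_⟩
  · have := congrFun h 0
    simp only [Pi.zero_apply, Complex.ofReal_eq_zero, y, h2, h5] at this
    linarith
  · simp only [hper]
    have : Complex.exp (2 * Real.pi * μ) = l := by exact_mod_cast congrArg Complex.ofReal hexp
    push_cast
    rw [← this, ← mul_assoc, ← Complex.exp_add]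
    congr 2; ring
  · rw [← mul_assoc, ← Complex.exp_add, add_neg_cancel, Complex.exp_zero, one_mul]

/-- The estimate of u'/u applies to every downward mode, so the choice made in `downwardMode` does
not matter. The constant |αₙ| comes from q > 0, which gives V ≥ -αₙ². -/
theorem downwardCoefficient_estimate {n : ℤ} (hn : ∀ᵐ t : ℝ, S.hillPotential n t ≤ -1)
    (hb : S.downwardMode n S.b ≠ 0) :
    (S.downwardCoefficient n).im = 0 ∧ (S.downwardCoefficient n).re < 0 ∧
      ‖S.downwardCoefficient n‖ ≤ |S.α n| := by
  have hη := two_lt_η hn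
  obtain ⟨-, hu, m, v, hm, hv, huv⟩ : S.IsDownwardMode n (S.downwardMode n) :=
    Classical.epsilon_spec (exists_isDownwardMode hn)
  obtain ⟨μ, hμ, rfl⟩ : ∃ μ : ℝ, 0 < μ ∧ m = μ := by
    rcases hm with ⟨-, μ, hμ, -, h⟩ | ⟨h, -⟩ | ⟨h, -⟩ | ⟨h, -⟩ | ⟨h, -⟩
    · exact ⟨μ, hμ, h⟩
    · linarith
    · linarith [(abs_lt.1 h).2]
    · linarith
    · linarith
  have hl : 1 < Real.exp (μ * (2 * Real.pi)) := Real.one_lt_exp_iff.2 (by positivity)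
  obtain ⟨h1, h2, h3⟩ := hu.growing_estimate (S.memLp_hillPotential n) (abs_nonneg (S.α n))
    Real.two_pi_pos hl hn (S.neg_sq_le_hillPotential n) (fun t => by
      rw [huv, huv, hv t, ← mul_assoc]
      push_cast
      rw [← Complex.exp_add]
      congr 2; ring) hb
  rw [downwardCoefficient, Complex.neg_im, Complex.neg_re, norm_neg, h1]
  exact ⟨neg_zero, by linarith, h3⟩

end GratingProblem

/-- Bessel's inequality for weighted orthogonal families. -/
theorem weighted_bessel {H ι : Type*} [NormedAddCommGroup H] [InnerProductSpace ℂ H]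
    {v : ι → H} (hv : Pairwise fun i j => inner ℂ (v i) (v j) = 0) {a : ι → ℝ} {K : ℝ}
    (ha : ∀ i, 0 ≤ a i) (hK0 : 0 ≤ K) (hK : ∀ i, a i * ‖v i‖ ^ 2 ≤ K) (s : Finset ι) (f : H) :
    ∑ i ∈ s, a i * ‖inner ℂ (v i) f‖ ^ 2 ≤ K * ‖f‖ ^ 2 := by
  classical
  set Z := ∑ i ∈ s, a i * ‖inner ℂ (v i) f‖ ^ 2 with hS
  have hS0 : 0 ≤ Z := Finset.sum_nonneg fun i _ => mul_nonneg (ha i) (sq_nonneg _)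
  -- Duality: the inner product of y with f is the sum Z to be bounded, while orthogonality gives
  -- ‖y‖² ≤ K Z. Cauchy–Schwarz then yields Z² ≤ K Z ‖f‖².
  set y : H := ∑ i ∈ s, ((a i : ℂ) * inner ℂ (v i) f) • v i with hy
  have h1 : inner ℂ y f = (Z : ℂ) := by
    rw [hy, sum_inner, hS]
    push_cast
    refine Finset.sum_congr rfl fun i _ => ?_
    rw [inner_smul_left, map_mul, Complex.conj_ofReal, mul_assoc, mul_comm (conj _),
      Complex.mul_conj, Complex.normSq_eq_norm_sq]
    push_cast; rfl
  have h2 : ‖y‖ ^ 2 ≤ K * Z := by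
    have h3 : inner ℂ y y = ((∑ i ∈ s, a i ^ 2 * ‖inner ℂ (v i) f‖ ^ 2 * ‖v i‖ ^ 2 : ℝ) : ℂ) := by
      conv_lhs => rw [hy]
      rw [sum_inner]
      push_cast
      refine Finset.sum_congr rfl fun i hi => ?_
      rw [inner_sum, Finset.sum_eq_single i]
      · rw [inner_smul_left, inner_smul_right, inner_self_eq_norm_sq_to_K, map_mul,
          Complex.conj_ofReal]
        have : inner ℂ (v i) f * conj (inner ℂ (v i) f) = (‖inner ℂ (v i) f‖ : ℂ) ^ 2 := by
          rw [Complex.mul_conj, Complex.normSq_eq_norm_sq]; push_cast; rfl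
        simp only [Complex.coe_algebraMap]
        linear_combination (a i : ℂ) ^ 2 * (‖v i‖ : ℂ) ^ 2 * this
      · intro j _ hj
        rw [inner_smul_left, inner_smul_right, hv hj.symm, mul_zero, mul_zero]
      · exact fun h => absurd hi h
    rw [inner_self_eq_norm_sq_to_K] at h3
    have h4 : ‖y‖ ^ 2 = ∑ i ∈ s, a i ^ 2 * ‖inner ℂ (v i) f‖ ^ 2 * ‖v i‖ ^ 2 := by
      exact Complex.ofReal_injective
        (by simpa only [Complex.coe_algebraMap, Complex.ofReal_pow] using h3)
    rw [h4, hS, Finset.mul_sum]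
    refine Finset.sum_le_sum fun i _ => ?_
    calc a i ^ 2 * ‖inner ℂ (v i) f‖ ^ 2 * ‖v i‖ ^ 2
        = (a i * ‖v i‖ ^ 2) * (a i * ‖inner ℂ (v i) f‖ ^ 2) := by ring
      _ ≤ _ := mul_le_mul_of_nonneg_right (hK i) (mul_nonneg (ha i) (sq_nonneg _))
  have h5 : Z ≤ ‖y‖ * ‖f‖ := by
    have := norm_inner_le_norm (𝕜 := ℂ) y f
    rwa [h1, Complex.norm_real, Real.norm_of_nonneg hS0] at this
  rcases hS0.eq_or_lt with h0 | h0
  · rw [← h0]; positivity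
  · have h6 : Z ^ 2 ≤ Z * (K * ‖f‖ ^ 2) := by
      calc Z ^ 2 ≤ (‖y‖ * ‖f‖) ^ 2 := by gcongr
        _ = ‖y‖ ^ 2 * ‖f‖ ^ 2 := mul_pow _ _ _
        _ ≤ K * Z * ‖f‖ ^ 2 := by gcongr
        _ = _ := by ring
    rw [sq] at h6
    exact le_of_mul_le_mul_left h6 h0

namespace GratingProblem

variable (S : GratingProblem)

/-! ### Separated modes in `L²` of the cell -/

theorem restrict_cell : (volume.restrict S.cell : Measure (ℝ × ℝ))
    = (volume.restrict (Set.Ioo 0 S.p)).prod (volume.restrict (Set.Ioo S.b S.d)) := by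
  rw [Measure.prod_restrict]; rfl

/-- `exp(-i αₙ x)`. -/
def wave (n : ℤ) (x : ℝ) : ℂ := Complex.exp (-(Complex.I * S.α n * x))

theorem continuous_wave (n : ℤ) : Continuous (S.wave n) := by unfold wave; fun_prop

theorem contDiff_wave (n : ℤ) : ContDiff ℝ ∞ (S.wave n) := by
  unfold wave
  exact ((contDiff_const.mul Complex.ofRealCLM.contDiff).neg).cexp

theorem hasDerivAt_wave (n : ℤ) (x : ℝ) :
    HasDerivAt (S.wave n) (-(Complex.I * S.α n) * S.wave n x) x := by
  unfold wave
  have h : HasDerivAt (fun x : ℝ => -(Complex.I * S.α n * x)) (-(Complex.I * S.α n)) x := by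
    have h1 := (Complex.ofRealCLM.hasDerivAt (x := x)).const_mul (Complex.I * S.α n)
    rw [Complex.ofRealCLM_apply, Complex.ofReal_one, mul_one] at h1
    exact h1.neg
  exact h.cexp.congr_deriv (mul_comm _ _)

theorem norm_wave (n : ℤ) (x : ℝ) : ‖S.wave n x‖ = 1 := by
  rw [wave, show -(Complex.I * S.α n * x) = ((-(S.α n * x) : ℝ) : ℂ) * Complex.I by
    push_cast; ring, Complex.norm_exp_ofReal_mul_I]

theorem conj_wave (n : ℤ) (x : ℝ) : conj (S.wave n x) = Complex.exp (Complex.I * S.α n * x) := by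
  rw [wave, ← Complex.exp_conj]
  simp

theorem wave_add_p (n : ℤ) (x : ℝ) :
    S.wave n (x + S.p) = Complex.exp (-(Complex.I * S.αhat * S.p)) * S.wave n x := by
  have hp : (S.p : ℂ) ≠ 0 := by exact_mod_cast S.p_pos.ne'
  have h1 : Complex.exp (((-n : ℤ) : ℂ) * (2 * Real.pi * Complex.I)) = 1 :=
    Complex.exp_int_mul_two_pi_mul_I (-n)
  rw [wave, wave, ← mul_one (Complex.exp _ * _), ← h1, ← Complex.exp_add, ← Complex.exp_add, α]
  congr 1
  push_cast
  field_simp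
  ring

theorem integral_wave_mul (n m : ℤ) :
    ∫ x in Set.Ioo 0 S.p, S.wave n x * conj (S.wave m x) = if n = m then (S.p : ℂ) else 0 := by
  have hp : (S.p : ℂ) ≠ 0 := by exact_mod_cast S.p_pos.ne'
  have hpi : (Real.pi : ℂ) ≠ 0 := by exact_mod_cast Real.pi_ne_zero
  rw [← integral_Ioc_eq_integral_Ioo, ← intervalIntegral.integral_of_le S.p_pos.le]
  have h : ∀ x : ℝ, S.wave n x * conj (S.wave m x)
      = Complex.exp ((2 * Real.pi * Complex.I / S.p * (m - n : ℤ)) * x) := by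
    intro x
    rw [conj_wave, wave, ← Complex.exp_add, α, α]
    congr 1
    push_cast; ring
  simp only [h]
  split_ifs with hnm
  · simp [hnm]
  · have hc : 2 * Real.pi * Complex.I / S.p * ((m - n : ℤ) : ℂ) ≠ 0 := by
      have : ((m - n : ℤ) : ℂ) ≠ 0 := by exact_mod_cast sub_ne_zero.2 (Ne.symm hnm)
      refine mul_ne_zero (div_ne_zero ?_ hp) this
      simp [hpi]
    rw [integral_exp_mul_complex hc]
    have h1 : Complex.exp (((m - n : ℤ) : ℂ) * (2 * Real.pi * Complex.I)) = 1 :=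
      Complex.exp_int_mul_two_pi_mul_I (m - n)
    rw [show 2 * Real.pi * Complex.I / S.p * ((m - n : ℤ) : ℂ) * (S.p : ℂ)
      = ((m - n : ℤ) : ℂ) * (2 * Real.pi * Complex.I) by field_simp, h1]
    simp

/-- The integral of `f` against `r(x₂) exp(-i αₙ x₁)` over the cell. -/
def coef (n : ℤ) (r : ℝ → ℝ) (f : ℝ × ℝ → ℂ) : ℂ :=
  ∫ x in S.cell, f x * (r x.2 * S.wave n x.1)

theorem memLp_continuous {φ : ℝ × ℝ → ℂ} (hφ : Continuous φ) :
    MemLp φ 2 (volume.restrict S.cell) := by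
  have := S.cell_finite
  obtain ⟨M, hM⟩ := (isCompact_Icc.prod isCompact_Icc :
    IsCompact (Set.Icc 0 S.p ×ˢ Set.Icc S.b S.d)).exists_bound_of_continuousOn hφ.continuousOn
  refine MemLp.of_bound hφ.aestronglyMeasurable M ?_
  refine (ae_restrict_iff' (measurableSet_Ioo.prod measurableSet_Ioo)).2 (ae_of_all _ ?_)
  intro x hx
  exact hM x ⟨Set.Ioo_subset_Icc_self hx.1, Set.Ioo_subset_Icc_self hx.2⟩

theorem continuous_modeFun (n : ℤ) {r : ℝ → ℝ} (hr : Continuous r) :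
    Continuous fun x : ℝ × ℝ => (r x.2 : ℂ) * S.wave n x.1 := by
  have := S.continuous_wave n
  fun_prop

/-- The function `r(x₂) exp(i αₙ x₁)` in `L²` of the cell. -/
def mode (n : ℤ) (r : ℝ → ℝ) (hr : Continuous r) : S.L2 :=
  (S.memLp_continuous (Complex.continuous_conj.comp (S.continuous_modeFun n hr))).toLp _

theorem inner_mode (n : ℤ) {r : ℝ → ℝ} (hr : Continuous r) (f : S.L2) :
    inner ℂ (S.mode n r hr) f = S.coef n r f := by
  rw [L2.inner_def, coef]
  refine integral_congr_ae ?_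
  filter_upwards [MemLp.coeFn_toLp
    (S.memLp_continuous (Complex.continuous_conj.comp (S.continuous_modeFun n hr)))] with x hx
  rw [mode, hx, RCLike.inner_apply, Function.comp_apply, Complex.conj_conj]

theorem integral_cell_mul (f g : ℝ → ℂ) :
    ∫ x in S.cell, f x.1 * g x.2
      = (∫ x in Set.Ioo 0 S.p, f x) * ∫ t in Set.Ioo S.b S.d, g t := by
  rw [restrict_cell, integral_prod_mul]

theorem inner_mode_mode (n m : ℤ) {r r' : ℝ → ℝ} (hr : Continuous r) (hr' : Continuous r') :
    inner ℂ (S.mode n r hr) (S.mode m r' hr')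
      = if n = m then ((S.p * ∫ t in S.b..S.d, r t * r' t : ℝ) : ℂ) else 0 := by
  have h1 : inner ℂ (S.mode n r hr) (S.mode m r' hr')
      = ∫ x in S.cell, (S.wave n x.1 * conj (S.wave m x.1)) * ((r x.2 * r' x.2 : ℝ) : ℂ) := by
    rw [inner_mode, coef]
    refine integral_congr_ae ?_
    filter_upwards [MemLp.coeFn_toLp
      (S.memLp_continuous (Complex.continuous_conj.comp (S.continuous_modeFun m hr')))] with x hx
    rw [mode, hx, Function.comp_apply, map_mul, Complex.conj_ofReal]
    push_cast; ring
  rw [h1, S.integral_cell_mul (fun x => S.wave n x * conj (S.wave m x))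
    (fun t => ((r t * r' t : ℝ) : ℂ)), integral_wave_mul]
  split_ifs
  · rw [integral_complex_ofReal, intervalIntegral.integral_of_le S.b_lt_d.le,
      integral_Ioc_eq_integral_Ioo]
    push_cast; rfl
  · rw [zero_mul]

theorem norm_mode_sq (n : ℤ) {r : ℝ → ℝ} (hr : Continuous r) :
    ‖S.mode n r hr‖ ^ 2 = S.p * ∫ t in S.b..S.d, r t ^ 2 := by
  have h := S.inner_mode_mode n n hr hr
  rw [if_pos rfl, inner_self_eq_norm_sq_to_K] at h
  simp only [sq (r _)]
  exact Complex.ofReal_injective (by simpa only [Complex.coe_algebraMap, Complex.ofReal_pow] using h)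

/-! ### Continuity of the coefficients in the profile -/

theorem integrable_coef (n : ℤ) {r : ℝ → ℝ} (hr : Continuous r) (f : S.L2) :
    Integrable (fun x => f x * (r x.2 * S.wave n x.1)) (volume.restrict S.cell) :=
  S.integrable_mul_continuous f (S.continuous_modeFun n hr)

theorem coef_add (n : ℤ) {r r' : ℝ → ℝ} (hr : Continuous r) (hr' : Continuous r') (f : S.L2) :
    S.coef n (fun t => r t + r' t) f = S.coef n r f + S.coef n r' f := by
  rw [coef, coef, coef, ← integral_add (S.integrable_coef n hr f) (S.integrable_coef n hr' f)]
  refine integral_congr_ae (ae_of_all _ fun x => ?_)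
  push_cast; ring

theorem coef_const_mul (n : ℤ) (c : ℝ) (r : ℝ → ℝ) (f : ℝ × ℝ → ℂ) :
    S.coef n (fun t => c * r t) f = c * S.coef n r f := by
  rw [coef, coef, ← integral_const_mul]
  refine integral_congr_ae (ae_of_all _ fun x => ?_)
  push_cast; ring

theorem tendsto_coef (n : ℤ) {ρ : ℕ → ℝ → ℝ} {r : ℝ → ℝ} (hρ : ∀ k, Continuous (ρ k)) {C : ℝ}
    (hC : ∀ k, ∀ t ∈ Set.Ioo S.b S.d, |ρ k t| ≤ C)
    (hlim : ∀ t ∈ Set.Ioo S.b S.d, Tendsto (fun k => ρ k t) atTop (nhds (r t))) (f : S.L2) :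
    Tendsto (fun k => S.coef n (ρ k) f) atTop (nhds (S.coef n r f)) := by
  have := S.cell_finite
  have hmem : ∀ᵐ x ∂(volume.restrict S.cell), x ∈ S.cell :=
    ae_restrict_mem (measurableSet_Ioo.prod measurableSet_Ioo)
  refine tendsto_integral_of_dominated_convergence (fun x => ‖f x‖ * C)
    (fun k => (S.integrable_coef n (hρ k) f).aestronglyMeasurable)
    (((Lp.memLp f).integrable (by norm_num)).norm.mul_const C) (fun k => ?_) ?_
  · filter_upwards [hmem] with x hx
    rw [norm_mul, norm_mul, norm_wave, mul_one, Complex.norm_real, Real.norm_eq_abs]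
    exact mul_le_mul_of_nonneg_left (hC k _ hx.2) (norm_nonneg _)
  · filter_upwards [hmem] with x hx
    have h := (Complex.continuous_ofReal.tendsto _).comp (hlim x.2 hx.2)
    exact (h.mul_const _).const_mul _

/-- A separated profile with compact support in `x₂` is a test function. -/
theorem isTestFunction_profile (n : ℤ) {ρ : ℝ → ℝ} (hρ : ContDiff ℝ ∞ ρ) {b' d' : ℝ}
    (hb : S.b < b') (hd : d' < S.d) (h0 : ∀ t, t ∉ Set.Icc b' d' → ρ t = 0) :
    S.IsTestFunction fun x => (ρ x.2 : ℂ) * S.wave n x.1 := by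
  refine ⟨?_, fun x₁ x₂ => ?_, b', d', hb, hd, fun x hx => ?_⟩
  · exact (Complex.ofRealCLM.contDiff.comp (hρ.comp contDiff_snd)).mul
      ((S.contDiff_wave n).comp contDiff_fst)
  · simp only [wave_add_p]; ring
  · simp only [h0 _ hx, Complex.ofReal_zero, zero_mul]

theorem fderiv_profile (n : ℤ) {ρ : ℝ → ℝ} (hρ : ContDiff ℝ ∞ ρ) (x e : ℝ × ℝ) :
    fderiv ℝ (fun x : ℝ × ℝ => (ρ x.2 : ℂ) * S.wave n x.1) x e
      = ((e.2 * deriv ρ x.2 : ℝ) : ℂ) * S.wave n x.1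
        + e.1 * (-(Complex.I * S.α n) * (ρ x.2 * S.wave n x.1)) := by
  have h1 : HasFDerivAt (fun x : ℝ × ℝ => (ρ x.2 : ℂ)) _ x :=
    ((hρ.differentiable (by simp) x.2).hasDerivAt.ofReal_comp).hasFDerivAt.comp x hasFDerivAt_snd
  have h2 : HasFDerivAt (fun x : ℝ × ℝ => S.wave n x.1) _ x :=
    (S.hasDerivAt_wave n x.1).hasFDerivAt.comp x hasFDerivAt_fst
  have h3 := congrArg (fun A : ℝ × ℝ →L[ℝ] ℂ => A e) (h1.mul h2).fderiv
  refine h3.trans ?_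
  simp
  ring

end GratingProblem

/-! ### Cutoff functions on an interval -/

/-- A smooth step, equal to `0` for `y ≤ 1` and to `1` for `2 ≤ y`. -/
def smoothStep (y : ℝ) : ℝ := Real.smoothTransition (y - 1)

theorem contDiff_smoothStep : ContDiff ℝ ∞ smoothStep :=
  Real.smoothTransition.contDiff.comp (contDiff_id.sub contDiff_const)

theorem smoothStep_of_le {y : ℝ} (hy : y ≤ 1) : smoothStep y = 0 :=
  Real.smoothTransition.zero_of_nonpos (by linarith)

theorem smoothStep_of_ge {y : ℝ} (hy : 2 ≤ y) : smoothStep y = 1 :=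
  Real.smoothTransition.one_of_one_le (by linarith)

theorem abs_smoothStep_le (y : ℝ) : |smoothStep y| ≤ 1 := by
  rw [smoothStep, abs_of_nonneg (Real.smoothTransition.nonneg _)]
  exact Real.smoothTransition.le_one _

theorem deriv_smoothStep_of_lt {y : ℝ} (hy : y < 1) : deriv smoothStep y = 0 := by
  have h : smoothStep =ᶠ[nhds y] fun _ => 0 := by
    filter_upwards [gt_mem_nhds hy] with z hz using smoothStep_of_le (le_of_lt hz)
  rw [h.deriv_eq, deriv_const]

theorem deriv_smoothStep_of_gt {y : ℝ} (hy : 2 < y) : deriv smoothStep y = 0 := by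
  have h : smoothStep =ᶠ[nhds y] fun _ => 1 := by
    filter_upwards [lt_mem_nhds hy] with z hz using smoothStep_of_ge (le_of_lt hz)
  rw [h.deriv_eq, deriv_const]

/-- The quantity y s'(y) is invariant under dilations of the argument, so its bound controls all the
rescaled cutoffs uniformly in k. -/
theorem exists_mul_deriv_smoothStep_le : ∃ C : ℝ, 0 ≤ C ∧ ∀ y, |y * deriv smoothStep y| ≤ C := by
  have hc : Continuous fun y => y * deriv smoothStep y :=
    continuous_id.mul (contDiff_smoothStep.continuous_deriv (by simp))
  obtain ⟨C, hC⟩ := (isCompact_Icc (a := (1 : ℝ)) (b := 2)).exists_bound_of_continuousOn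
    hc.continuousOn
  refine ⟨max C 0, le_max_right _ _, fun y => ?_⟩
  rcases lt_or_ge y 1 with h | h
  · simp [deriv_smoothStep_of_lt h]
  · rcases lt_or_ge 2 y with h2 | h2
    · simp [deriv_smoothStep_of_gt h2]
    · exact (hC y ⟨h, h2⟩).trans (le_max_left _ _)

/-- Smooth functions supported in `(b, d)` which increase to `1` there. -/
def intervalCutoff (b d : ℝ) (k : ℕ) (t : ℝ) : ℝ :=
  smoothStep ((k + 1) * ((t - b) * (d - t)))

section Cutoff

variable {b d : ℝ}

theorem contDiff_intervalCutoff (b d : ℝ) (k : ℕ) : ContDiff ℝ ∞ (intervalCutoff b d k) := by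
  refine contDiff_smoothStep.comp ?_
  fun_prop

theorem deriv_intervalCutoff (b d : ℝ) (k : ℕ) (t : ℝ) :
    deriv (intervalCutoff b d k) t
      = deriv smoothStep ((k + 1) * ((t - b) * (d - t))) * ((k + 1) * (b + d - 2 * t)) := by
  have h1 : HasDerivAt (fun t => ((k : ℝ) + 1) * ((t - b) * (d - t)))
      ((k + 1) * (b + d - 2 * t)) t := by
    have := ((((hasDerivAt_id t).sub_const b).mul ((hasDerivAt_id t).const_sub d)).const_mul
      ((k : ℝ) + 1))
    refine this.congr_deriv ?_
    simp only [id]; ring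
  exact (((contDiff_smoothStep.differentiable (by simp) _).hasDerivAt).comp t h1).deriv

theorem intervalCutoff_support (hbd : b < d) (k : ℕ) :
    ∃ b' d' : ℝ, b < b' ∧ d' < d ∧ ∀ t, t ∉ Set.Icc b' d' → intervalCutoff b d k t = 0 := by
  have hL : 0 < d - b := sub_pos.2 hbd
  have hk : (0 : ℝ) < k + 1 := by positivity
  -- Within distance ε of an end, the argument of the step is at most (k + 1)(d - b)ε = 1, where the
  -- step still vanishes.
  set ε := 1 / ((k + 1) * (d - b)) with hε
  have hε0 : 0 < ε := by positivity
  have hε1 : (k + 1) * (d - b) * ε = 1 := by rw [hε]; field_simp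
  refine ⟨b + ε, d - ε, by linarith, by linarith, fun t ht => smoothStep_of_le ?_⟩
  rcases le_or_gt t b with h1 | h1
  · have : (t - b) * (d - t) ≤ 0 := mul_nonpos_of_nonpos_of_nonneg (by linarith) (by linarith)
    nlinarith
  rcases le_or_gt d t with h2 | h2
  · have : (t - b) * (d - t) ≤ 0 := mul_nonpos_of_nonneg_of_nonpos (by linarith) (by linarith)
    nlinarith
  have h3 : (t - b) * (d - t) ≤ (d - b) * ε := by
    rcases lt_or_ge t (b + ε) with h | h
    · calc (t - b) * (d - t) ≤ ε * (d - b) :=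
            mul_le_mul (by linarith) (by linarith) (by linarith) hε0.le
        _ = _ := mul_comm _ _
    · have h' : d - ε < t := by
        by_contra hcon
        exact ht ⟨h, not_lt.1 hcon⟩
      exact mul_le_mul (by linarith) (by linarith) (by linarith) hL.le
  calc (k + 1 : ℝ) * ((t - b) * (d - t)) ≤ (k + 1) * ((d - b) * ε) := by gcongr
    _ = (k + 1) * (d - b) * ε := by ring
    _ = 1 := hε1

theorem exists_intervalCutoff_deriv_le (b d : ℝ) : ∃ C : ℝ, 0 ≤ C ∧ ∀ k, ∀ t ∈ Set.Ioo b d,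
    |(t - b) * (d - t) * deriv (intervalCutoff b d k) t| ≤ C := by
  obtain ⟨C, hC0, hC⟩ := exists_mul_deriv_smoothStep_le
  refine ⟨C * |d - b|, by positivity, fun k t ht => ?_⟩
  rw [deriv_intervalCutoff]
  have h := hC ((k + 1) * ((t - b) * (d - t)))
  have h2 : |b + d - 2 * t| ≤ |d - b| := by
    rw [abs_le, abs_of_pos (by linarith [ht.1, ht.2])]
    constructor <;> linarith [ht.1, ht.2]
  calc _ = |((k + 1) * ((t - b) * (d - t))) * deriv smoothStep ((k + 1) * ((t - b) * (d - t)))|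
        * |b + d - 2 * t| := by rw [← abs_mul]; congr 1; ring
    _ ≤ _ := by gcongr

theorem eventually_intervalCutoff {t : ℝ} (ht : t ∈ Set.Ioo b d) :
    ∀ᶠ k : ℕ in atTop, intervalCutoff b d k t = 1 ∧ deriv (intervalCutoff b d k) t = 0 := by
  have hw : 0 < (t - b) * (d - t) := mul_pos (sub_pos.2 ht.1) (sub_pos.2 ht.2)
  have h1 : Tendsto (fun k : ℕ => ((k : ℝ) + 1) * ((t - b) * (d - t))) atTop atTop :=
    Tendsto.atTop_mul_const hw (tendsto_atTop_add_const_right _ _ tendsto_natCast_atTop_atTop)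
  filter_upwards [h1.eventually_gt_atTop 2] with k hk
  refine ⟨smoothStep_of_ge hk.le, ?_⟩
  rw [deriv_intervalCutoff, deriv_smoothStep_of_gt hk, zero_mul]

/-- A smooth function vanishing at both ends of an interval is bounded by a multiple of the
product of the distances to the ends. -/
theorem exists_abs_le_of_vanishing (hbd : b < d) {ρ : ℝ → ℝ} (hρ : ContDiff ℝ ∞ ρ)
    (hb : ρ b = 0) (hd : ρ d = 0) :
    ∃ C : ℝ, 0 ≤ C ∧ ∀ t ∈ Set.Ioo b d, |ρ t| ≤ C * ((t - b) * (d - t)) := by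
  obtain ⟨M, hM⟩ := (isCompact_Icc (a := b) (b := d)).exists_bound_of_continuousOn
    (hρ.continuous_deriv (by simp)).continuousOn
  have hL : 0 < d - b := sub_pos.2 hbd
  have hM0 : 0 ≤ M := (norm_nonneg _).trans (hM b ⟨le_rfl, hbd.le⟩)
  have hlip : ∀ s ∈ Set.Icc b d, ∀ t ∈ Set.Icc b d, |ρ t - ρ s| ≤ M * |t - s| := fun s hs t ht =>
    (convex_Icc b d).norm_image_sub_le_of_norm_deriv_le
      (fun x _ => hρ.differentiable (by simp) x) hM hs ht
  refine ⟨2 * M / (d - b), by positivity, fun t ht => ?_⟩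
  have ht' := Set.Ioo_subset_Icc_self ht
  have h1 := hlip b ⟨le_rfl, hbd.le⟩ t ht'
  have h2 := hlip d ⟨hbd.le, le_rfl⟩ t ht'
  rw [hb, sub_zero, abs_of_pos (sub_pos.2 ht.1)] at h1
  rw [hd, sub_zero, abs_sub_comm, abs_of_pos (sub_pos.2 ht.2)] at h2
  -- The bounds by M(t - b) and M(d - t), multiplied by d - t and t - b, are added; the left side
  -- becomes (d - b)|ρ t|.
  rw [div_mul_eq_mul_div, le_div_iff₀ hL]
  have h3 := mul_le_mul_of_nonneg_right h1 (sub_pos.2 ht.2).le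
  have h4 := mul_le_mul_of_nonneg_right h2 (sub_pos.2 ht.1).le
  nlinarith

end Cutoff

namespace GratingProblem

variable {S : GratingProblem}

/-! ### Integration by parts against separated profiles -/

theorem coef_d₁_of_compact (u : S.H1) (n : ℤ) {ρ : ℝ → ℝ} (hρ : ContDiff ℝ ∞ ρ) {b' d' : ℝ}
    (hb : S.b < b') (hd : d' < S.d) (h0 : ∀ t, t ∉ Set.Icc b' d' → ρ t = 0) :
    S.coef n ρ (d₁ u) = Complex.I * S.α n * S.coef n ρ (val u) := by
  have h := u.2.1 _ (S.isTestFunction_profile n hρ hb hd h0)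
  simp only [S.fderiv_profile n hρ] at h
  rw [coef, coef, ← integral_const_mul]
  refine (neg_eq_iff_eq_neg.2 h).symm.trans ?_
  rw [← integral_neg]
  refine integral_congr_ae (ae_of_all _ fun x => ?_)
  simp only [val]
  push_cast
  ring

theorem coef_d₂_of_compact (u : S.H1) (n : ℤ) {ρ : ℝ → ℝ} (hρ : ContDiff ℝ ∞ ρ) {b' d' : ℝ}
    (hb : S.b < b') (hd : d' < S.d) (h0 : ∀ t, t ∉ Set.Icc b' d' → ρ t = 0) :
    S.coef n (deriv ρ) (val u) + S.coef n ρ (d₂ u) = 0 := by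
  have h := u.2.2 _ (S.isTestFunction_profile n hρ hb hd h0)
  simp only [S.fderiv_profile n hρ] at h
  rw [← eq_neg_iff_add_eq_zero]
  refine Eq.trans ?_ h
  refine integral_congr_ae (ae_of_all _ fun x => ?_)
  simp only [val]
  push_cast
  ring

/-- No end condition on the profile is needed: the cutoff depends on x₂ only and is not
differentiated by ∂₁. -/
theorem coef_d₁ (u : S.H1) (n : ℤ) {ρ : ℝ → ℝ} (hρ : ContDiff ℝ ∞ ρ) :
    S.coef n ρ (d₁ u) = Complex.I * S.α n * S.coef n ρ (val u) := by
  obtain ⟨M, hM⟩ := (isCompact_Icc (a := S.b) (b := S.d)).exists_bound_of_continuousOn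
    hρ.continuous.continuousOn
  let χ := intervalCutoff S.b S.d
  have hc : ∀ k, ContDiff ℝ ∞ fun t => χ k t * ρ t := fun k =>
    (contDiff_intervalCutoff S.b S.d k).mul hρ
  have hlim : ∀ f : S.L2, Tendsto (fun k => S.coef n (fun t => χ k t * ρ t) f) atTop
      (nhds (S.coef n ρ f)) := fun f => by
    refine S.tendsto_coef n (fun k => (hc k).continuous) (C := M) (fun k t ht => ?_)
      (fun t ht => ?_) f
    · rw [abs_mul]
      calc |χ k t| * |ρ t| ≤ 1 * M :=
            mul_le_mul (abs_smoothStep_le _) (hM t (Set.Ioo_subset_Icc_self ht)) (abs_nonneg _)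
              zero_le_one
        _ = M := one_mul _
    · refine tendsto_const_nhds.congr' ?_
      filter_upwards [eventually_intervalCutoff ht] with k hk
      rw [show χ k t = 1 from hk.1, one_mul]
  refine tendsto_nhds_unique (hlim (u.1 1)) (((hlim (u.1 0)).const_mul _).congr fun k => ?_)
  obtain ⟨b', d', hb, hd, h0⟩ := intervalCutoff_support S.b_lt_d k
  exact (coef_d₁_of_compact u n (hc k) hb hd fun t ht => by
    rw [show χ k t = 0 from h0 t ht, zero_mul]).symm

/-- The cutoff is now differentiated. Since ρ vanishes at both ends, it compensates the growth of
χₖ' there; the products χₖ'ρ are bounded uniformly in k and tend to 0 pointwise, so dominated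
convergence removes them. -/
theorem coef_d₂ (u : S.H1) (n : ℤ) {ρ : ℝ → ℝ} (hρ : ContDiff ℝ ∞ ρ) (hρb : ρ S.b = 0)
    (hρd : ρ S.d = 0) : S.coef n (deriv ρ) (val u) + S.coef n ρ (d₂ u) = 0 := by
  obtain ⟨M, hM⟩ := (isCompact_Icc (a := S.b) (b := S.d)).exists_bound_of_continuousOn
    hρ.continuous.continuousOn
  have hρ'c : Continuous (deriv ρ) := hρ.continuous_deriv (by simp)
  obtain ⟨M', hM'⟩ := (isCompact_Icc (a := S.b) (b := S.d)).exists_bound_of_continuousOn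
    hρ'c.continuousOn
  obtain ⟨C, hC0, hC⟩ := exists_intervalCutoff_deriv_le S.b S.d
  obtain ⟨A, hA0, hA⟩ := exists_abs_le_of_vanishing S.b_lt_d hρ hρb hρd
  let χ := intervalCutoff S.b S.d
  have hc : ∀ k, ContDiff ℝ ∞ fun t => χ k t * ρ t := fun k =>
    (contDiff_intervalCutoff S.b S.d k).mul hρ
  have hd : ∀ k t, deriv (fun t => χ k t * ρ t) t = deriv (χ k) t * ρ t + χ k t * deriv ρ t :=
    fun k t => (((contDiff_intervalCutoff S.b S.d k).differentiable (by simp) t).hasDerivAt.mul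
      (hρ.differentiable (by simp) t).hasDerivAt).deriv
  have hlim1 : Tendsto (fun k => S.coef n (fun t => χ k t * ρ t) (d₂ u)) atTop
      (nhds (S.coef n ρ (d₂ u))) := by
    refine S.tendsto_coef n (fun k => (hc k).continuous) (C := M) (fun k t ht => ?_)
      (fun t ht => ?_) (u.1 2)
    · rw [abs_mul]
      calc |χ k t| * |ρ t| ≤ 1 * M :=
            mul_le_mul (abs_smoothStep_le _) (hM t (Set.Ioo_subset_Icc_self ht)) (abs_nonneg _)
              zero_le_one
        _ = M := one_mul _
    · refine tendsto_const_nhds.congr' ?_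
      filter_upwards [eventually_intervalCutoff ht] with k hk
      rw [show χ k t = 1 from hk.1, one_mul]
  have hlim2 : Tendsto (fun k => S.coef n (deriv fun t => χ k t * ρ t) (val u)) atTop
      (nhds (S.coef n (deriv ρ) (val u))) := by
    refine S.tendsto_coef n (fun k => (hc k).continuous_deriv (by simp)) (C := A * C + M')
      (fun k t ht => ?_) (fun t ht => ?_) (u.1 0)
    · rw [hd]
      refine (abs_add_le _ _).trans (add_le_add ?_ ?_)
      · have h1 := hC k t ht
        rw [abs_mul, abs_of_pos (mul_pos (sub_pos.2 ht.1) (sub_pos.2 ht.2))] at h1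
        rw [abs_mul]
        calc |deriv (χ k) t| * |ρ t|
            ≤ |deriv (χ k) t| * (A * ((t - S.b) * (S.d - t))) :=
              mul_le_mul_of_nonneg_left (hA t ht) (abs_nonneg _)
          _ = A * ((t - S.b) * (S.d - t) * |deriv (χ k) t|) := by ring
          _ ≤ A * C := mul_le_mul_of_nonneg_left h1 hA0
      · rw [abs_mul]
        calc |χ k t| * |deriv ρ t| ≤ 1 * M' :=
              mul_le_mul (abs_smoothStep_le _) (hM' t (Set.Ioo_subset_Icc_self ht)) (abs_nonneg _)
                zero_le_one
          _ = M' := one_mul _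
    · refine tendsto_const_nhds.congr' ?_
      filter_upwards [eventually_intervalCutoff ht] with k hk
      rw [hd, show χ k t = 1 from hk.1, show deriv (χ k) t = 0 from hk.2]
      ring
  refine tendsto_nhds_unique (hlim2.add hlim1) (tendsto_const_nhds.congr fun k => ?_)
  obtain ⟨b', d', hb, hd', h0⟩ := intervalCutoff_support S.b_lt_d k
  exact (coef_d₂_of_compact u n (hc k) hb hd' fun t ht => by
    rw [show χ k t = 0 from h0 t ht, zero_mul]).symm

end GratingProblem

namespace GratingProblem

variable {S : GratingProblem}

/-! ### Traces -/

theorem norm_H1_sq (u : S.H1) :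
    ‖u‖ ^ 2 = ‖(u.1 0 : S.L2)‖ ^ 2 + ‖(u.1 1 : S.L2)‖ ^ 2 + ‖(u.1 2 : S.L2)‖ ^ 2 := by
  change ‖u.1‖ ^ 2 = _
  rw [PiLp.norm_sq_eq_of_L2, Fin.sum_univ_three]

theorem integral_cell (S : GratingProblem) {f : ℝ × ℝ → ℂ}
    (hf : Integrable f (volume.restrict S.cell)) :
    ∫ x in S.cell, f x = ∫ x in Set.Ioo 0 S.p, ∫ t in Set.Ioo S.b S.d, f (x, t) := by
  rw [restrict_cell] at hf ⊢
  exact integral_prod _ hf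

theorem fourierCoefficient_trace (c : ℝ) (u g : S.L2) (n : ℤ) :
    S.fourierCoefficient (fun x₁ => ((S.d - S.b : ℝ) : ℂ)⁻¹ *
        ∫ t in S.b..S.d, (u (x₁, t) + ((t - c : ℝ) : ℂ) * g (x₁, t))) n
      = ((1 / S.p : ℝ) : ℂ) * (((S.d - S.b : ℝ) : ℂ)⁻¹
        * (S.coef n (fun _ => 1) u + S.coef n (fun t => t - c) g)) := by
  have hu := S.integrable_coef n (r := fun _ => 1) continuous_const u
  have hg := S.integrable_coef n (r := fun t => t - c) (by fun_prop) g
  have h1 : S.coef n (fun _ => 1) u + S.coef n (fun t => t - c) g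
      = ∫ x in Set.Ioo 0 S.p, ∫ t in Set.Ioo S.b S.d,
        (u (x, t) + ((t - c : ℝ) : ℂ) * g (x, t)) * S.wave n x := by
    rw [coef, coef, ← integral_add hu hg]
    refine (S.integral_cell (hu.add hg)).trans ?_
    refine integral_congr_ae (ae_of_all _ fun x => integral_congr_ae (ae_of_all _ fun t => ?_))
    simp only [Pi.add_apply]
    push_cast; ring
  rw [fourierCoefficient, h1, intervalIntegral.integral_of_le S.p_pos.le,
    integral_Ioc_eq_integral_Ioo, ← integral_const_mul (((S.d - S.b : ℝ) : ℂ)⁻¹)]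
  congr 1
  refine integral_congr_ae (ae_of_all _ fun x => ?_)
  simp only [integral_mul_const, wave]
  rw [intervalIntegral.integral_of_le S.b_lt_d.le, integral_Ioc_eq_integral_Ioo]
  ring

/-- The trace is defined with the affine profile (t - c)/(d - b). A profile with the same end values
differs from it by one vanishing at both ends, which contributes nothing by `coef_d₂`. The profile
may therefore be adapted to n. -/
theorem coef_trace (u : S.H1) (n : ℤ) (c : ℝ) {ρ : ℝ → ℝ} (hρ : ContDiff ℝ ∞ ρ)
    (hb : ρ S.b = (S.d - S.b)⁻¹ * (S.b - c)) (hd : ρ S.d = (S.d - S.b)⁻¹ * (S.d - c)) :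
    S.coef n (deriv ρ) (val u) + S.coef n ρ (d₂ u) = ((S.d - S.b : ℝ) : ℂ)⁻¹
      * (S.coef n (fun _ => 1) (val u) + S.coef n (fun t => t - c) (d₂ u)) := by
  let l : ℝ := (S.d - S.b)⁻¹
  let r : ℝ → ℝ := fun t => ρ t - l * (t - c)
  have hr : ContDiff ℝ ∞ r := hρ.sub (by fun_prop)
  have hrd : ∀ t, deriv r t = deriv ρ t - l * 1 := fun t =>
    ((hρ.differentiable (by simp) t).hasDerivAt.sub
      (((hasDerivAt_id t).sub_const c).const_mul l)).deriv
  have h := coef_d₂ u n hr (by simp only [r, hb, l, sub_self]) (by simp only [r, hd, l, sub_self])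
  have h1 : S.coef n ρ (d₂ u) = S.coef n r (d₂ u) + l * S.coef n (fun t => t - c) (d₂ u) := by
    rw [← S.coef_const_mul]
    refine Eq.trans ?_ (S.coef_add n hr.continuous (by fun_prop) (u.1 2))
    exact congrArg (fun ψ => S.coef n ψ (d₂ u)) (funext fun t => by simp only [r]; ring)
  have h2 : S.coef n (deriv ρ) (val u)
      = S.coef n (deriv r) (val u) + l * S.coef n (fun _ => 1) (val u) := by
    rw [← S.coef_const_mul]
    refine Eq.trans ?_ (S.coef_add n (hr.continuous_deriv (by simp)) (by fun_prop) (u.1 0))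
    exact congrArg (fun ψ => S.coef n ψ (val u)) (funext fun t => by rw [hrd]; ring)
  have hl : (l : ℂ) = ((S.d - S.b : ℝ) : ℂ)⁻¹ := by rw [Complex.ofReal_inv]
  rw [h1, h2, ← hl]
  linear_combination h

theorem topCoeff_eq (u : S.H1) (n : ℤ) {ρ : ℝ → ℝ} (hρ : ContDiff ℝ ∞ ρ) (hb : ρ S.b = 0)
    (hd : ρ S.d = 1) :
    topCoeff u n = ((1 / S.p : ℝ) : ℂ) * (S.coef n (deriv ρ) (val u) + S.coef n ρ (d₂ u)) := by
  have h0 : S.d - S.b ≠ 0 := (sub_pos.2 S.b_lt_d).ne'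
  rw [coef_trace u n S.b hρ (by rw [hb, sub_self, mul_zero]) (by rw [hd, inv_mul_cancel₀ h0])]
  exact fourierCoefficient_trace S.b (u.1 0) (u.1 2) n

theorem bottomCoeff_eq (u : S.H1) (n : ℤ) {ρ : ℝ → ℝ} (hρ : ContDiff ℝ ∞ ρ) (hb : ρ S.b = -1)
    (hd : ρ S.d = 0) :
    bottomCoeff u n = ((1 / S.p : ℝ) : ℂ) * (S.coef n (deriv ρ) (val u) + S.coef n ρ (d₂ u)) := by
  have h0 : S.d - S.b ≠ 0 := (sub_pos.2 S.b_lt_d).ne'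
  rw [coef_trace u n S.d hρ
    (by rw [hb, ← neg_sub S.d S.b, mul_neg, inv_mul_cancel₀ h0]) (by rw [hd, sub_self, mul_zero])]
  exact fourierCoefficient_trace S.d (u.1 0) (u.1 2) n

/-! ### The trace inequality with weight |n| + 1 -/

theorem abs_α_le (S : GratingProblem) (n : ℤ) :
    |S.α n| ≤ (|S.αhat| + 2 * Real.pi / S.p) * (|(n : ℝ)| + 1) := by
  have hp := S.p_pos
  have hc : 0 < 2 * Real.pi / S.p := by positivity
  have h : |S.α n| ≤ |S.αhat| + 2 * Real.pi / S.p * |(n : ℝ)| := by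
    rw [α]
    refine (abs_add_le _ _).trans ?_
    rw [abs_mul, abs_of_pos hc]
  have := mul_nonneg (abs_nonneg S.αhat) (abs_nonneg (n : ℝ))
  nlinarith

theorem exists_sq_le_α (S : GratingProblem) : ∃ A : ℝ, 0 < A ∧ ∀ n : ℤ,
    (|(n : ℝ)| + 1) ^ 2 ≤ A * (1 + S.α n ^ 2) := by
  have hp := S.p_pos
  set c : ℝ := S.p / (2 * Real.pi) with hc
  have hc0 : 0 < c := by positivity
  refine ⟨2 * (1 + c * (1 + |S.αhat|)) ^ 2, by positivity, fun n => ?_⟩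
  have h1 : |(n : ℝ)| ≤ c * (|S.α n| + |S.αhat|) := by
    have : (n : ℝ) = c * (S.α n - S.αhat) := by
      rw [α, hc]; field_simp; ring
    rw [this, abs_mul, abs_of_pos hc0]
    exact mul_le_mul_of_nonneg_left (abs_sub _ _) hc0.le
  have h2 : |(n : ℝ)| + 1 ≤ (1 + c * (1 + |S.αhat|)) * (1 + |S.α n|) := by
    have := abs_nonneg (S.α n)
    have := mul_nonneg hc0.le (mul_nonneg (abs_nonneg S.αhat) (abs_nonneg (S.α n)))
    nlinarith
  have h3 : (1 + |S.α n|) ^ 2 ≤ 2 * (1 + S.α n ^ 2) := by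
    rw [← sq_abs (S.α n)]
    nlinarith [sq_nonneg (1 - |S.α n|)]
  calc (|(n : ℝ)| + 1) ^ 2 ≤ ((1 + c * (1 + |S.αhat|)) * (1 + |S.α n|)) ^ 2 := by gcongr
    _ = (1 + c * (1 + |S.αhat|)) ^ 2 * (1 + |S.α n|) ^ 2 := mul_pow _ _ _
    _ ≤ (1 + c * (1 + |S.αhat|)) ^ 2 * (2 * (1 + S.α n ^ 2)) := by gcongr
    _ = _ := by ring

theorem pairwise_inner_mode {r : ℤ → ℝ → ℝ} (hr : ∀ n, Continuous (r n)) :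
    Pairwise fun n m => inner ℂ (S.mode n (r n) (hr n)) (S.mode m (r m) (hr m)) = 0 :=
  fun n m hnm => (S.inner_mode_mode n m _ _).trans (if_neg hnm)

/-- The hypotheses describe profiles living in a layer of width of order 1/(|n|+1). Bessel's
inequality for ∂₂u against ρₙ tolerates the weight |n|+1 because ∫ρₙ² is small. For u against ρₙ' it
tolerates only (|n|+1)/(1+αₙ²); using it for both u and ∂₁u restores the factor 1+αₙ², since the
coefficients of ∂₁u are iαₙ times those of u. -/
theorem exists_trace_bound (S : GratingProblem) : ∃ K : ℝ, 0 ≤ K ∧ ∀ ρ : ℤ → ℝ → ℝ,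
    (∀ n, ContDiff ℝ ∞ (ρ n)) →
    (∀ n : ℤ, (|(n : ℝ)| + 1) * ∫ t in S.b..S.d, ρ n t ^ 2 ≤ S.d - S.b) →
    (∀ n : ℤ, ∫ t in S.b..S.d, deriv (ρ n) t ^ 2 ≤ (|(n : ℝ)| + 1) / (S.d - S.b)) →
    ∀ (u : S.H1) (s : Finset ℤ), ∑ n ∈ s, (|(n : ℝ)| + 1) *
      ‖S.coef n (deriv (ρ n)) (val u) + S.coef n (ρ n) (d₂ u)‖ ^ 2 ≤ K * ‖u‖ ^ 2 := by
  obtain ⟨A, hA, hαA⟩ := S.exists_sq_le_α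
  have hp := S.p_pos
  have hL : 0 < S.d - S.b := sub_pos.2 S.b_lt_d
  refine ⟨2 * (S.p * A / (S.d - S.b)) + 2 * (S.p * (S.d - S.b)), by positivity,
    fun ρ hρ h1 h2 u s => ?_⟩
  have hc : ∀ n, Continuous (ρ n) := fun n => (hρ n).continuous
  have hdc : ∀ n, Continuous (deriv (ρ n)) := fun n => (hρ n).continuous_deriv (by simp)
  have hds : ∀ n, ContDiff ℝ ∞ (deriv (ρ n)) := fun n =>
    (contDiff_infty_iff_deriv.1 (hρ n)).2
  have hY : ∑ n ∈ s, (|(n : ℝ)| + 1) * ‖S.coef n (ρ n) (d₂ u)‖ ^ 2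
      ≤ S.p * (S.d - S.b) * ‖(u.1 2 : S.L2)‖ ^ 2 := by
    have := weighted_bessel (pairwise_inner_mode hc) (a := fun n => |(n : ℝ)| + 1)
      (fun n => by positivity) (by positivity : 0 ≤ S.p * (S.d - S.b)) (fun n => by
        rw [norm_mode_sq, mul_left_comm]
        exact mul_le_mul_of_nonneg_left (h1 n) hp.le) s (u.1 2)
    simp only [inner_mode] at this
    exact this
  have hX : ∀ f : S.L2, ∑ n ∈ s, (|(n : ℝ)| + 1) / (1 + S.α n ^ 2) *
      ‖S.coef n (deriv (ρ n)) f‖ ^ 2 ≤ S.p * A / (S.d - S.b) * ‖f‖ ^ 2 := by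
    intro f
    have := weighted_bessel (pairwise_inner_mode hdc)
      (a := fun n => (|(n : ℝ)| + 1) / (1 + S.α n ^ 2))
      (fun n => by positivity) (by positivity : 0 ≤ S.p * A / (S.d - S.b)) (fun n => by
        rw [norm_mode_sq]
        calc (|(n : ℝ)| + 1) / (1 + S.α n ^ 2) * (S.p * ∫ t in S.b..S.d, deriv (ρ n) t ^ 2)
            ≤ (|(n : ℝ)| + 1) / (1 + S.α n ^ 2) * (S.p * ((|(n : ℝ)| + 1) / (S.d - S.b))) := by
              gcongr; exact h2 n
          _ = S.p / (S.d - S.b) * ((|(n : ℝ)| + 1) ^ 2 / (1 + S.α n ^ 2)) := by ring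
          _ ≤ S.p / (S.d - S.b) * A := by
              gcongr
              rw [div_le_iff₀ (by positivity)]
              exact hαA n
          _ = _ := by ring) s f
    simpa only [inner_mode] using this
  have hXX : ∑ n ∈ s, (|(n : ℝ)| + 1) * ‖S.coef n (deriv (ρ n)) (val u)‖ ^ 2
      ≤ S.p * A / (S.d - S.b) * (‖(u.1 0 : S.L2)‖ ^ 2 + ‖(u.1 1 : S.L2)‖ ^ 2) := by
    rw [mul_add]
    refine le_trans (le_of_eq ?_) (add_le_add (hX (u.1 0)) (hX (u.1 1)))
    rw [← Finset.sum_add_distrib]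
    refine Finset.sum_congr rfl fun n _ => ?_
    have h3 := coef_d₁ u n (hds n)
    simp only [d₁, val] at h3 ⊢
    rw [h3, norm_mul, norm_mul, Complex.norm_I, one_mul, Complex.norm_real, Real.norm_eq_abs,
      mul_pow, sq_abs]
    have : 1 + S.α n ^ 2 ≠ 0 := by positivity
    field_simp
  calc ∑ n ∈ s, (|(n : ℝ)| + 1) *
        ‖S.coef n (deriv (ρ n)) (val u) + S.coef n (ρ n) (d₂ u)‖ ^ 2
      ≤ ∑ n ∈ s, (2 * ((|(n : ℝ)| + 1) * ‖S.coef n (deriv (ρ n)) (val u)‖ ^ 2)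
          + 2 * ((|(n : ℝ)| + 1) * ‖S.coef n (ρ n) (d₂ u)‖ ^ 2)) := by
        refine Finset.sum_le_sum fun n _ => ?_
        have h3 := norm_add_le (S.coef n (deriv (ρ n)) (val u)) (S.coef n (ρ n) (d₂ u))
        have h4 := pow_le_pow_left₀ (norm_nonneg _) h3 2
        have h5 : (0 : ℝ) ≤ |(n : ℝ)| + 1 := by positivity
        refine (mul_le_mul_of_nonneg_left (h4.trans (add_sq_le)) h5).trans (le_of_eq ?_)
        ring
    _ ≤ 2 * (S.p * A / (S.d - S.b) * (‖(u.1 0 : S.L2)‖ ^ 2 + ‖(u.1 1 : S.L2)‖ ^ 2))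
          + 2 * (S.p * (S.d - S.b) * ‖(u.1 2 : S.L2)‖ ^ 2) := by
        rw [Finset.sum_add_distrib, ← Finset.mul_sum, ← Finset.mul_sum]
        gcongr
    _ ≤ _ := by
        rw [norm_H1_sq]
        have e1 : 0 ≤ S.p * A / (S.d - S.b) * ‖(u.1 2 : S.L2)‖ ^ 2 := by positivity
        have e2 : 0 ≤ S.p * (S.d - S.b) * (‖(u.1 0 : S.L2)‖ ^ 2 + ‖(u.1 1 : S.L2)‖ ^ 2) := by
          positivity
        nlinarith

theorem integral_profile_pow {b d e l : ℝ} (hl : l ≠ 0) (j : ℕ) :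
    ∫ t in b..d, ((t - e) / l) ^ j
      = l * (((d - e) / l) ^ (j + 1) - ((b - e) / l) ^ (j + 1)) / (j + 1) := by
  have h : ∀ t ∈ Set.uIcc b d, HasDerivAt (fun t => l * ((t - e) / l) ^ (j + 1) / (j + 1))
      (((t - e) / l) ^ j) t := by
    intro t _
    have h1 := ((((hasDerivAt_id t).sub_const e).div_const l).pow (j + 1)).const_mul l
    refine (h1.div_const ((j : ℝ) + 1)).congr_deriv ?_
    simp only [id, Nat.add_sub_cancel]
    push_cast
    field_simp
  rw [intervalIntegral.integral_eq_sub_of_hasDerivAt h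
    (Continuous.intervalIntegrable (by fun_prop) _ _)]
  ring

theorem exists_coeff_bound (S : GratingProblem) : ∃ K : ℝ, 0 ≤ K ∧ ∀ (u : S.H1) (s : Finset ℤ),
    ∑ n ∈ s, (|(n : ℝ)| + 1) * ‖topCoeff u n‖ ^ 2 ≤ K * ‖u‖ ^ 2 ∧
    ∑ n ∈ s, (|(n : ℝ)| + 1) * ‖bottomCoeff u n‖ ^ 2 ≤ K * ‖u‖ ^ 2 := by
  obtain ⟨K, hK0, hK⟩ := S.exists_trace_bound
  have hp := S.p_pos
  have hL : 0 < S.d - S.b := sub_pos.2 S.b_lt_d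
  have hL' : S.b - S.d ≠ 0 := by linarith
  -- The data (1, d - b, b) serve the upper edge and (-1, b - d, d) the lower one. The exponent is
  -- |n| + 1 rather than |n| so that the profile vanishes at the opposite edge also for n = 0.
  have key : ∀ (σ l e : ℝ), σ ^ 2 = 1 → l ^ 2 = (S.d - S.b) ^ 2 →
      (∀ j : ℕ, ∫ t in S.b..S.d, ((t - e) / l) ^ (2 * j) = (S.d - S.b) / (2 * j + 1)) →
      ∀ (u : S.H1) (s : Finset ℤ), ∑ n ∈ s, (|(n : ℝ)| + 1) *
        ‖S.coef n (deriv fun t => σ * ((t - e) / l) ^ (n.natAbs + 1)) (val u)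
          + S.coef n (fun t => σ * ((t - e) / l) ^ (n.natAbs + 1)) (d₂ u)‖ ^ 2 ≤ K * ‖u‖ ^ 2 := by
    intro σ l e hσ hl hint u s
    have hl0 : l ≠ 0 := fun h => by rw [h] at hl; nlinarith
    have hd : ∀ (j : ℕ) t, deriv (fun t => σ * ((t - e) / l) ^ (j + 1)) t
        = σ * ((j + 1) * ((t - e) / l) ^ j / l) := fun j t => by
      have h1 := ((((hasDerivAt_id t).sub_const e).div_const l).pow (j + 1)).const_mul σ
      refine h1.deriv.trans ?_
      simp only [id, Nat.add_sub_cancel]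
      push_cast; ring
    refine hK (fun (n : ℤ) t => σ * ((t - e) / l) ^ (n.natAbs + 1)) (fun n => by fun_prop)
      (fun n => ?_) (fun n => ?_) u s
    · have h1 : ∀ t, (σ * ((t - e) / l) ^ (n.natAbs + 1)) ^ 2
          = ((t - e) / l) ^ (2 * (n.natAbs + 1)) := fun t => by
        rw [mul_pow, hσ, one_mul, ← pow_mul, mul_comm]
      simp only [h1, hint, ← Int.cast_abs, Int.abs_eq_natAbs, Int.cast_natCast]
      push_cast
      rw [mul_div_assoc', div_le_iff₀ (by positivity), mul_comm]
      gcongr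
      have : (0 : ℝ) ≤ n.natAbs := by positivity
      linarith
    · have h1 : ∀ t, (deriv (fun t => σ * ((t - e) / l) ^ (n.natAbs + 1)) t) ^ 2
          = ((n.natAbs : ℝ) + 1) ^ 2 / (S.d - S.b) ^ 2 * ((t - e) / l) ^ (2 * n.natAbs) :=
        fun t => by
        rw [hd, ← hl, mul_pow, hσ, one_mul, div_pow, mul_pow, ← pow_mul, mul_comm 2]
        ring
      simp only [h1, intervalIntegral.integral_const_mul, hint, ← Int.cast_abs,
        Int.abs_eq_natAbs, Int.cast_natCast]
      rw [div_mul_div_comm, div_le_div_iff₀ (by positivity) hL]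
      have h2 : (0 : ℝ) ≤ n.natAbs := by positivity
      have h3 : 0 ≤ ((n.natAbs : ℝ) + 1) * (S.d - S.b) ^ 2 := by positivity
      nlinarith
  refine ⟨(1 / S.p) ^ 2 * K, by positivity, fun u s => ⟨?_, ?_⟩⟩
  · have h := key 1 (S.d - S.b) S.b (by norm_num) rfl (fun j => by
      rw [integral_profile_pow hL.ne', div_self hL.ne', sub_self, zero_div]
      simp) u s
    rw [mul_assoc]
    refine le_trans (le_of_eq ?_) (mul_le_mul_of_nonneg_left h (sq_nonneg _))
    rw [Finset.mul_sum]
    refine Finset.sum_congr rfl fun n _ => ?_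
    rw [topCoeff_eq u n (ρ := fun t => 1 * ((t - S.b) / (S.d - S.b)) ^ (n.natAbs + 1))
      (by fun_prop) (by simp) (by simp [div_self hL.ne']), norm_mul, Complex.norm_real,
      Real.norm_eq_abs, mul_pow, sq_abs]
    ring
  · have h := key (-1) (S.b - S.d) S.d (by norm_num) (by ring) (fun j => by
      rw [integral_profile_pow hL', div_self hL', sub_self, zero_div]
      push_cast
      simp) u s
    rw [mul_assoc]
    refine le_trans (le_of_eq ?_) (mul_le_mul_of_nonneg_left h (sq_nonneg _))
    rw [Finset.mul_sum]
    refine Finset.sum_congr rfl fun n _ => ?_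
    rw [bottomCoeff_eq u n (ρ := fun t => (-1) * ((t - S.d) / (S.b - S.d)) ^ (n.natAbs + 1))
      (by fun_prop) (by simp [div_self hL']) (by simp), norm_mul, Complex.norm_real,
      Real.norm_eq_abs, mul_pow, sq_abs]
    ring

end GratingProblem

/-! ### A criterion for compactness -/

theorem isCompactOperator_smulRight {H E : Type*} [NormedAddCommGroup H] [NormedSpace ℂ H]
    [NormedAddCommGroup E] [NormedSpace ℂ E] (φ : H →L[ℂ] ℂ) (e : E) :
    IsCompactOperator (φ.smulRight e) :=
  (isCompactOperator_of_locallyCompactSpace_dom φ).clm_comp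
    (ContinuousLinearMap.toSpanSingleton ℂ e)

theorem IsCompactOperator.finset_sum {H E ι : Type*} [NormedAddCommGroup H]
    [NormedAddCommGroup E] (s : Finset ι) (f : ι → H → E)
    (hf : ∀ i ∈ s, IsCompactOperator (f i)) : IsCompactOperator fun u => ∑ i ∈ s, f i u := by
  classical
  induction s using Finset.induction_on with
  | empty => exact isCompactOperator_zero
  | insert i s hi ih =>
    simp only [Finset.sum_insert hi]
    exact (hf i (Finset.mem_insert_self _ _)).add
      (ih fun j hj => hf j (Finset.mem_insert_of_mem hj))

/-- An operator is compact if its coefficients in a Hilbert basis are square summable, uniformly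
on bounded sets, with weights that tend to infinity. -/
theorem isCompactOperator_of_weighted_coefficients {H E ι : Type*} [NormedAddCommGroup H]
    [InnerProductSpace ℂ H] [NormedAddCommGroup E] [InnerProductSpace ℂ E] [CompleteSpace E]
    (e : HilbertBasis ι ℂ E) (A : H →L[ℂ] E) {D : ι → ℝ} (hD : Tendsto D cofinite atTop) {C : ℝ}
    (hD0 : ∀ i, 0 ≤ D i)
    (h : ∀ (u : H) (s : Finset ι), ∑ i ∈ s, D i * ‖inner ℂ (e i) (A u)‖ ^ 2 ≤ C * ‖u‖ ^ 2) :
    IsCompactOperator A := by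
  classical
  have hfin : ∀ R : ℕ, {i | ¬ (R : ℝ) + 1 ≤ D i}.Finite := fun R =>
    Filter.eventually_cofinite.1 (hD.eventually_ge_atTop ((R : ℝ) + 1))
  -- Truncation to the finitely many indices with D i < R + 1. The remainder has squared norm at
  -- most |C|/(R + 1), so the finite rank operators P R converge to A in norm.
  let P : ℕ → H →L[ℂ] E := fun R => ∑ i ∈ (hfin R).toFinset,
    ((innerSL ℂ (e i)).comp A).smulRight (e i)
  have hPapp : ∀ R u, P R u = ∑ i ∈ (hfin R).toFinset, inner ℂ (e i) (A u) • e i := by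
    intro R u
    simp [P]
  have hPc : ∀ R, IsCompactOperator (P R) := fun R => by
    have := IsCompactOperator.finset_sum (hfin R).toFinset
      (fun i => ((((innerSL ℂ (e i)).comp A).smulRight (e i) : H →L[ℂ] E) : H → E))
      fun i _ => isCompactOperator_smulRight _ _
    convert this using 1
    funext u
    simp [P]
  have hcoef : ∀ R u i, inner ℂ (e i) (A u - P R u)
      = if (R : ℝ) + 1 ≤ D i then inner ℂ (e i) (A u) else 0 := by
    intro R u i
    have h1 : inner ℂ (e i) (P R u)
        = if i ∈ (hfin R).toFinset then inner ℂ (e i) (A u) else 0 := by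
      rw [hPapp, inner_sum]
      simp only [inner_smul_right, orthonormal_iff_ite.1 e.orthonormal, mul_ite, mul_one, mul_zero,
        Finset.sum_ite_eq]
    rw [inner_sub_right, h1]
    simp only [Set.Finite.mem_toFinset, Set.mem_ofPred_eq]
    by_cases h : (R : ℝ) + 1 ≤ D i <;> simp [h]
  have hsum : ∀ (x : E), HasSum (fun i => ‖inner ℂ (e i) x‖ ^ 2) (‖x‖ ^ 2) := by
    intro x
    have h1 := e.hasSum_inner_mul_inner x x
    rw [inner_self_eq_norm_sq_to_K] at h1
    have h2 := Complex.hasSum_re h1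
    convert h2 using 1
    · funext i
      rw [← inner_conj_symm x (e i), mul_comm, Complex.mul_conj, Complex.normSq_eq_norm_sq,
        Complex.ofReal_re]
    · simp only [Complex.coe_algebraMap, ← Complex.ofReal_pow, Complex.ofReal_re]
  have hbound : ∀ R u, ‖A u - P R u‖ ^ 2 ≤ C / ((R : ℝ) + 1) * ‖u‖ ^ 2 := by
    intro R u
    refine le_of_tendsto' (hsum (A u - P R u)) fun s => ?_
    rw [div_mul_eq_mul_div, le_div_iff₀ (by positivity), Finset.sum_mul]
    refine le_trans (Finset.sum_le_sum fun i _ => ?_) (h u s)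
    rw [hcoef]
    split_ifs with hi
    · rw [mul_comm]
      exact mul_le_mul_of_nonneg_right hi (sq_nonneg _)
    · rw [norm_zero, sq, zero_mul, zero_mul]
      exact mul_nonneg (hD0 i) (sq_nonneg _)
  refine isCompactOperator_of_tendsto (F := P) (l := atTop) ?_ (Eventually.of_forall hPc)
  rw [tendsto_iff_norm_sub_tendsto_zero]
  have hlim : Tendsto (fun R : ℕ => √(|C| / ((R : ℝ) + 1))) atTop (nhds 0) := by
    rw [← Real.sqrt_zero]
    refine (Real.continuous_sqrt.tendsto 0).comp ?_
    exact tendsto_const_nhds.div_atTop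
      (tendsto_atTop_add_const_right _ _ tendsto_natCast_atTop_atTop)
  refine squeeze_zero (fun _ => norm_nonneg _) (fun R => ?_) hlim
  refine ContinuousLinearMap.opNorm_le_bound _ (Real.sqrt_nonneg _) fun u => ?_
  rw [← norm_neg, sub_apply, neg_sub]
  refine le_of_sq_le_sq ?_ (by positivity)
  rw [mul_pow, Real.sq_sqrt (by positivity)]
  refine (hbound R u).trans ?_
  gcongr
  exact le_abs_self C

/-! ### Completeness of the exponentials and of the cosines on an interval -/

theorem ae_eq_zero_of_fourierCoeffOn {a b : ℝ} (hab : a < b) {f : ℝ → ℂ}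
    (hf : MemLp f 2 (volume.restrict (Set.Ioc a b))) (h : ∀ n, fourierCoeffOn hab f n = 0) :
    f =ᵐ[volume.restrict (Set.Ioc a b)] 0 := by
  have h1 := hasSum_sq_fourierCoeffOn hab hf
  simp only [h, norm_zero, ne_eq, OfNat.ofNat_ne_zero, not_false_eq_true, zero_pow] at h1
  have h2 := h1.unique hasSum_zero
  rw [smul_eq_mul, mul_eq_zero, or_iff_right (inv_ne_zero (sub_pos.2 hab).ne'),
    intervalIntegral.integral_of_le hab.le] at h2
  rw [integral_eq_zero_iff_of_nonneg (fun _ => sq_nonneg _)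
    ((memLp_two_iff_integrable_sq_norm hf.1).1 hf)] at h2
  filter_upwards [h2] with x hx
  simpa using hx

/-- After even reflection about b, the Fourier coefficients on the doubled interval are multiples of
cosine integrals of f, so completeness of the exponentials applies. -/
theorem ae_eq_zero_of_integral_mul_cos {b d : ℝ} (hbd : b < d) {f : ℝ → ℂ}
    (hf : MemLp f 2 (volume.restrict (Set.Ioo b d)))
    (h : ∀ m : ℕ, ∫ t in Set.Ioo b d,
      f t * ((Real.cos (m * Real.pi * (t - b) / (d - b)) : ℝ) : ℂ) = 0) :
    f =ᵐ[volume.restrict (Set.Ioo b d)] 0 := by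
  have hL : 0 < d - b := sub_pos.2 hbd
  have hab : 2 * b - d < d := by linarith
  have hss : Set.Ioo b d ⊆ Set.Ioc (2 * b - d) d := fun t (ht : b < t ∧ t < d) =>
    show 2 * b - d < t ∧ t ≤ d from ⟨by linarith [ht.1], ht.2.le⟩
  let F : ℝ → ℂ := (Set.Ioo b d).indicator f
  have hF : MemLp F 2 volume := (memLp_indicator_iff_restrict measurableSet_Ioo).2 hf
  have hmp : MeasurePreserving (fun t : ℝ => 2 * b - t) volume volume :=
    Measure.measurePreserving_sub_left volume (2 * b)
  have hF' : MemLp (fun t => F (2 * b - t)) 2 volume := hF.comp_measurePreserving hmp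
  let G : ℝ → ℂ := fun t => F t + F (2 * b - t)
  have hG : MemLp G 2 volume := hF.add hF'
  have hFi : ∀ x y : ℝ, IntervalIntegrable F volume x y := fun x y => by
    rw [intervalIntegrable_iff]
    exact (hF.locallyIntegrable (by norm_num)).integrableOn_isCompact isCompact_uIcc
      |>.mono_set Set.uIoc_subset_uIcc
  have hF'i : ∀ x y : ℝ, IntervalIntegrable (fun t => F (2 * b - t)) volume x y := fun x y => by
    rw [intervalIntegrable_iff]
    exact (hF'.locallyIntegrable (by norm_num)).integrableOn_isCompact isCompact_uIcc
      |>.mono_set Set.uIoc_subset_uIcc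
  have hzero := ae_eq_zero_of_fourierCoeffOn hab (hG.restrict _) (fun n => by
    rw [fourierCoeffOn_eq_integral]
    refine smul_eq_zero_of_right _ ?_
    let E : ℝ → ℂ := fun t => Complex.exp (-(Real.pi * Complex.I * n * t / (d - b)))
    have hE : Continuous E := by fun_prop
    have hfour : ∀ t : ℝ, fourier (-n) (t : AddCircle (d - (2 * b - d))) = E t := by
      intro t
      rw [fourier_coe_apply]
      simp only [E]
      congr 1
      have : (d : ℂ) - b ≠ 0 := by exact_mod_cast hL.ne'
      rw [show d - (2 * b - d) = 2 * (d - b) by ring]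
      push_cast
      field_simp
    simp only [hfour, smul_eq_mul, G, mul_add]
    rw [intervalIntegral.integral_add ((hFi _ _).continuousOn_mul hE.continuousOn)
      ((hF'i _ _).continuousOn_mul hE.continuousOn)]
    have hsub : ∫ t in (2 * b - d)..d, E t * F (2 * b - t)
        = ∫ t in (2 * b - d)..d, E (2 * b - t) * F t := by
      have := intervalIntegral.integral_comp_sub_left (a := 2 * b - d) (b := d)
        (fun t => E (2 * b - t) * F t) (2 * b)
      simp only [sub_sub_cancel] at this
      exact this
    rw [hsub, ← intervalIntegral.integral_add ((hFi _ _).continuousOn_mul hE.continuousOn)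
      ((hFi _ _).continuousOn_mul (by fun_prop)), intervalIntegral.integral_of_le hab.le]
    -- The exponential and its reflection add up to a phase times 2cos. The cosine is even, so only
    -- |n| enters.
    have hsum : ∀ t, E t * F t + E (2 * b - t) * F t = (Set.Ioo b d).indicator (fun t =>
        2 * Complex.exp (-(Real.pi * Complex.I * n * b / (d - b))) *
          (f t * ((Real.cos (n.natAbs * Real.pi * (t - b) / (d - b)) : ℝ) : ℂ))) t := by
      intro t
      by_cases ht : t ∈ Set.Ioo b d
      · simp only [F, Set.indicator_of_mem ht]
        have hcos : Real.cos (n.natAbs * Real.pi * (t - b) / (d - b))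
            = Real.cos (n * (Real.pi * (t - b) / (d - b))) := by
          rcases Int.natAbs_eq n with h | h
          · conv_rhs => rw [h]
            simp only [Int.cast_natCast]; congr 1; ring
          · conv_rhs => rw [h]
            rw [← Real.cos_neg]
            simp only [Int.cast_natCast, Int.cast_neg]; congr 1; ring
        rw [hcos, Complex.ofReal_cos, Complex.cos]
        have e1 : E t = Complex.exp (-(Real.pi * Complex.I * n * b / (d - b))) *
            Complex.exp (-((n * (Real.pi * (t - b) / (d - b)) : ℝ) : ℂ) * Complex.I) := by
          rw [← Complex.exp_add]
          simp only [E]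
          congr 1
          push_cast; ring
        have e2 : E (2 * b - t) = Complex.exp (-(Real.pi * Complex.I * n * b / (d - b))) *
            Complex.exp (((n * (Real.pi * (t - b) / (d - b)) : ℝ) : ℂ) * Complex.I) := by
          rw [← Complex.exp_add]
          simp only [E]
          congr 1
          push_cast; ring
        rw [e1, e2]
        ring
      · simp only [F, Set.indicator_of_notMem ht, mul_zero, add_zero]
    simp only [hsum]
    rw [setIntegral_indicator measurableSet_Ioo,
      Set.inter_eq_right.2 hss, integral_const_mul, h, mul_zero])
  have hzero' : ∀ᵐ t ∂(volume.restrict (Set.Ioo b d)), G t = 0 :=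
    ae_restrict_of_ae_restrict_of_subset hss hzero
  filter_upwards [hzero', ae_restrict_mem measurableSet_Ioo] with t ht hmem
  have h1 : (2 * b - t) ∉ Set.Ioo b d := fun h => by linarith [h.1, hmem.1]
  rw [Pi.zero_apply]
  simpa only [G, F, Set.indicator_of_mem hmem, Set.indicator_of_notMem h1, add_zero] using ht

/-! ### Square integrable functions on a product -/

/-- Cauchy–Schwarz against the constant 1, obtained by expanding ∫(m‖f‖ - I)² ≥ 0. -/
theorem sq_norm_integral_le {X : Type*} [MeasurableSpace X] {μ : Measure X} [IsFiniteMeasure μ]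
    {f : X → ℂ} (hf : MemLp f 2 μ) : ‖∫ x, f x ∂μ‖ ^ 2 ≤ μ.real Set.univ * ∫ x, ‖f x‖ ^ 2 ∂μ := by
  have h1 : Integrable (fun x => ‖f x‖) μ := (hf.integrable (by norm_num)).norm
  have h2 : Integrable (fun x => ‖f x‖ ^ 2) μ := (memLp_two_iff_integrable_sq_norm hf.1).1 hf
  set m := μ.real Set.univ
  set I := ∫ x, ‖f x‖ ∂μ
  have hm : 0 ≤ m := measureReal_nonneg
  have h3 : 0 ≤ ∫ x, (m * ‖f x‖ - I) ^ 2 ∂μ := integral_nonneg fun _ => sq_nonneg _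
  have h4 : ∫ x, (m * ‖f x‖ - I) ^ 2 ∂μ = m * (m * ∫ x, ‖f x‖ ^ 2 ∂μ - I ^ 2) := by
    have h5 : ∀ x, (m * ‖f x‖ - I) ^ 2 = m ^ 2 * ‖f x‖ ^ 2 - 2 * m * I * ‖f x‖ + I ^ 2 := fun x => by
      ring
    simp only [h5]
    have i1 : Integrable (fun x => m ^ 2 * ‖f x‖ ^ 2 - 2 * m * I * ‖f x‖) μ :=
      (h2.const_mul _).sub (h1.const_mul _)
    rw [integral_add i1 (integrable_const _),
      integral_sub (h2.const_mul _) (h1.const_mul _), integral_const_mul, integral_const_mul,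
      integral_const, smul_eq_mul]
    ring
  have h6 : ‖∫ x, f x ∂μ‖ ^ 2 ≤ I ^ 2 := by
    have := norm_integral_le_integral_norm (μ := μ) f
    gcongr
  refine h6.trans ?_
  rcases hm.eq_or_lt with h0 | h0
  · have : μ = 0 := by
      rw [← Measure.measure_univ_eq_zero]
      exact (measureReal_eq_zero_iff).1 h0.symm
    simp [I, this]
  · rw [h4] at h3
    have := nonneg_of_mul_nonneg_right h3 h0
    linarith

/-! ### The cosine basis of L² of the cell and the compact embedding of H¹ -/

namespace GratingProblem

variable (S : GratingProblem)

/-- The cosine profiles. -/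
def cosProfile (m : ℕ) (t : ℝ) : ℝ := Real.cos (m * Real.pi * (t - S.b) / (S.d - S.b))

/-- The sine profiles. -/
def sinProfile (m : ℕ) (t : ℝ) : ℝ := Real.sin (m * Real.pi * (t - S.b) / (S.d - S.b))

theorem contDiff_cosProfile (m : ℕ) : ContDiff ℝ ∞ (S.cosProfile m) := by
  unfold cosProfile; fun_prop

theorem contDiff_sinProfile (m : ℕ) : ContDiff ℝ ∞ (S.sinProfile m) := by
  unfold sinProfile; fun_prop

theorem deriv_sinProfile (m : ℕ) :
    deriv (S.sinProfile m) = fun t => m * Real.pi / (S.d - S.b) * S.cosProfile m t := by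
  funext t
  have h1 : HasDerivAt (fun t => m * Real.pi * (t - S.b) / (S.d - S.b))
      (m * Real.pi / (S.d - S.b)) t := by
    refine ((((hasDerivAt_id t).sub_const S.b).const_mul (m * Real.pi)).div_const
      (S.d - S.b)).congr_deriv ?_
    ring
  rw [cosProfile, mul_comm]
  exact h1.sin.deriv

theorem sinProfile_b (m : ℕ) : S.sinProfile m S.b = 0 := by simp [sinProfile]

theorem sinProfile_d (m : ℕ) : S.sinProfile m S.d = 0 := by
  have h : S.d - S.b ≠ 0 := (sub_pos.2 S.b_lt_d).ne'
  rw [sinProfile, mul_div_assoc, div_self h, mul_one, Real.sin_nat_mul_pi]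

theorem integral_cos_int (k : ℤ) :
    ∫ t in S.b..S.d, Real.cos (k * Real.pi * (t - S.b) / (S.d - S.b))
      = if k = 0 then S.d - S.b else 0 := by
  have h : S.d - S.b ≠ 0 := (sub_pos.2 S.b_lt_d).ne'
  split_ifs with hk
  · simp [hk]
  · have hc : (k * Real.pi / (S.d - S.b)) ≠ 0 :=
      div_ne_zero (mul_ne_zero (by exact_mod_cast hk) Real.pi_ne_zero) h
    have hd : ∀ t ∈ Set.uIcc S.b S.d, HasDerivAt
        (fun t => (k * Real.pi / (S.d - S.b))⁻¹ * Real.sin (k * Real.pi * (t - S.b) / (S.d - S.b)))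
        (Real.cos (k * Real.pi * (t - S.b) / (S.d - S.b))) t := by
      intro t _
      have h1 : HasDerivAt (fun t => k * Real.pi * (t - S.b) / (S.d - S.b))
          (k * Real.pi / (S.d - S.b)) t := by
        refine ((((hasDerivAt_id t).sub_const S.b).const_mul (k * Real.pi)).div_const
          (S.d - S.b)).congr_deriv ?_
        ring
      refine (h1.sin.const_mul _).congr_deriv ?_
      rw [mul_comm (Real.cos _), inv_mul_cancel_left₀ hc]
    rw [intervalIntegral.integral_eq_sub_of_hasDerivAt hd
      (Continuous.intervalIntegrable (by fun_prop) _ _), mul_div_cancel_right₀ _ h,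
      Real.sin_int_mul_pi]
    simp

theorem integral_cosProfile_mul (m l : ℕ) :
    ∫ t in S.b..S.d, S.cosProfile m t * S.cosProfile l t
      = ((if (m : ℤ) - l = 0 then S.d - S.b else 0)
        + if (m : ℤ) + l = 0 then S.d - S.b else 0) / 2 := by
  rw [← integral_cos_int, ← integral_cos_int, ← intervalIntegral.integral_add
    (Continuous.intervalIntegrable (by fun_prop) _ _)
    (Continuous.intervalIntegrable (by fun_prop) _ _), ← intervalIntegral.integral_div]
  refine intervalIntegral.integral_congr fun t _ => ?_
  simp only [cosProfile]
  push_cast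
  rw [show ((m : ℝ) - l) * Real.pi * (t - S.b) / (S.d - S.b)
      = m * Real.pi * (t - S.b) / (S.d - S.b) - l * Real.pi * (t - S.b) / (S.d - S.b) by ring,
    show ((m : ℝ) + l) * Real.pi * (t - S.b) / (S.d - S.b)
      = m * Real.pi * (t - S.b) / (S.d - S.b) + l * Real.pi * (t - S.b) / (S.d - S.b) by ring,
    Real.cos_sub, Real.cos_add]
  ring

theorem integral_sinProfile_mul (m l : ℕ) :
    ∫ t in S.b..S.d, S.sinProfile m t * S.sinProfile l t
      = ((if (m : ℤ) - l = 0 then S.d - S.b else 0)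
        - if (m : ℤ) + l = 0 then S.d - S.b else 0) / 2 := by
  rw [← integral_cos_int, ← integral_cos_int, ← intervalIntegral.integral_sub
    (Continuous.intervalIntegrable (by fun_prop) _ _)
    (Continuous.intervalIntegrable (by fun_prop) _ _), ← intervalIntegral.integral_div]
  refine intervalIntegral.integral_congr fun t _ => ?_
  simp only [sinProfile]
  push_cast
  rw [show ((m : ℝ) - l) * Real.pi * (t - S.b) / (S.d - S.b)
      = m * Real.pi * (t - S.b) / (S.d - S.b) - l * Real.pi * (t - S.b) / (S.d - S.b) by ring,
    show ((m : ℝ) + l) * Real.pi * (t - S.b) / (S.d - S.b)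
      = m * Real.pi * (t - S.b) / (S.d - S.b) + l * Real.pi * (t - S.b) / (S.d - S.b) by ring,
    Real.cos_sub, Real.cos_add]
  ring

/-- The doubly indexed cosine system in `L²` of the cell. -/
def cosMode (i : ℤ × ℕ) : S.L2 :=
  S.mode i.1 (S.cosProfile i.2) (S.contDiff_cosProfile i.2).continuous

/-- The doubly indexed sine system in `L²` of the cell. -/
def sinMode (i : ℤ × ℕ) : S.L2 :=
  S.mode i.1 (S.sinProfile i.2) (S.contDiff_sinProfile i.2).continuous

theorem inner_cosMode_of_ne {i j : ℤ × ℕ} (h : i ≠ j) :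
    inner ℂ (S.cosMode i) (S.cosMode j) = 0 := by
  rw [cosMode, cosMode, inner_mode_mode]
  split_ifs with h1
  · have h2 : i.2 ≠ j.2 := fun h2 => h (Prod.ext h1 h2)
    rw [integral_cosProfile_mul, if_neg (by omega), if_neg (by omega)]
    simp
  · rfl

theorem inner_sinMode_of_ne {i j : ℤ × ℕ} (h : i ≠ j) :
    inner ℂ (S.sinMode i) (S.sinMode j) = 0 := by
  rw [sinMode, sinMode, inner_mode_mode]
  split_ifs with h1
  · have h2 : i.2 ≠ j.2 := fun h2 => h (Prod.ext h1 h2)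
    rw [integral_sinProfile_mul, if_neg (by omega), if_neg (by omega)]
    simp
  · rfl

theorem norm_cosMode_pos (i : ℤ × ℕ) : 0 < ‖S.cosMode i‖ := by
  have hp := S.p_pos
  have hL : 0 < S.d - S.b := sub_pos.2 S.b_lt_d
  have h : 0 < ‖S.cosMode i‖ ^ 2 := by
    rw [cosMode, norm_mode_sq]
    simp only [sq (S.cosProfile i.2 _)]
    rw [integral_cosProfile_mul]
    refine mul_pos hp ?_
    split_ifs <;> first | linarith | omega
  exact lt_of_le_of_ne (norm_nonneg _) fun h0 => by rw [← h0] at h; norm_num at h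

/-- The sine mode of index 0 vanishes and cannot be normalized. Both systems are therefore weighted
by the norms of the cosine modes, for which Bessel's inequality still has constant 1. -/
theorem norm_sinMode_le (i : ℤ × ℕ) : ‖S.sinMode i‖ ^ 2 ≤ ‖S.cosMode i‖ ^ 2 := by
  have hp := S.p_pos
  have hL : 0 < S.d - S.b := sub_pos.2 S.b_lt_d
  rw [cosMode, sinMode, norm_mode_sq, norm_mode_sq]
  simp only [sq (S.cosProfile i.2 _), sq (S.sinProfile i.2 _)]
  rw [integral_cosProfile_mul, integral_sinProfile_mul]
  refine mul_le_mul_of_nonneg_left ?_ hp.le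
  split_ifs <;> linarith

theorem orthonormal_cosMode :
    Orthonormal ℂ fun i : ℤ × ℕ => ((‖S.cosMode i‖⁻¹ : ℝ) : ℂ) • S.cosMode i := by
  refine ⟨fun i => ?_, fun i j hij => ?_⟩
  · rw [norm_smul, Complex.norm_real, norm_inv, norm_norm, inv_mul_cancel₀ (S.norm_cosMode_pos i).ne']
  · simp only [inner_smul_left, inner_smul_right, S.inner_cosMode_of_ne hij, mul_zero]

/-- The exponentials times cosines are complete in `L²` of the cell. -/
theorem eq_zero_of_coef_cosProfile (f : S.L2)
    (h : ∀ (n : ℤ) (m : ℕ), S.coef n (S.cosProfile m) f = 0) : f = 0 := by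
  have hfin := S.cell_finite
  set μ : Measure ℝ := volume.restrict (Set.Ioo 0 S.p) with hμ
  set ν : Measure ℝ := volume.restrict (Set.Ioo S.b S.d) with hν
  have hcell : (volume.restrict S.cell : Measure (ℝ × ℝ)) = μ.prod ν := S.restrict_cell
  obtain ⟨g, hg⟩ : ∃ g : ℝ × ℝ → ℂ, g = f := ⟨_, rfl⟩
  have hgL : MemLp g 2 (μ.prod ν) := by
    rw [hg, ← hcell]; exact Lp.memLp f
  have hgi : Integrable g (μ.prod ν) := hgL.integrable (by norm_num)
  have hg2 : Integrable (fun x => ‖g x‖ ^ 2) (μ.prod ν) :=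
    (memLp_two_iff_integrable_sq_norm hgL.1).1 hgL
  have hwi : ∀ n, Integrable (fun x => g x * S.wave n x.1) (μ.prod ν) := fun n => by
    refine hgi.mul_bdd (c := 1) ((S.continuous_wave n).comp continuous_fst).aestronglyMeasurable
      (ae_of_all _ fun x => (S.norm_wave n x.1).le)
  have hslice : ∀ᵐ t ∂ν, MemLp (fun x => g (x, t)) 2 μ := by
    filter_upwards [hgi.prod_left_ae, hg2.prod_left_ae] with t h1 h2
    exact (memLp_two_iff_integrable_sq_norm h1.1).2 h2
  have hsliceW : ∀ n, ∀ᵐ t ∂ν, MemLp (fun x => g (x, t) * S.wave n x) 2 μ := fun n => by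
    filter_upwards [hslice] with t ht
    have hm : AEStronglyMeasurable (fun x => g (x, t) * S.wave n x) μ :=
      ht.1.mul (S.continuous_wave n).aestronglyMeasurable
    refine ht.of_le hm (ae_of_all _ fun x => ?_)
    rw [norm_mul, norm_wave, mul_one]
  -- The n-th horizontal Fourier coefficient of the slice at height t, up to a constant factor. Its
  -- cosine integrals in t are the given coefficients, so it vanishes for almost every t,
  -- simultaneously for all n by countability.
  let F : ℤ → ℝ → ℂ := fun n t => ∫ x, g (x, t) * S.wave n x ∂μ
  have hFi : ∀ n, Integrable (F n) ν := fun n => (hwi n).integral_prod_right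
  have hFL : ∀ n, MemLp (F n) 2 ν := fun n => by
    refine (memLp_two_iff_integrable_sq_norm (hFi n).1).2 ?_
    refine (hg2.integral_prod_right.const_mul (μ.real Set.univ)).mono' ((hFi n).1.norm.pow 2) ?_
    filter_upwards [hsliceW n] with t ht
    rw [Real.norm_of_nonneg (sq_nonneg _)]
    refine (sq_norm_integral_le ht).trans (le_of_eq ?_)
    simp only [norm_mul, norm_wave, mul_one]
  have hF0 : ∀ n, F n =ᵐ[ν] 0 := fun n => by
    refine ae_eq_zero_of_integral_mul_cos S.b_lt_d (hFL n) fun m => ?_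
    have h1 := h n m
    rw [coef, ← hg, hcell] at h1
    have hi : Integrable (fun x : ℝ × ℝ => g x * (S.cosProfile m x.2 * S.wave n x.1))
        (μ.prod ν) := by
      rw [hg, ← hcell]
      exact S.integrable_coef n (S.contDiff_cosProfile m).continuous f
    rw [integral_prod_symm _ hi] at h1
    refine Eq.trans ?_ h1
    refine integral_congr_ae (ae_of_all _ fun t => ?_)
    simp only [F, ← integral_mul_const]
    refine integral_congr_ae (ae_of_all _ fun x => ?_)
    simp only [cosProfile]
    ring
  have hall : ∀ᵐ t ∂ν, ∀ n, F n t = 0 := ae_all_iff.2 fun n => hF0 n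
  have hz : ∀ᵐ t ∂ν, ∫ x, ‖g (x, t)‖ ^ 2 ∂μ = 0 := by
    filter_upwards [hall, hsliceW 0] with t ht hL
    -- Multiplication by exp(-iα₀x) turns the quasi-periodic exponentials into the ordinary Fourier
    -- system of period p without changing the modulus.
    have hioc : MemLp (fun x => g (x, t) * S.wave 0 x) 2 (volume.restrict (Set.Ioc 0 S.p)) := by
      rwa [← restrict_Ioo_eq_restrict_Ioc]
    have h0 := ae_eq_zero_of_fourierCoeffOn S.p_pos hioc (fun n => by
      rw [fourierCoeffOn_eq_integral]
      refine smul_eq_zero_of_right _ ?_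
      rw [intervalIntegral.integral_of_le S.p_pos.le, integral_Ioc_eq_integral_Ioo]
      refine Eq.trans ?_ (ht n)
      refine integral_congr_ae (ae_of_all _ fun x => ?_)
      simp only [fourier_coe_apply, smul_eq_mul, wave]
      rw [mul_left_comm, ← Complex.exp_add]
      congr 2
      simp only [α]
      push_cast
      ring)
    rw [← restrict_Ioo_eq_restrict_Ioc] at h0
    refine integral_eq_zero_of_ae ?_
    filter_upwards [h0] with x hx
    have hw : S.wave 0 x ≠ 0 := norm_ne_zero_iff.1 (by rw [norm_wave]; exact one_ne_zero)
    have : g (x, t) = 0 := (mul_eq_zero.1 hx).resolve_right hw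
    simp [this]
  have hnorm : ∫ x, ‖g x‖ ^ 2 ∂(μ.prod ν) = 0 := by
    rw [integral_prod_symm _ hg2]
    exact integral_eq_zero_of_ae hz
  rw [integral_eq_zero_iff_of_nonneg (fun _ => sq_nonneg _) hg2] at hnorm
  rw [Lp.eq_zero_iff_ae_eq_zero, ← hg, hcell]
  filter_upwards [hnorm] with x hx
  simpa using hx

/-- The normalized Hilbert basis of exponentials times cosines. -/
def cosBasis : HilbertBasis (ℤ × ℕ) ℂ S.L2 :=
  HilbertBasis.mkOfOrthogonalEqBot S.orthonormal_cosMode (by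
    rw [Submodule.eq_bot_iff]
    intro f hf
    refine S.eq_zero_of_coef_cosProfile f fun n m => ?_
    have h1 := (Submodule.mem_orthogonal _ _).1 hf _
      (Submodule.subset_span (Set.mem_range_self (n, m)))
    simp only [inner_smul_left, Complex.conj_ofReal] at h1
    have h2 : (((‖S.cosMode (n, m)‖⁻¹ : ℝ) : ℂ)) ≠ 0 := by
      exact_mod_cast inv_ne_zero (S.norm_cosMode_pos _).ne'
    have h3 := (mul_eq_zero.1 h1).resolve_left h2
    rwa [cosMode, inner_mode] at h3)

/-- The embedding of `H¹` into `L²`. -/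
def embedding : S.H1 →L[ℂ] S.L2 :=
  (PiLp.proj 2 (fun _ : Fin 3 => S.L2) 0).comp S.H1.subtypeL

theorem embedding_apply (u : S.H1) : S.embedding u = u.1 0 := rfl

/-- The cosine coefficients of ∂₁u are iαₙ times those of u. The sine coefficients of ∂₂u are
-mπ/(d-b) times the cosine coefficients of u, with no boundary term because the sines vanish at both
ends. Hence the weights αₙ² + (mπ/(d-b))² sum to at most ‖∇u‖². -/
theorem isCompactOperator_embedding : IsCompactOperator S.embedding := by
  have hL : 0 < S.d - S.b := sub_pos.2 S.b_lt_d
  let D : ℤ × ℕ → ℝ := fun i => S.α i.1 ^ 2 + (i.2 * Real.pi / (S.d - S.b)) ^ 2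
  have hD0 : ∀ i, 0 ≤ D i := fun i => by positivity
  have hD : Tendsto D cofinite atTop := by
    rw [tendsto_atTop]
    intro R
    have h1 : {n : ℤ | ¬ (|R| + 1 ≤ |S.α n|)}.Finite :=
      Filter.eventually_cofinite.1 (S.tendsto_abs_α.eventually_ge_atTop (|R| + 1))
    have h2t : Tendsto (fun m : ℕ => m * Real.pi / (S.d - S.b)) cofinite atTop := by
      rw [Nat.cofinite_eq_atTop]
      exact (tendsto_natCast_atTop_atTop.atTop_mul_const Real.pi_pos).atTop_div_const hL
    have h2 : {m : ℕ | ¬ (|R| + 1 ≤ m * Real.pi / (S.d - S.b))}.Finite :=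
      Filter.eventually_cofinite.1 (h2t.eventually_ge_atTop (|R| + 1))
    rw [Filter.eventually_cofinite]
    refine (h1.prod h2).subset fun i hi => ⟨fun hi1 => hi ?_, fun hi2 => hi ?_⟩
    · have h3 : (|R| + 1) ^ 2 ≤ |S.α i.1| ^ 2 := by gcongr
      rw [sq_abs] at h3
      have := sq_nonneg (i.2 * Real.pi / (S.d - S.b))
      have := le_abs_self R
      have := abs_nonneg R
      simp only [D]
      nlinarith
    · have h3 : (|R| + 1) ^ 2 ≤ (i.2 * Real.pi / (S.d - S.b)) ^ 2 := by gcongr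
      have := sq_nonneg (S.α i.1)
      have := le_abs_self R
      have := abs_nonneg R
      simp only [D]
      nlinarith
  refine isCompactOperator_of_weighted_coefficients S.cosBasis S.embedding hD (C := 1) hD0
    fun u s => ?_
  let a : ℤ × ℕ → ℝ := fun i => (‖S.cosMode i‖ ^ 2)⁻¹
  have ha : ∀ i, 0 ≤ a i := fun i => by positivity
  have hcos := weighted_bessel (v := S.cosMode) (fun i j h => S.inner_cosMode_of_ne h) ha
    zero_le_one (fun i => by
      rw [inv_mul_cancel₀ (pow_ne_zero 2 (S.norm_cosMode_pos i).ne')]) s (u.1 1)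
  have hsin := weighted_bessel (v := S.sinMode) (fun i j h => S.inner_sinMode_of_ne h) ha
    zero_le_one (fun i => by
      rw [inv_mul_le_one₀ (pow_pos (S.norm_cosMode_pos i) 2)]
      exact S.norm_sinMode_le i) s (u.1 2)
  have hterm : ∀ i, D i * ‖inner ℂ (S.cosBasis i) (S.embedding u)‖ ^ 2
      = a i * ‖inner ℂ (S.cosMode i) (u.1 1)‖ ^ 2 + a i * ‖inner ℂ (S.sinMode i) (u.1 2)‖ ^ 2 := by
    intro i
    have e1 : S.cosBasis i = ((‖S.cosMode i‖⁻¹ : ℝ) : ℂ) • S.cosMode i := by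
      rw [cosBasis, HilbertBasis.coe_mkOfOrthogonalEqBot]
    have h1 := coef_d₁ u i.1 (S.contDiff_cosProfile i.2)
    have h2 := coef_d₂ u i.1 (S.contDiff_sinProfile i.2) (S.sinProfile_b i.2) (S.sinProfile_d i.2)
    rw [deriv_sinProfile, coef_const_mul] at h2
    have h2' := eq_neg_of_add_eq_zero_right h2
    simp only [d₁, d₂, val] at h1 h2'
    rw [e1, inner_smul_left, embedding_apply, cosMode, sinMode, inner_mode, inner_mode, inner_mode,
      h1, h2', norm_mul, norm_mul, norm_mul, norm_neg, norm_mul, Complex.norm_I, RCLike.norm_conj,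
      Complex.norm_real, Complex.norm_real, Complex.norm_real, norm_inv, norm_norm]
    simp only [a, D, mul_pow, Real.norm_eq_abs, sq_abs, inv_pow, one_pow, cosMode]
    ring
  simp only [hterm]
  rw [Finset.sum_add_distrib, one_mul, norm_H1_sq]
  rw [one_mul] at hcos hsin
  have := sq_nonneg ‖(u.1 0 : S.L2)‖
  linarith

end GratingProblem

/-! ### Bounded sesquilinear forms -/

theorem exists_continuous_form {E H : Type*} [NormedAddCommGroup E] [NormedSpace ℂ E]
    [NormedAddCommGroup H] [NormedSpace ℂ H] (B : E → H → ℂ)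
    (h1 : ∀ u u' v, B (u + u') v = B u v + B u' v) (h2 : ∀ (c : ℂ) u v, B (c • u) v = c * B u v)
    (h3 : ∀ u v v', B u (v + v') = B u v + B u v') (h4 : ∀ (c : ℂ) u v, B u (c • v) = conj c * B u v)
    {C : ℝ} (hC : ∀ u v, ‖B u v‖ ≤ C * ‖u‖ * ‖v‖) :
    ∃ B' : E →L[ℂ] H →L⋆[ℂ] ℂ, ∀ u v, B u v = B' u v :=
  ⟨(LinearMap.mk₂'ₛₗ (RingHom.id ℂ) (starRingEnd ℂ) B h1 h2 h3 h4).mkContinuous₂ C hC,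
    fun _ _ => rfl⟩

section WeightedSums

variable {H : Type*} [NormedAddCommGroup H] [NormedSpace ℂ H]

/-- Cauchy–Schwarz with the weight split as √w · √w. With w = |n| + 1 it turns the trace inequality
and linear growth of the multipliers into bounded boundary forms. -/
theorem weighted_sum_mul_le {ι : Type*} {w : ι → ℝ} (hw : ∀ n, 0 ≤ w n) {K : ℝ} (hK : 0 ≤ K)
    {φ : ι → H →L[ℂ] ℂ} (hφ : ∀ (u : H) (s : Finset ι), ∑ n ∈ s, w n * ‖φ n u‖ ^ 2 ≤ K * ‖u‖ ^ 2)
    {t : ι → ℂ} {M : ℝ} (hM : 0 ≤ M) (ht : ∀ n, ‖t n‖ ≤ M * w n) (u v : H) (s : Finset ι) :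
    ∑ n ∈ s, ‖t n * φ n u * conj (φ n v)‖ ≤ M * K * ‖u‖ * ‖v‖ := by
  have h1 : (∑ n ∈ s, w n * (‖φ n u‖ * ‖φ n v‖)) ≤ K * ‖u‖ * ‖v‖ := by
    refine le_of_sq_le_sq ?_ (by positivity)
    have h2 := Finset.sum_mul_sq_le_sq_mul_sq s (fun n => √(w n) * ‖φ n u‖)
      (fun n => √(w n) * ‖φ n v‖)
    have h3 : ∀ n, √(w n) * ‖φ n u‖ * (√(w n) * ‖φ n v‖) = w n * (‖φ n u‖ * ‖φ n v‖) := fun n => by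
      rw [mul_mul_mul_comm, Real.mul_self_sqrt (hw n)]
    simp only [h3, mul_pow, Real.sq_sqrt (hw _)] at h2
    refine h2.trans ((mul_le_mul (hφ u s) (hφ v s)
      (Finset.sum_nonneg fun n _ => mul_nonneg (hw n) (sq_nonneg _)) (by positivity)).trans
      (le_of_eq ?_))
    ring
  calc ∑ n ∈ s, ‖t n * φ n u * conj (φ n v)‖ ≤ ∑ n ∈ s, M * (w n * (‖φ n u‖ * ‖φ n v‖)) := by
        refine Finset.sum_le_sum fun n _ => ?_
        rw [norm_mul, norm_mul, RCLike.norm_conj, mul_assoc, ← mul_assoc M]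
        exact mul_le_mul_of_nonneg_right (ht n) (by positivity)
    _ = M * ∑ n ∈ s, w n * (‖φ n u‖ * ‖φ n v‖) := by rw [Finset.mul_sum]
    _ ≤ M * (K * ‖u‖ * ‖v‖) := by gcongr
    _ = _ := by ring

theorem summable_weighted_sum {ι : Type*} {w : ι → ℝ} (hw : ∀ n, 0 ≤ w n) {K : ℝ} (hK : 0 ≤ K)
    {φ : ι → H →L[ℂ] ℂ} (hφ : ∀ (u : H) (s : Finset ι), ∑ n ∈ s, w n * ‖φ n u‖ ^ 2 ≤ K * ‖u‖ ^ 2)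
    {t : ι → ℂ} {M : ℝ} (hM : 0 ≤ M) (ht : ∀ n, ‖t n‖ ≤ M * w n) (u v : H) :
    Summable fun n => t n * φ n u * conj (φ n v) :=
  Summable.of_norm (summable_of_sum_le (fun _ => norm_nonneg _)
    (weighted_sum_mul_le hw hK hφ hM ht u v))

theorem exists_continuous_weighted_sum {ι : Type*} {w : ι → ℝ} (hw : ∀ n, 0 ≤ w n) {K : ℝ}
    (hK : 0 ≤ K) {φ : ι → H →L[ℂ] ℂ}
    (hφ : ∀ (u : H) (s : Finset ι), ∑ n ∈ s, w n * ‖φ n u‖ ^ 2 ≤ K * ‖u‖ ^ 2)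
    {t : ι → ℂ} {M : ℝ} (hM : 0 ≤ M) (ht : ∀ n, ‖t n‖ ≤ M * w n) :
    ∃ B' : H →L[ℂ] H →L⋆[ℂ] ℂ, ∀ u v, ∑' n, t n * φ n u * conj (φ n v) = B' u v := by
  have hs := summable_weighted_sum hw hK hφ hM ht
  refine exists_continuous_form (fun u v => ∑' n, t n * φ n u * conj (φ n v))
    (fun u u' v => ?_) (fun c u v => ?_) (fun u v v' => ?_) (fun c u v => ?_) (C := M * K)
    fun u v => ?_
  · rw [← (hs u v).tsum_add (hs u' v)]
    refine tsum_congr fun n => ?_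
    rw [map_add]; ring
  · rw [← tsum_mul_left]
    refine tsum_congr fun n => ?_
    rw [map_smul, smul_eq_mul]; ring
  · rw [← (hs u v).tsum_add (hs u v')]
    refine tsum_congr fun n => ?_
    rw [map_add, map_add]; ring
  · rw [← tsum_mul_left]
    refine tsum_congr fun n => ?_
    rw [map_smul, smul_eq_mul, map_mul]; ring
  · have hb := weighted_sum_mul_le hw hK hφ hM ht u v
    have hn := summable_of_sum_le (fun _ => norm_nonneg _) hb
    exact (norm_tsum_le_tsum_norm hn).trans (hn.tsum_le_of_sum_le hb)

/-- Each summand has rank one: u is mapped to t φ(u) times the fixed antilinear functional conj ∘ φ.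
-/
theorem exists_compact_finite_sum {ι : Type*} (s : Finset ι) (φ : ι → H →L[ℂ] ℂ) (t : ι → ℂ) :
    ∃ Q' : H →L[ℂ] H →L⋆[ℂ] ℂ, (∀ u v, ∑ n ∈ s, t n * φ n u * conj (φ n v) = Q' u v) ∧
      IsCompactOperator Q' := by
  let ψ : ι → H →L⋆[ℂ] ℂ := fun n => ((starL ℂ : ℂ ≃L⋆[ℂ] ℂ) : ℂ →L⋆[ℂ] ℂ).comp (φ n)
  let Q : ι → H →L[ℂ] H →L⋆[ℂ] ℂ := fun n => (t n • φ n).smulRight (ψ n)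
  have hQ : ∀ u, (∑ n ∈ s, Q n) u = ∑ n ∈ s, Q n u := fun u => by
    simp only [sum_apply]
  refine ⟨∑ n ∈ s, Q n, fun u v => ?_, ?_⟩
  · rw [hQ, sum_apply]
    rfl
  · rw [show ⇑(∑ n ∈ s, Q n) = fun u => ∑ n ∈ s, Q n u from funext hQ]
    exact IsCompactOperator.finset_sum s (fun n => (Q n : H → H →L⋆[ℂ] ℂ))
      fun n _ => isCompactOperator_smulRight _ _

end WeightedSums

namespace GratingProblem

variable {S : GratingProblem}

/-! ### The Fourier coefficients of the traces as functionals -/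

theorem exists_coef_clm (S : GratingProblem) (n : ℤ) {ρ : ℝ → ℝ} (hρ : ContDiff ℝ ∞ ρ) :
    ∃ φ : S.H1 →L[ℂ] ℂ, ∀ u,
      ((1 / S.p : ℝ) : ℂ) * (S.coef n (deriv ρ) (val u) + S.coef n ρ (d₂ u)) = φ u := by
  let π : Fin 3 → S.H1 →L[ℂ] S.L2 := fun i =>
    (PiLp.proj 2 (fun _ : Fin 3 => S.L2) i).comp S.H1.subtypeL
  refine ⟨((1 / S.p : ℝ) : ℂ) • ((innerSL ℂ (S.mode n (deriv ρ) (hρ.continuous_deriv (by simp)))).comp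
    (π 0) + (innerSL ℂ (S.mode n ρ hρ.continuous)).comp (π 2)), fun u => ?_⟩
  have h1 := S.inner_mode n (hρ.continuous_deriv (by simp)) (u.1 0)
  have h2 := S.inner_mode n hρ.continuous (u.1 2)
  exact congrArg _ (congrArg₂ _ h1.symm h2.symm)

theorem exists_topCoeff_clm (S : GratingProblem) :
    ∃ φ : ℤ → S.H1 →L[ℂ] ℂ, ∀ u n, topCoeff u n = φ n u := by
  have h : S.d - S.b ≠ 0 := (sub_pos.2 S.b_lt_d).ne'
  have hρ : ContDiff ℝ ∞ fun t : ℝ => (t - S.b) / (S.d - S.b) := by fun_prop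
  choose φ hφ using fun n => S.exists_coef_clm n hρ
  refine ⟨φ, fun u n => ?_⟩
  rw [← hφ, topCoeff_eq u n hρ (by simp) (div_self h)]

theorem exists_bottomCoeff_clm (S : GratingProblem) :
    ∃ φ : ℤ → S.H1 →L[ℂ] ℂ, ∀ u n, bottomCoeff u n = φ n u := by
  have h : S.d - S.b ≠ 0 := (sub_pos.2 S.b_lt_d).ne'
  have hρ : ContDiff ℝ ∞ fun t : ℝ => (t - S.d) / (S.d - S.b) := by fun_prop
  choose φ hφ using fun n => S.exists_coef_clm n hρ
  refine ⟨φ, fun u n => ?_⟩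
  rw [← hφ, bottomCoeff_eq u n hρ (by rw [← neg_sub, neg_div, div_self h]) (by simp)]

/-! ### Growth and signs of the multipliers -/

theorem re_I_mul_β_nonpos (S : GratingProblem) (n : ℤ) : (Complex.I * S.β n).re ≤ 0 := by
  rw [β]
  split_ifs
  · simp
  · rw [← mul_assoc, Complex.I_mul_I, neg_one_mul, Complex.neg_re, Complex.ofReal_re]
    exact neg_nonpos.2 (Real.sqrt_nonneg _)

theorem norm_β_le (S : GratingProblem) (n : ℤ) : ‖S.β n‖ ≤ S.k + |S.α n| := by
  have hk := S.k_pos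
  rw [β]
  split_ifs
  · rw [Complex.norm_real, Real.norm_of_nonneg (Real.sqrt_nonneg _)]
    have : √(S.k ^ 2 - S.α n ^ 2) ≤ S.k := Real.sqrt_le_iff.2 ⟨hk.le, by nlinarith [sq_nonneg (S.α n)]⟩
    linarith [abs_nonneg (S.α n)]
  · rw [norm_mul, Complex.norm_I, one_mul, Complex.norm_real,
      Real.norm_of_nonneg (Real.sqrt_nonneg _)]
    have : √(S.α n ^ 2 - S.k ^ 2) ≤ |S.α n| :=
      Real.sqrt_le_iff.2 ⟨abs_nonneg _, by rw [sq_abs]; nlinarith [sq_nonneg S.k]⟩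
    linarith

theorem exists_β_bound (S : GratingProblem) :
    ∃ M : ℝ, 0 ≤ M ∧ ∀ n : ℤ, ‖Complex.I * S.β n‖ ≤ M * (|(n : ℝ)| + 1) := by
  have hp := S.p_pos
  have hk := S.k_pos
  refine ⟨S.k + (|S.αhat| + 2 * Real.pi / S.p), by positivity, fun n => ?_⟩
  rw [norm_mul, Complex.norm_I, one_mul]
  have h1 := S.norm_β_le n
  have h2 := S.abs_α_le n
  have := mul_nonneg hk.le (abs_nonneg (n : ℝ))
  nlinarith

theorem exists_downwardCoefficient_bound {N : ℕ}
    (hN : ∀ n : ℤ, (N : ℤ) < |n| → ‖S.downwardCoefficient n‖ ≤ |S.α n|) :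
    ∃ M : ℝ, 0 ≤ M ∧ ∀ n : ℤ, ‖S.downwardCoefficient n‖ ≤ M * (|(n : ℝ)| + 1) := by
  have hp := S.p_pos
  set Z : ℝ := ∑ n ∈ Finset.Icc (-(N : ℤ)) N, ‖S.downwardCoefficient n‖ with hZ
  have hZ0 : 0 ≤ Z := Finset.sum_nonneg fun _ _ => norm_nonneg _
  refine ⟨Z + (|S.αhat| + 2 * Real.pi / S.p), by positivity, fun n => ?_⟩
  have h0 : (0 : ℝ) ≤ |(n : ℝ)| := abs_nonneg _
  rcases lt_or_ge (N : ℤ) |n| with h | h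
  · have := (hN n h).trans (S.abs_α_le n)
    have := mul_nonneg hZ0 h0
    nlinarith
  · have h1 : ‖S.downwardCoefficient n‖ ≤ Z :=
      Finset.single_le_sum (f := fun n => ‖S.downwardCoefficient n‖) (fun _ _ => norm_nonneg _)
        (Finset.mem_Icc.2 (abs_le.1 h))
    have h2 : (0 : ℝ) ≤ |S.αhat| + 2 * Real.pi / S.p := by positivity
    nlinarith

/-! ### The volume terms -/

theorem integrable_mul_conj (f g : S.L2) :
    Integrable (fun x => f x * conj (g x)) (volume.restrict S.cell) := by
  refine (L2.integrable_inner (𝕜 := ℂ) g f).congr (ae_of_all _ fun x => ?_)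
  simp only [RCLike.inner_apply]

theorem inner_eq_integral (f g : S.L2) : inner ℂ g f = ∫ x in S.cell, f x * conj (g x) := by
  rw [L2.inner_def]
  refine integral_congr_ae (ae_of_all _ fun x => ?_)
  simp only [RCLike.inner_apply]

theorem integral_gradient_eq_inner (u v : S.H1) :
    ∫ x in S.cell, (d₁ u x * conj (d₁ v x) + d₂ u x * conj (d₂ v x) + val u x * conj (val v x))
      = inner ℂ v u := by
  have h : inner ℂ v u = ∑ i : Fin 3, inner ℂ (v.1 i : S.L2) (u.1 i) := PiLp.inner_apply v.1 u.1
  have h1 := integrable_mul_conj (u.1 1) (v.1 1)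
  have h2 := integrable_mul_conj (u.1 2) (v.1 2)
  have h0 := integrable_mul_conj (u.1 0) (v.1 0)
  rw [h, Fin.sum_univ_three, inner_eq_integral, inner_eq_integral, inner_eq_integral]
  exact (integral_add (h1.add h2) h0).trans
    ((congrArg (· + _) (integral_add h1 h2)).trans (by ring))

theorem memLp_weight (S : GratingProblem) :
    MemLp (fun x => (S.k : ℂ) ^ 2 * S.refractiveIndex x + 1) ⊤ (volume.restrict S.cell) := by
  have := S.cell_finite
  have hsub : S.cell ⊆ Set.univ ×ˢ Set.Ioo S.b S.d := fun x hx => ⟨trivial, hx.2⟩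
  have hq : MemLp S.q₀ ⊤ (volume.restrict S.cell) :=
    S.q₀_bounded.mono_measure (Measure.restrict_mono hsub le_rfl)
  have h1 : MemLp (fun x => (S.k : ℂ) ^ 2 * S.q₀ x + 1) ⊤ (volume.restrict S.cell) :=
    (hq.const_mul _).add (memLp_top_const _)
  refine h1.ae_eq ?_
  filter_upwards [ae_restrict_mem (measurableSet_Ioo.prod measurableSet_Ioo)] with x hx
  have hx2 : x.2 ∈ Set.Ioo S.b S.d := hx.2
  simp only [refractiveIndex, if_neg (not_lt.2 hx2.2.le), if_pos hx2.1]

/-- Multiplication by `k² q̃ + 1`. -/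
theorem exists_weight_clm (S : GratingProblem) : ∃ W : S.L2 →L[ℂ] S.L2, ∀ f : S.L2,
    W f =ᵐ[volume.restrict S.cell]
      fun x => ((S.k : ℂ) ^ 2 * S.refractiveIndex x + 1) * f x := by
  refine ⟨(ContinuousLinearMap.mul ℂ ℂ).holderL (volume.restrict S.cell) ⊤ 2 2
    S.memLp_weight.toLp, fun f => ?_⟩
  filter_upwards [(ContinuousLinearMap.mul ℂ ℂ).coeFn_holder (r := 2) S.memLp_weight.toLp f,
    S.memLp_weight.coeFn_toLp] with x hx hx2
  exact hx.trans (by rw [hx2]; rfl)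

/-- The induced operator factors through the compact embedding into L²; multiplication by the
bounded weight and pairing with v are continuous. -/
theorem exists_compact_weight_form (S : GratingProblem) :
    ∃ Q' : S.H1 →L[ℂ] S.H1 →L⋆[ℂ] ℂ, (∀ u v, ∫ x in S.cell,
      ((S.k : ℂ) ^ 2 * S.refractiveIndex x + 1) * val u x * conj (val v x) = Q' u v) ∧
      IsCompactOperator Q' := by
  obtain ⟨W, hW⟩ := S.exists_weight_clm
  obtain ⟨B, hB⟩ := exists_continuous_form (E := S.L2) (H := S.H1)
    (fun f v => inner ℂ (S.embedding v) f)
    (fun f f' v => inner_add_right _ _ _) (fun c f v => inner_smul_right _ _ _)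
    (fun f v v' => by rw [map_add, inner_add_left])
    (fun c f v => by rw [map_smul, inner_smul_left]) (C := ‖S.embedding‖) (fun f v => by
      refine (norm_inner_le_norm _ _).trans ?_
      refine (mul_le_mul_of_nonneg_right (S.embedding.le_opNorm v) (norm_nonneg _)).trans
        (le_of_eq (by ring)))
  refine ⟨(B.comp W).comp S.embedding, fun u v => ?_, ?_⟩
  · have h : (((B.comp W).comp S.embedding) u) v = inner ℂ (S.embedding v) (W (S.embedding u)) :=
      (hB _ _).symm
    rw [h, inner_eq_integral]
    refine integral_congr_ae ?_
    filter_upwards [hW (S.embedding u)] with x hx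
    rw [hx]
    rfl
  · exact S.isCompactOperator_embedding.clm_comp (B.comp W)

theorem integral_form_eq (u v : S.H1) :
    ∫ x in S.cell, (d₁ u x * conj (d₁ v x) + d₂ u x * conj (d₂ v x)
      - (S.k : ℂ) ^ 2 * S.refractiveIndex x * val u x * conj (val v x))
      = (∫ x in S.cell, (d₁ u x * conj (d₁ v x) + d₂ u x * conj (d₂ v x)
          + val u x * conj (val v x)))
        - ∫ x in S.cell, ((S.k : ℂ) ^ 2 * S.refractiveIndex x + 1) * val u x * conj (val v x) := by
  obtain ⟨W, hW⟩ := S.exists_weight_clm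
  have h1 := integrable_mul_conj (u.1 1) (v.1 1)
  have h2 := integrable_mul_conj (u.1 2) (v.1 2)
  have h0 := integrable_mul_conj (u.1 0) (v.1 0)
  have h3 : Integrable (fun x => ((S.k : ℂ) ^ 2 * S.refractiveIndex x + 1) * val u x
      * conj (val v x)) (volume.restrict S.cell) := by
    refine (integrable_mul_conj (W (u.1 0)) (v.1 0)).congr ?_
    filter_upwards [hW (u.1 0)] with x hx
    rw [hx]
    rfl
  have h4 : Integrable (fun x => d₁ u x * conj (d₁ v x) + d₂ u x * conj (d₂ v x)
      + val u x * conj (val v x)) (volume.restrict S.cell) := (h1.add h2).add h0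
  rw [← integral_sub h4 h3]
  refine integral_congr_ae (ae_of_all _ fun x => ?_)
  ring

end GratingProblem


end

/-! ### Splitting of the form and proof of the theorem -/

open GratingProblem in
theorem mainTheorem3 (S : GratingProblem) (hA : S.AssumptionA)
    (hb : ∀ n : ℤ, S.downwardMode n S.b ≠ 0) :
    (∀ u v : S.H1,
      Summable (fun n : ℤ => S.T (GratingProblem.topCoeff u) n
        * (starRingEnd ℂ) (GratingProblem.topCoeff v n)) ∧
      Summable (fun n : ℤ => S.Tminus (GratingProblem.bottomCoeff u) n
        * (starRingEnd ℂ) (GratingProblem.bottomCoeff v n))) ∧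
    IsStronglyElliptic S.form ∧
    ∃ N : ℕ,
      (∀ n : ℤ, (N : ℤ) < |n| →
        (S.downwardCoefficient n).im = 0 ∧ (S.downwardCoefficient n).re < 0) ∧
      IsCoerciveForm (S.principalForm N) ∧
      IsCompactForm (S.lowerOrderForm N) ∧
      ∀ u v : S.H1, S.form u v = S.principalForm N u v - S.lowerOrderForm N u v := by
  obtain ⟨N, hN⟩ := S.exists_hillPotential_le
  have hest := fun n hn => downwardCoefficient_estimate (hN n hn) (hb n)
  obtain ⟨φ, hφ⟩ := S.exists_topCoeff_clm
  obtain ⟨ψ, hψ⟩ := S.exists_bottomCoeff_clm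
  obtain ⟨K, hK0, hK⟩ := S.exists_coeff_bound
  obtain ⟨Mβ, hMβ0, hMβ⟩ := S.exists_β_bound
  obtain ⟨Mτ, hMτ0, hMτ⟩ := exists_downwardCoefficient_bound fun n hn => (hest n hn).2.2
  have hw : ∀ n : ℤ, (0 : ℝ) ≤ |(n : ℝ)| + 1 := fun n => by positivity
  have hKφ : ∀ (u : S.H1) (s : Finset ℤ), ∑ n ∈ s, (|(n : ℝ)| + 1) * ‖φ n u‖ ^ 2 ≤ K * ‖u‖ ^ 2 :=
    fun u s => by simpa only [hφ] using (hK u s).1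
  have hKψ : ∀ (u : S.H1) (s : Finset ℤ), ∑ n ∈ s, (|(n : ℝ)| + 1) * ‖ψ n u‖ ^ 2 ≤ K * ‖u‖ ^ 2 :=
    fun u s => by simpa only [hψ] using (hK u s).2
  let τh : ℤ → ℂ := fun n => if (N : ℤ) < |n| then S.downwardCoefficient n else 0
  let τl : ℤ → ℂ := fun n => if (N : ℤ) < |n| then 0 else S.downwardCoefficient n
  have hτh : ∀ n, ‖τh n‖ ≤ Mτ * (|(n : ℝ)| + 1) := fun n => by
    simp only [τh]
    split_ifs
    · exact hMτ n
    · rw [norm_zero]; positivity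
  have hτl : ∀ n, ‖τl n‖ ≤ Mτ * (|(n : ℝ)| + 1) := fun n => by
    simp only [τl]
    split_ifs
    · rw [norm_zero]; positivity
    · exact hMτ n
  have hsT := summable_weighted_sum hw hK0 hKφ hMβ0 hMβ
  have hsτ := summable_weighted_sum hw hK0 hKψ hMτ0 hMτ
  have hsh := summable_weighted_sum hw hK0 hKψ hMτ0 hτh
  have hsl := summable_weighted_sum hw hK0 hKψ hMτ0 hτl
  have hpT : ∀ u v : S.H1, S.pairing (S.T (topCoeff u)) (topCoeff v)
      = S.p * ∑' n, Complex.I * S.β n * φ n u * conj (φ n v) := fun u v => by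
    simp only [pairing, T, hφ]
  have hpτ : ∀ u v : S.H1, S.pairing (S.Tminus (bottomCoeff u)) (bottomCoeff v)
      = S.p * ∑' n, S.downwardCoefficient n * ψ n u * conj (ψ n v) := fun u v => by
    simp only [pairing, Tminus, hψ]
  have hph : ∀ u v : S.H1, S.pairing (S.TminusHigh N (bottomCoeff u)) (bottomCoeff v)
      = S.p * ∑' n, τh n * ψ n u * conj (ψ n v) := fun u v => by
    simp only [pairing, TminusHigh, Tminus, hψ, τh, ite_mul, zero_mul]
  have hpl : ∀ u v : S.H1, S.pairing (S.TminusLow N (bottomCoeff u)) (bottomCoeff v)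
      = S.p * ∑' n, τl n * ψ n u * conj (ψ n v) := fun u v => by
    simp only [pairing, TminusLow, Tminus, hψ, τl, ite_mul, zero_mul]
  have hsplit : ∀ u v : S.H1, S.form u v = S.principalForm N u v - S.lowerOrderForm N u v := by
    intro u v
    have h1 : ∑' n, S.downwardCoefficient n * ψ n u * conj (ψ n v)
        = ∑' n, τh n * ψ n u * conj (ψ n v) + ∑' n, τl n * ψ n u * conj (ψ n v) := by
      rw [← (hsh u v).tsum_add (hsl u v)]
      refine tsum_congr fun n => ?_
      simp only [τh, τl]
      split_ifs <;> ring
    rw [form, principalForm, lowerOrderForm, integral_form_eq, hpT, hpτ, hph, hpl, h1]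
    ring
  have hcoer : IsCoerciveForm (S.principalForm N) := by
    obtain ⟨B₁, hB₁⟩ := exists_continuous_weighted_sum hw hK0 hKφ hMβ0 hMβ
    obtain ⟨B₂, hB₂⟩ := exists_continuous_weighted_sum hw hK0 hKψ hMτ0 hτh
    -- The constant is 1: the volume term of B(u, u) is ‖u‖², and both subtracted series have
    -- nonpositive real part.
    refine ⟨⟨innerSLFlip ℂ - (S.p : ℂ) • B₁ - (S.p : ℂ) • B₂, fun u v => ?_⟩, 1, one_pos,
      fun u => ?_⟩
    · rw [principalForm, integral_gradient_eq_inner, hpT, hph, hB₁, hB₂]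
      rfl
    · have hself : (inner ℂ u u : ℂ) = ((‖u‖ ^ 2 : ℝ) : ℂ) := by
        rw [Complex.ofReal_pow]
        exact inner_self_eq_norm_sq_to_K u
      rw [principalForm, integral_gradient_eq_inner, hpT, hph, Complex.sub_re, Complex.sub_re,
        Complex.re_ofReal_mul, Complex.re_ofReal_mul, Complex.re_tsum (hsT u u),
        Complex.re_tsum (hsh u u), hself]
      have hre : ∀ (z t : ℂ), (t * z * conj z).re = t.re * ‖z‖ ^ 2 := fun z t => by
        rw [mul_assoc, Complex.mul_conj, Complex.re_mul_ofReal, Complex.normSq_eq_norm_sq]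
      have h1 : ∑' n, (Complex.I * S.β n * φ n u * conj (φ n u)).re ≤ 0 :=
        tsum_nonpos fun n => by
          rw [hre]
          exact mul_nonpos_of_nonpos_of_nonneg (S.re_I_mul_β_nonpos n) (sq_nonneg _)
      have h2 : ∑' n, (τh n * ψ n u * conj (ψ n u)).re ≤ 0 :=
        tsum_nonpos fun n => by
          rw [hre]
          refine mul_nonpos_of_nonpos_of_nonneg ?_ (sq_nonneg _)
          simp only [τh]
          split_ifs with hn
          · exact (hest n hn).2.1.le
          · simp
      have h3 := mul_nonpos_of_nonneg_of_nonpos S.p_pos.le h1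
      have h4 := mul_nonpos_of_nonneg_of_nonpos S.p_pos.le h2
      rw [Complex.ofReal_re]
      linarith
  have hcomp : IsCompactForm (S.lowerOrderForm N) := by
    obtain ⟨Q₁, hQ₁, hc₁⟩ := S.exists_compact_weight_form
    obtain ⟨Q₂, hQ₂, hc₂⟩ := exists_compact_finite_sum (Finset.Icc (-(N : ℤ)) N) ψ τl
    refine ⟨Q₁ + (S.p : ℂ) • Q₂, fun u v => ?_, hc₁.add (hc₂.smul (S.p : ℂ))⟩
    -- Only the modes with |n| ≤ N contribute, so this part of Q has finite rank.
    have h1 : ∑' n, τl n * ψ n u * conj (ψ n v)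
        = ∑ n ∈ Finset.Icc (-(N : ℤ)) N, τl n * ψ n u * conj (ψ n v) := by
      refine tsum_eq_sum fun n hn => ?_
      have h2 : (N : ℤ) < |n| := by
        by_contra h
        exact hn (Finset.mem_Icc.2 (abs_le.1 (not_lt.1 h)))
      simp only [τl, if_pos h2, zero_mul]
    rw [lowerOrderForm, hQ₁, hpl, h1, hQ₂]
    rfl
  refine ⟨fun u v => ⟨?_, ?_⟩, ⟨_, _, hcoer, hcomp, hsplit⟩, N,
    fun n hn => ⟨(hest n hn).1, (hest n hn).2.1⟩, hcoer, hcomp, hsplit⟩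
  · simpa only [T, hφ] using hsT u v
  · simpa only [Tminus, hψ] using hsτ u v
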